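/- **Setting.** Let $\{f(\cdot\mid\psi):\psi\in\Psi\}$ be densities on $\mathbb R^p$ (with respect to a product of $\sigma$-finite measures), $\psi=(\theta,\eta)$, where $\theta\in\mathbb R^k$ is the parameter of interest and $\eta$ is a (possibly absent) finite-dimensional nuisance parameter. For each $n$, $X$ is a dataset of $n$ i.i.d. rows with density $f(\cdot\mid\psi^\star)$, $\psi^\star=(\theta^\star,\eta^\star)$; only the part $X_{\rm obs}$ of its entries is observed, and $X^1,\dots,X^m$ ($m>1$) are completed datasets that agree with $X$ on the observed entries. The true value $\psi^\star=\psi^\star_n$ and the null value $\theta_0=\theta_{0,n}$ may depend on $n$, with $\sqrt n\,A(\theta^\star-\theta_0)\to\delta$ for some vector $\delta$ and some invertible matrix $A$ (local alternatives). For a dataset $Y$ let $\mathcal d(Y)$ be one of the complete-data Wald, likelihood ratio and score statistics of $H_0:\theta=\theta_0$, $$(\hat\theta-\theta_0)^{\mathsf T}\hat V^{-1}(\hat\theta-\theta_0),\qquad 2\log\{f(Y\mid\hat\psi)/f(Y\mid\hat\psi_0)\},\qquad u(\hat\psi_0)^{\mathsf T}I(\hat\psi_0)^{-1}u(\hat\psi_0),$$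 with $\hat\psi=(\hat\theta,\hat\eta)$ and $\hat\psi_0$ the unrestricted and the $H_0$-restricted MLE, $u$ and $I$ the gradient and the negative Hessian of the log-likelihood, and $\hat V$ a variance estimator of $\hat\theta$. Write $\hat\theta^\ell=\hat\theta(X^\ell)$, $\hat V^\ell=\hat V(X^\ell)$, and $\hat\theta_{\rm obs}$ for the observed-data MLE of $\theta$. Let $I_{\rm com}=\mathrm E\{-\partial^2\log f(X\mid\psi)/\partial\theta\partial\theta^{\mathsf T}\}$, $I_{\rm mis}=\mathrm E\{-\partial^2\log f(X\mid X_{\rm obs},\psi)/\partial\theta\partial\theta^{\mathsf T}\}$ (at $\psi=\psi^\star$), $I_{\rm obs}=I_{\rm com}-I_{\rm mis}$, $T=I_{\rm obs}^{-1}$, $V=I_{\rm com}^{-1}$, $B=T-V$. Let $i_{\rm com},i_{\rm mis}$ be the limits of $n^{-1}I_{\rm com},n^{-1}I_{\rm mis}$, let $f_1\ge\dots\ge f_k$ be the eigenvalues of $F=i_{\rm mis}i_{\rm com}^{-1}$ $(=\lim I_{\rm mis}I_{\rm com}^{-1})$, $r_j=f_j/(1-f_j)$, and $R_\tau=\sum_{j=1}^k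 r_j^\tau$. For a non-empty multiset $S$ from $\{1,\dots,m\}$, let $X^S$ be the dataset obtained by stacking the rows of $X^\ell$, $\ell\in S$ (with multiplicity), and $\hat d^S=|S|^{-1}\mathcal d(X^S)$. For non-empty $S_1\ne S_2\subseteq\{1,\dots,m\}$ let $$\hat T_{S_1,S_2}=\frac{|S_1|+|S_2|}{|S_1|+|S_2|-2|S_1\cap S_2|}\Big\{|S_1|\hat d^{S_1}+|S_2|\hat d^{S_2}-(|S_1|+|S_2|)\hat d^{S_1\oplus S_2}\Big\},$$ with $\oplus$ the multiset sum. Let $\mathcal L$ be the set of all pairs $(S_1,S_2)$ of non-empty distinct subsets of $\{1,\dots,m\}$; for a non-empty $\Lambda\subseteq\mathcal L$ and $\tau\in\mathbb N$ let $\hat t_\tau(\Lambda)=|\Lambda|^{-1}\sum_{(S_1,S_2)\in\Lambda}\hat T_{S_1,S_2}^{\,\tau}$. Let $t_\tau=\mathrm E(\mathbb T^\tau)$, where $\mathbb T=\sum_{j=1}^k r_jU_j$ with $U_1,\dots,U_k\sim\chi^2_1$ independent. **Assumptions.** (a) $T^{-1/2}(\hat\theta_{\rm obs}-\theta^\star)\Rightarrow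 N_k(0,I_k)$. (b) The pairs $(\hat\theta^\ell,\hat V^\ell)$, $\ell=1,\dots,m$, are conditionally independent given $X_{\rm obs}$, and for each $\ell$, conditionally on $X_{\rm obs}$ (in probability), $B^{-1/2}(\hat\theta^\ell-\hat\theta_{\rm obs})\Rightarrow N_k(0,I_k)$ and $T^{-1}(\hat V^\ell-V)\to0$ in probability. (c) For all $(S_1,S_2)\in\mathcal L$, the sequence $\hat T_{S_1,S_2}^{2\tau}(n)$ is uniformly integrable: $\lim_{c\to\infty}\sup_n\mathrm E[\hat T_{S_1,S_2}^{2\tau}(n)\mathbf 1\{|\hat T_{S_1,S_2}(n)|>c\}]=0$. (d) Standard likelihood regularity: $\psi^\star$ converges to an interior point $\psi_\infty$ of $\Psi$; the Fisher information matrices of the full parameter $\psi$ (complete data) and of $\theta$ (missing data) exist and, divided by $n$, converge; the limits of the full complete-data information, of $n^{-1}I_{\rm obs}$ and of $nB$ are positive definite; almost surely, at the rows of each $X^\ell$, $f(\cdot\mid\psi)$ is positive and $C^2$ in $\psi$ on a fixed neighbourhood of $\psi_\infty$; and for each single completed dataset $X^\ell$: the observed information per row converges in probability to the limiting complete-data information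 $i$ of $\psi$ uniformly over small neighbourhoods of $\psi_\infty$; the score at $\psi^\star$ is $O_p(\sqrt n)$; and for every $\varepsilon>0$ there is $\kappa>0$ such that, with probability tending to one, $f(X^\ell\mid\psi)\le e^{-n\kappa}f(X^\ell\mid\psi_\infty)$ for all $\psi\in\Psi$ with $\|\psi-\psi_\infty\|\ge\varepsilon$. The variance estimator is $\hat V(Y)=N^{-1}v\big(\hat\psi,N^{-1}\sum_{i=1}^N h(y_i,\hat\psi)\big)$ for a dataset $Y$ with rows $y_1,\dots,y_N$, where the averages of $h(\cdot,\psi)$ over each $X^\ell$ converge in probability, uniformly over small neighbourhoods of $\psi_\infty$, to some $H$, and $v$ is continuous at $(\psi_\infty,H)$ with value the $\theta\theta$-block of $i^{-1}$. **Conclusion.** As $n\to\infty$: (1) $\mathrm E\{\hat t_\tau(\Lambda)\}\to t_\tau$. (2) For $(S_1,S_2),(S_3,S_4)\in\mathcal L$, with $s_a=|S_a|$ and $s_{ab}=|S_a\cap S_b|$, define $$\rho(S_1,S_2,S_3,S_4)=\frac{(s_1s_2s_3s_4)^{1/2}}{(s_1+s_2-2s_{12})^{1/2}(s_3+s_4-2s_{34})^{1/2}}\left(\frac{s_{13}}{s_1s_3}-\frac{s_{14}}{s_1s_4}-\frac{s_{23}}{s_2s_3}+\frac{s_{24}}{s_2s_4}\right).$$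 Then $$\mathrm{Var}\{\hat t_\tau(\Lambda)\}\to\frac1{|\Lambda|^2}\sum_{(S_1,S_2)\in\Lambda}\ \sum_{(S_3,S_4)\in\Lambda}\rho^2(S_1,S_2,S_3,S_4)\,C_\tau(S_1,S_2,S_3,S_4),$$ where the numbers $C_\tau(S_1,S_2,S_3,S_4)$ depend only on $\tau,r_1,\dots,r_k,m$ and the sets $S_1,\dots,S_4$ (not on $\Lambda$ or the model), and $|C_\tau(S_1,S_2,S_3,S_4)|\le C_\tau$ for a finite constant $C_\tau$ depending only on $\tau,r_1,\dots,r_k$. In particular $C_1(S_1,S_2,S_3,S_4)=2R_2$. -/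

import Mathlib

open MeasureTheory ProbabilityTheory Filter Topology
open scoped ENNReal MatrixOrder Matrix

namespace StackedMI

noncomputable section

/-- A row (unit) of a data matrix with `p` columns. -/
abbrev Row (p : ℕ) := Fin p → ℝ

/-- Parameters `ψ = (θ, η)`: `θ` (first block, dimension `k`) is the parameter of interest,
`η` (second block, dimension `q`, possibly `0`) is the nuisance part. -/
abbrev Param (k q : ℕ) := Fin k ⊕ Fin q → ℝ

variable {p k q m n : ℕ}

/-- The sub-vector `θ` of `ψ`. -/
def thetaPart (ψ : Param k q) : Fin k → ℝ := fun j => ψ (Sum.inl j)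

/-- The gradient of `g` at `ψ`. -/
def grad (g : Param k q → ℝ) (ψ : Param k q) : Fin k ⊕ Fin q → ℝ :=
  fun a => fderiv ℝ g ψ (Pi.single a 1)

/-- The Hessian matrix of `g` at `ψ`. -/
def hess (g : Param k q → ℝ) (ψ : Param k q) : Matrix (Fin k ⊕ Fin q) (Fin k ⊕ Fin q) ℝ :=
  Matrix.of fun a b => iteratedFDeriv ℝ 2 g ψ ![Pi.single a 1, Pi.single b 1]

/-! ### The parametric model and complete-data likelihood -/

/-- A parametric model for one unit: a parameter space `Ψ` and densities `f ψ`, `ψ ∈ Ψ`, with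
respect to a product `ν` of σ-finite measures on the columns (Lebesgue, counting, ...). -/
structure Model (p k q : ℕ) where
  ν : Fin p → Measure ℝ
  sigmaFinite : ∀ j, SigmaFinite (ν j)
  Ψ : Set (Param k q)
  f : Param k q → Row p → ℝ
  measurable_f : ∀ ψ ∈ Ψ, Measurable (f ψ)
  f_nonneg : ∀ ψ ∈ Ψ, ∀ x, 0 ≤ f ψ x
  lintegral_f : ∀ ψ ∈ Ψ, ∫⁻ x, ENNReal.ofReal (f ψ x) ∂(Measure.pi ν) = 1

/-- The likelihood `f(X ∣ ψ)` of a dataset, given as the list of its (independent) rows. -/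
def lik (M : Model p k q) (x : List (Row p)) (ψ : Param k q) : ℝ := (x.map (M.f ψ)).prod

/-- The log-likelihood `log f(X ∣ ψ)`. -/
def loglik (M : Model p k q) (x : List (Row p)) (ψ : Param k q) : ℝ := Real.log (lik M x ψ)

/-- The observed information `I(ψ ∣ X) = - ∂² log f(X ∣ ψ) / ∂ψ∂ψᵀ`. -/
def info (M : Model p k q) (x : List (Row p)) (ψ : Param k q) :
    Matrix (Fin k ⊕ Fin q) (Fin k ⊕ Fin q) ℝ := - hess (loglik M x) ψ

/-- `ψ` is a (global) maximum likelihood estimate from the dataset `x`. -/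
def IsMLE (M : Model p k q) (x : List (Row p)) (ψ : Param k q) : Prop :=
  ψ ∈ M.Ψ ∧ ∀ ψ' ∈ M.Ψ, lik M x ψ' ≤ lik M x ψ

/-- `ψ` is a maximum likelihood estimate under the restriction `θ = θ₀`. -/
def IsNullMLE (M : Model p k q) (θ₀ : Fin k → ℝ) (x : List (Row p)) (ψ : Param k q) : Prop :=
  ψ ∈ M.Ψ ∧ thetaPart ψ = θ₀ ∧ ∀ ψ' ∈ M.Ψ, thetaPart ψ' = θ₀ → lik M x ψ' ≤ lik M x ψ

/-- The complete-data estimators used by the analyst.  `psiHat` and `psiNull θ₀` pick the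
unrestricted MLE and the MLE under `θ = θ₀` from every dataset that has one.  The variance
estimator of `θ̂` is of the plug-in form
`V̂(X) = N⁻¹ v (ψ̂(X), N⁻¹ ∑ᵢ h (xᵢ, ψ̂(X)))` for a dataset with `N` rows (inverse observed or
expected information, outer product of scores, sandwich, ...). -/
structure Analyst (M : Model p k q) where
  psiHat : List (Row p) → Param k q
  psiHat_spec : ∀ x, (∃ ψ, IsMLE M x ψ) → IsMLE M x (psiHat x)
  psiNull : (Fin k → ℝ) → List (Row p) → Param k q
  psiNull_spec : ∀ θ₀ x, (∃ ψ, IsNullMLE M θ₀ x ψ) → IsNullMLE M θ₀ x (psiNull θ₀ x)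
  dim : ℕ
  h : Row p → Param k q → Fin dim → ℝ
  v : Param k q → (Fin dim → ℝ) → Matrix (Fin k) (Fin k) ℝ

namespace Analyst

variable {M : Model p k q} (A : Analyst M)

/-- The MLE `θ̂(X)` of `θ`. -/
def thetaHat (x : List (Row p)) : Fin k → ℝ := thetaPart (A.psiHat x)

/-- The variance estimator `V̂(X)` of `θ̂(X)`. -/
def VHat (x : List (Row p)) : Matrix (Fin k) (Fin k) ℝ :=
  (x.length : ℝ)⁻¹ • A.v (A.psiHat x)
    (fun c => (x.length : ℝ)⁻¹ * (x.map fun row => A.h row (A.psiHat x) c).sum)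

end Analyst

/-- The three standard testing devices. -/
inductive Test
  | wald
  | likelihoodRatio
  | score

/-- The complete-data test statistic of `H₀ : θ = θ₀`. -/
def device {M : Model p k q} (A : Analyst M) (θ₀ : Fin k → ℝ) (x : List (Row p)) : Test → ℝ
  | .wald => (A.thetaHat x - θ₀) ⬝ᵥ ((A.VHat x)⁻¹ *ᵥ (A.thetaHat x - θ₀))
  | .likelihoodRatio =>
      2 * Real.log (lik M x (A.psiHat x) / lik M x (A.psiNull θ₀ x))
  | .score =>
      grad (loglik M x) (A.psiNull θ₀ x) ⬝ᵥ
        ((info M x (A.psiNull θ₀ x))⁻¹ *ᵥ grad (loglik M x) (A.psiNull θ₀ x))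

/-! ### Observed-data likelihood -/

/-- Observed data: response indicators (`true` = observed) and the data matrix in which the
missing entries are masked. -/
abbrev ObsData (n p : ℕ) := (Fin n → Fin p → Bool) × (Fin n → Row p)

/-- The missing coordinates of a response pattern. -/
def missing (D : Fin p → Bool) : Finset (Fin p) := Finset.univ.filter fun j => D j = false

/-- Density of the observed part of one unit: the missing coordinates are integrated out. -/
def obsDensity (M : Model p k q) (ψ : Param k q) (D : Fin p → Bool) (x : Row p) : ℝ :=
  (lmarginal M.ν (missing D) (fun y => ENNReal.ofReal (M.f ψ y)) x).toReal

/-- The observed-data likelihood `f(X_obs ∣ ψ)`. -/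
def obsLik (M : Model p k q) (o : ObsData n p) (ψ : Param k q) : ℝ :=
  ∏ i, obsDensity M ψ (o.1 i) (o.2 i)

/-- `ψ` is an observed-data maximum likelihood estimate. -/
def IsObsMLE (M : Model p k q) (o : ObsData n p) (ψ : Param k q) : Prop :=
  ψ ∈ M.Ψ ∧ ∀ ψ' ∈ M.Ψ, obsLik M o ψ' ≤ obsLik M o ψ

/-! ### The sequence of incomplete datasets and their imputations -/

/-- For every sample size `n`: the true parameter `psiStar n`, the null value `theta₀ n`, the
complete data `X n` (i.i.d. rows with density `f (· ∣ psiStar n)`), the response indicators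
`D n`, the `m` completed datasets `Ximp n ℓ`, which agree with `X n` on the observed entries,
and an observed-data MLE.  Letting `psiStar` and `theta₀` depend on `n` covers local
alternatives in either parametrization. -/
structure Imputation (M : Model p k q) (m : ℕ) (Ω : Type*) [MeasurableSpace Ω]
    (P : Measure Ω) where
  psiStar : ℕ → Param k q
  theta₀ : ℕ → Fin k → ℝ
  X : (n : ℕ) → Fin n → Ω → Row p
  D : (n : ℕ) → Ω → Fin n → Fin p → Bool
  Ximp : (n : ℕ) → Fin m → Fin n → Ω → Row p
  psiObs : (n : ℕ) → ObsData n p → Param k q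
  psiStar_mem : ∀ n, psiStar n ∈ M.Ψ
  measurable_X : ∀ n i, Measurable (X n i)
  measurable_D : ∀ n, Measurable (D n)
  measurable_Ximp : ∀ n ℓ i, Measurable (Ximp n ℓ i)
  measurable_psiObs : ∀ n, Measurable (psiObs n)
  indep_X : ∀ n, iIndepFun (X n) P
  law_X : ∀ n i, P.map (X n i) =
    (Measure.pi M.ν).withDensity fun x => ENNReal.ofReal (M.f (psiStar n) x)
  Ximp_obs : ∀ n ℓ i ω j, D n ω i j = true → Ximp n ℓ i ω j = X n i ω j
  psiObs_spec : ∀ n o, (∃ ψ, IsObsMLE M o ψ) → IsObsMLE M o (psiObs n o)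

namespace Imputation

variable {M : Model p k q} {Ω : Type*} [MeasurableSpace Ω] {P : Measure Ω}
  (E : Imputation M m Ω P)

/-- The complete dataset as a list of rows. -/
def complete (n : ℕ) (ω : Ω) : List (Row p) := List.ofFn fun i => E.X n i ω

/-- The observed data `X_obs`. -/
def obs (n : ℕ) (ω : Ω) : ObsData n p :=
  (E.D n ω, fun i j => if E.D n ω i j then E.X n i ω j else 0)

/-- The σ-algebra generated by `X_obs`. -/
def obsSigma (n : ℕ) : MeasurableSpace Ω := MeasurableSpace.comap (E.obs n) inferInstance

theorem measurable_obs (n : ℕ) : Measurable (E.obs n) := by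
  have hX := E.measurable_X n
  have hD := E.measurable_D n
  refine hD.prodMk ?_
  refine measurable_pi_lambda _ fun i => measurable_pi_lambda _ fun j => ?_
  have hDij : Measurable fun ω => E.D n ω i j :=
    (measurable_pi_apply j).comp ((measurable_pi_apply i).comp hD)
  exact Measurable.ite (hDij (measurableSet_singleton true))
    ((measurable_pi_apply j).comp (hX i)) measurable_const

theorem obsSigma_le (n : ℕ) : E.obsSigma n ≤ ‹MeasurableSpace Ω› :=
  (E.measurable_obs n).comap_le

/-- The stacked dataset `X^S` of a multiset `S` of imputation indices. -/
def stack (n : ℕ) (S : Multiset (Fin m)) (ω : Ω) : List (Row p) :=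
  ((S.sort (· ≤ ·)).map fun ℓ => List.ofFn fun i => E.Ximp n ℓ i ω).flatten

/-- The observed-data MLE of `θ`. -/
def thetaObs (n : ℕ) (ω : Ω) : Fin k → ℝ := thetaPart (E.psiObs n (E.obs n ω))

/-- `θ̂^ℓ`. -/
def thetaImp (A : Analyst M) (n : ℕ) (ℓ : Fin m) (ω : Ω) : Fin k → ℝ :=
  A.thetaHat (E.stack n {ℓ} ω)

/-- `V̂^ℓ`. -/
def VImp (A : Analyst M) (n : ℕ) (ℓ : Fin m) (ω : Ω) : Matrix (Fin k) (Fin k) ℝ :=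
  A.VHat (E.stack n {ℓ} ω)

/-- `d̂^S = |S|⁻¹ 𝒹(X^S)`. -/
def dHat (A : Analyst M) (t : Test) (n : ℕ) (S : Multiset (Fin m)) (ω : Ω) : ℝ :=
  (S.card : ℝ)⁻¹ * device A (E.theta₀ n) (E.stack n S ω) t

/-- The stacked multiple imputation statistic `T̂_{S₁,S₂}`. -/
def THat (A : Analyst M) (t : Test) (n : ℕ) (Q : Finset (Fin m) × Finset (Fin m)) (ω : Ω) : ℝ :=
  ((Q.1.card : ℝ) + Q.2.card) / ((Q.1.card : ℝ) + Q.2.card - 2 * (Q.1 ∩ Q.2).card) *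
    ((Q.1.card : ℝ) * E.dHat A t n Q.1.val ω + (Q.2.card : ℝ) * E.dHat A t n Q.2.val ω
      - ((Q.1.card : ℝ) + Q.2.card) * E.dHat A t n (Q.1.val + Q.2.val) ω)

/-- The estimator `t̂_τ(Λ)`. -/
def tHat (A : Analyst M) (t : Test) (τ : ℕ) (Λ : Finset (Finset (Fin m) × Finset (Fin m)))
    (n : ℕ) (ω : Ω) : ℝ :=
  (Λ.card : ℝ)⁻¹ * ∑ Q ∈ Λ, E.THat A t n Q ω ^ τ

/-! ### Fisher information at sample size `n` -/

/-- `log f(X ∣ X_obs, ψ)`. -/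
def logCondDensity (n : ℕ) (ω : Ω) (ψ : Param k q) : ℝ :=
  Real.log (lik M (E.complete n ω) ψ / obsLik M (E.obs n ω) ψ)

/-- Complete-data Fisher information of the whole parameter `ψ`. -/
def Ifull (n : ℕ) : Matrix (Fin k ⊕ Fin q) (Fin k ⊕ Fin q) ℝ :=
  Matrix.of fun a b => ∫ ω, info M (E.complete n ω) (E.psiStar n) a b ∂P

/-- Complete-data Fisher information `I_com` of `θ`. -/
def Icom (n : ℕ) : Matrix (Fin k) (Fin k) ℝ := (E.Ifull n).toBlocks₁₁

/-- Missing-data Fisher information `I_mis` of `θ`. -/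
def Imis (n : ℕ) : Matrix (Fin k) (Fin k) ℝ :=
  Matrix.of fun a b =>
    ∫ ω, (- hess (E.logCondDensity n ω) (E.psiStar n)) (Sum.inl a) (Sum.inl b) ∂P

/-- Observed-data Fisher information `I_obs` of `θ`. -/
def Iobs (n : ℕ) : Matrix (Fin k) (Fin k) ℝ := E.Icom n - E.Imis n

/-- `T = I_obs⁻¹`. -/
def Tmat (n : ℕ) : Matrix (Fin k) (Fin k) ℝ := (E.Iobs n)⁻¹

/-- `V = I_com⁻¹`. -/
def Vmat (n : ℕ) : Matrix (Fin k) (Fin k) ℝ := (E.Icom n)⁻¹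

/-- `B = I_obs⁻¹ - I_com⁻¹`. -/
def Bmat (n : ℕ) : Matrix (Fin k) (Fin k) ℝ := E.Tmat n - E.Vmat n

end Imputation

/-- `C^{-1/2}` for a positive definite matrix `C`: the positive square root of `C⁻¹`. -/
def invSqrt (C : Matrix (Fin k) (Fin k) ℝ) : Matrix (Fin k) (Fin k) ℝ := CFC.sqrt C⁻¹

/-- The standard normal law `N_k(0, I)`. -/
def stdNormal (k : ℕ) : Measure (Fin k → ℝ) := Measure.pi fun _ => gaussianReal 0 1

instance (k : ℕ) : IsProbabilityMeasure (stdNormal k) := by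
  unfold stdNormal; infer_instance

/-! ### Assumptions -/

section Assumptions

variable {M : Model p k q} {Ω : Type*} [MeasurableSpace Ω] {P : Measure Ω}
  (A : Analyst M) (E : Imputation M m Ω P)

/-- The statistics are random variables. -/
structure MeasurableStatistics (t : Test) : Prop where
  theta : ∀ n ℓ, Measurable (E.thetaImp A n ℓ)
  var : ∀ n ℓ a b, Measurable fun ω => E.VImp A n ℓ ω a b
  d : ∀ n S, S ≠ 0 → Measurable (E.dHat A t n S)

/-- On every completed dataset, the average of `h (·, ψ)` over the rows converges in probability
to `H`, uniformly over small neighbourhoods of `ψ = ψlim`. -/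
def LocalUniformLLN {ι : Type} (h : Row p → Param k q → ι → ℝ) (ψlim : Param k q)
    (H : ι → ℝ) : Prop :=
  ∀ ℓ : Fin m, ∀ ε : ℝ, 0 < ε → ∃ δ : ℝ, 0 < δ ∧
    Tendsto (fun n : ℕ => P {ω | ∃ ψ, dist ψ ψlim < δ ∧ ∃ c,
      ε < |(n : ℝ)⁻¹ * (∑ i, h (E.Ximp n ℓ i ω) ψ c) - H c|}) atTop (𝓝 0)

/-- Standard regularity conditions of likelihood theory.  `ψlim` is the limit of the true
parameter, `iFull` the per-unit complete-data information matrix of `ψ`, `iMis` the per-unit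
missing-data information of `θ`, and `H` the limit of the averages entering `V̂`.  All conditions
on imputed data concern a single completed dataset at a time. -/
structure Regular (ψlim : Param k q)
    (iFull : Matrix (Fin k ⊕ Fin q) (Fin k ⊕ Fin q) ℝ)
    (iMis : Matrix (Fin k) (Fin k) ℝ) (H : Fin A.dim → ℝ) : Prop where
  /-- The true parameter converges to an interior point of the parameter space. -/
  tendsto_psiStar : Tendsto E.psiStar atTop (𝓝 ψlim)
  mem_interior : ψlim ∈ interior M.Ψ
  /-- The Fisher informations exist, and are proportional to `n` in the limit. -/
  integrable_com : ∀ n a b,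
    Integrable (fun ω => info M (E.complete n ω) (E.psiStar n) a b) P
  integrable_mis : ∀ n a b,
    Integrable (fun ω => hess (E.logCondDensity n ω) (E.psiStar n) (Sum.inl a) (Sum.inl b)) P
  tendsto_full : Tendsto (fun n : ℕ => (n : ℝ)⁻¹ • E.Ifull n) atTop (𝓝 iFull)
  tendsto_mis : Tendsto (fun n : ℕ => (n : ℝ)⁻¹ • E.Imis n) atTop (𝓝 iMis)
  /-- `I(ψ)⁻¹`, `T`, `B`, `V` and their inverses are well defined (in the limit). -/
  posDef_full : iFull.PosDef
  posDef_obs : (iFull.toBlocks₁₁ - iMis).PosDef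
  posDef_B : ((iFull.toBlocks₁₁ - iMis)⁻¹ - iFull.toBlocks₁₁⁻¹).PosDef
  /-- Near `ψlim` the density is positive and twice continuously differentiable in `ψ`. -/
  smooth : ∃ U : Set (Param k q), IsOpen U ∧ ψlim ∈ U ∧ ∀ n ℓ i, ∀ᵐ ω ∂P,
    (∀ ψ ∈ U, 0 < M.f ψ (E.Ximp n ℓ i ω)) ∧
      ContDiffOn ℝ 2 (fun ψ => M.f ψ (E.Ximp n ℓ i ω)) U
  /-- The observed information per unit converges to the expected one. -/
  info_lln : LocalUniformLLN E
    (fun x ψ (ab : (Fin k ⊕ Fin q) × (Fin k ⊕ Fin q)) => info M [x] ψ ab.1 ab.2) ψlim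
    (fun ab => iFull ab.1 ab.2)
  /-- The score at the true parameter is of order `√n`. -/
  score_tight : ∀ ℓ : Fin m, ∀ ε : ℝ, 0 < ε → ∃ K : ℝ, ∀ᶠ n : ℕ in atTop,
    P {ω | K * √n < ‖grad (loglik M (E.stack n {ℓ} ω)) (E.psiStar n)‖} ≤ ENNReal.ofReal ε
  /-- Identifiability: away from `ψlim` the average log-likelihood is smaller by a margin. -/
  identifiable : ∀ ℓ : Fin m, ∀ ε : ℝ, 0 < ε → ∃ η : ℝ, 0 < η ∧
    Tendsto (fun n : ℕ => P {ω | ∃ ψ ∈ M.Ψ, ε ≤ dist ψ ψlim ∧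
      Real.exp (-(n * η)) * lik M (E.stack n {ℓ} ω) ψlim < lik M (E.stack n {ℓ} ω) ψ})
      atTop (𝓝 0)
  /-- `V̂` is a variance estimator of the MLE `θ̂`: with `H` the limit of the averages entering
  `V̂`, the function `v` is continuous at the limit and takes there the value of the asymptotic
  variance of `√n θ̂`, the `θθ`-block of the inverse information matrix. -/
  var_lln : LocalUniformLLN E A.h ψlim H
  var_cont : ContinuousAt (fun z : Param k q × (Fin A.dim → ℝ) => A.v z.1 z.2) (ψlim, H)
  var_eq : A.v ψlim H = (iFull⁻¹).toBlocks₁₁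

/-- Local alternatives: `√n C (θ* - θ₀) → δ` for some vector `δ` and invertible matrix `C`. -/
def LocalAlternative : Prop :=
  ∃ (C : Matrix (Fin k) (Fin k) ℝ) (δ : Fin k → ℝ), IsUnit C ∧
    Tendsto (fun n : ℕ => √n • (C *ᵥ (thetaPart (E.psiStar n) - E.theta₀ n))) atTop (𝓝 δ)

/-- Asymptotic normality of the observed-data MLE: `T^{-1/2}(θ̂_obs - θ*) ⇒ N_k(0, I)`. -/
def NormalObsMLE [IsProbabilityMeasure P] : Prop :=
  TendstoInDistribution
    (fun n ω => invSqrt (E.Tmat n) *ᵥ (E.thetaObs n ω - thetaPart (E.psiStar n))) atTop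
    (id : (Fin k → ℝ) → Fin k → ℝ) (fun _ => P) (stdNormal k)

/-- Proper imputation: given `X_obs`, the pairs `(θ̂^ℓ, V̂^ℓ)` are independent,
`B^{-1/2}(θ̂^ℓ - θ̂_obs) ⇒ N_k(0, I)` and `T⁻¹(V̂^ℓ - V) → 0` in probability.  Conditional weak
convergence means convergence in probability of the conditional expectations of bounded
continuous functions. -/
structure ProperImputation [StandardBorelSpace Ω] [IsProbabilityMeasure P] : Prop where
  indep : ∀ n, iCondIndepFun (E.obsSigma n) (E.obsSigma_le n)
    (fun (ℓ : Fin m) ω => (E.thetaImp A n ℓ ω, fun a b : Fin k => E.VImp A n ℓ ω a b)) P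
  normal : ∀ (ℓ : Fin m) (g : BoundedContinuousFunction (Fin k → ℝ) ℝ),
    TendstoInMeasure P
      (fun n => P[fun ω => g (invSqrt (E.Bmat n) *ᵥ (E.thetaImp A n ℓ ω - E.thetaObs n ω))
        | E.obsSigma n]) atTop (fun _ => ∫ z, g z ∂(stdNormal k))
  var : ∀ (ℓ : Fin m) (ε : ℝ), 0 < ε →
    TendstoInMeasure P
      (fun n => P⟦{ω | ∃ a b, ε ≤ |((E.Tmat n)⁻¹ * (E.VImp A n ℓ ω - E.Vmat n)) a b|}
        | E.obsSigma n⟧) atTop (fun _ => 0)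

end Assumptions

/-- The set `ℒ` of pairs of non-empty distinct subsets of `{1, …, m}`. -/
def pairs (m : ℕ) : Finset (Finset (Fin m) × Finset (Fin m)) :=
  Finset.univ.filter fun Q => Q.1.Nonempty ∧ Q.2.Nonempty ∧ Q.1 ≠ Q.2

/-- Uniform integrability of `T̂_{S₁,S₂}^{2τ}` over `n ≥ 1`, for every pair in `ℒ`. -/
def UniformlyIntegrablePow {M : Model p k q} {Ω : Type*} [MeasurableSpace Ω] {P : Measure Ω}
    (A : Analyst M) (E : Imputation M m Ω P) (t : Test) (τ : ℕ) : Prop :=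
  ∀ Q ∈ pairs m, Tendsto (fun c : ℝ => ⨆ (n : ℕ) (_ : 1 ≤ n),
    ∫⁻ ω in {ω | c < |E.THat A t n Q ω|}, ENNReal.ofReal (E.THat A t n Q ω ^ (2 * τ)) ∂P)
    atTop (𝓝 0)

/-- `r₁, …, r_k` are the odds of missing information: `r_j = f_j / (1 - f_j)`, where
`f₁ ≥ ⋯ ≥ f_k` are the eigenvalues (with multiplicity) of `F = I_mis I_com⁻¹`. -/
def IsOMI (iCom iMis : Matrix (Fin k) (Fin k) ℝ) (r : Fin k → ℝ) : Prop :=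
  ∃ f : Fin k → ℝ, Antitone f ∧
    (iMis * iCom⁻¹).charpoly = ∏ j, (Polynomial.X - Polynomial.C (f j)) ∧
    ∀ j, r j = f j / (1 - f j)

/-- `R_τ = ∑ⱼ r_j^τ`. -/
def powerSum (r : Fin k → ℝ) (τ : ℕ) : ℝ := ∑ j, r j ^ τ

/-- `t_τ = E(𝕋^τ)` with `𝕋 = ∑ⱼ r_j U_j` and independent `U_j ∼ χ²₁` (squares of independent
standard normal variables). -/
def tMoment (r : Fin k → ℝ) (τ : ℕ) : ℝ := ∫ z, (∑ j, r j * z j ^ 2) ^ τ ∂(stdNormal k)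

/-- The correlation `ρ(S₁,S₂,S₃,S₄)` with `Q = (S₁,S₂)` and `Q' = (S₃,S₄)`. -/
def rho (Q Q' : Finset (Fin m) × Finset (Fin m)) : ℝ :=
  √((Q.1.card : ℝ) * Q.2.card * Q'.1.card * Q'.2.card) /
      (√((Q.1.card : ℝ) + Q.2.card - 2 * (Q.1 ∩ Q.2).card) *
        √((Q'.1.card : ℝ) + Q'.2.card - 2 * (Q'.1 ∩ Q'.2).card)) *
    (((Q.1 ∩ Q'.1).card : ℝ) / ((Q.1.card : ℝ) * Q'.1.card)
      - ((Q.1 ∩ Q'.2).card : ℝ) / ((Q.1.card : ℝ) * Q'.2.card)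
      - ((Q.2 ∩ Q'.1).card : ℝ) / ((Q.2.card : ℝ) * Q'.1.card)
      + ((Q.2 ∩ Q'.2).card : ℝ) / ((Q.2.card : ℝ) * Q'.2.card))

end

end StackedMI

/-! Near the true parameter each completed dataset has an asymptotically quadratic log-likelihood
with information `n i`. Stacking multiplies likelihoods, so `X^S` has information `|S| n i`, and the
limit of its rescaled MLE error is the average over `S` of the limits `h ℓ` belonging to the single
imputations. Wald, likelihood ratio and score statistics, divided by `|S|`, all approach one
quadratic form `quad W (average + δ)` with `W = ((i⁻¹)_θθ)⁻¹` (`tendsto_device`, `tendsto_dHat`).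
The combination defining `THat` is a between-group sum of squares: the shift `δ` cancels
(`quad_combination`), leaving `quad W (∑ ℓ, contrast Q ℓ • h ℓ)`. The vectors `contrast Q` have sum
zero and length one, and their inner products are exactly `rho` (`sum_contrast_mul`).

Convergence in probability is expressed by the filter `probFilter`. It suffices to argue along finer
ultrafilters on which the normalized scores are bounded; there every bounded quantity has a limit,
and the likelihood theory becomes deterministic.

Since the contrasts sum to zero, the imputed estimates may be centred at the observed-data MLE.
Proper imputation makes the noises `B^{-1/2}(θ̂^ℓ - θ̂_obs)` asymptotically independent standard
normal, so two contrasts are jointly normal with cross-correlation `rho`. Validity of the variance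
estimator forces `W = i_com`, and `i_com lim(nB) = (1 - F)⁻¹ - 1` has eigenvalues `r j`. Hence the
statistics of two pairs converge jointly to `∑ r j Z_j²` and `∑ r j (ρ Z_j + √(1 - ρ²) Z'_j)²`
(`tendstoInDistribution_THat`).

Uniform integrability upgrades this to moments of order `τ` and to mixed moments
(`tendsto_integral_of_truncation`). The limiting covariance is `O(ρ²)` uniformly in `|ρ| ≤ 1`,
because the part linear in `ρ` is odd in `Z` and integrates to zero
(`exists_abs_pairMoment_sub_le`). Dividing by `ρ²` defines the bounded constants `C`; for `τ = 1`
the covariance is exactly `2 R₂ ρ²` (`pairMoment_one`). -/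

namespace StackedMI

/-! ### Local quadratic asymptotics of likelihoods along a filter -/

section LocalAsymptotics

variable {α E : Type*} [NormedAddCommGroup E] [NormedSpace ℝ E]

/-- Local asymptotic quadraticity of a family of likelihoods `lk a` of sample size `N a`, along
the filter `l`: `Λ` is the limiting information and `σ` the limit of the normalized scores at
`ψs a`. -/
structure LocalLik (l : Filter α) (N : α → ℝ) (Ψ : Set E) (ψlim : E) (ψs : α → E)
    (lk : α → E → ℝ) (Λ : E →L[ℝ] E →L[ℝ] ℝ) (σ : E →L[ℝ] ℝ) : Prop where
  nonneg : ∀ a, ∀ ψ ∈ Ψ, 0 ≤ lk a ψ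
  smooth : ∃ U, IsOpen U ∧ ψlim ∈ U ∧
    ∀ᶠ a in l, (∀ ψ ∈ U, 0 < lk a ψ) ∧ ContDiffOn ℝ 2 (lk a) U
  -- Convergence along the product filter encodes uniformity over small neighbourhoods of `ψlim`.
  hess : Tendsto (fun z : α × E =>
    ‖(N z.1)⁻¹ • fderiv ℝ (fderiv ℝ fun ψ => Real.log (lk z.1 ψ)) z.2 + Λ‖)
    (l ×ˢ 𝓝 ψlim) (𝓝 0)
  score : Tendsto (fun a => (√(N a))⁻¹ • fderiv ℝ (fun ψ => Real.log (lk a ψ)) (ψs a)) l (𝓝 σ)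
  ident : ∀ ε > 0, ∃ η > 0, ∀ᶠ a in l, ∀ ψ ∈ Ψ, ε ≤ dist ψ ψlim →
    lk a ψ ≤ Real.exp (-(N a * η)) * lk a ψlim

theorem tendsto_clm_apply {G : Type*} [NormedAddCommGroup G] [NormedSpace ℝ G] {l : Filter α}
    {f : α → E →L[ℝ] G} {x : α → E} {f₀ : E →L[ℝ] G} {x₀ : E} (hf : Tendsto f l (𝓝 f₀))
    (hx : Tendsto x l (𝓝 x₀)) : Tendsto (fun a => f a (x a)) l (𝓝 (f₀ x₀)) :=
  (isBoundedBilinearMap_apply.continuous.tendsto (f₀, x₀)).comp (hf.prodMk_nhds hx)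

theorem hasFDerivAt_of_contDiffOn {f : E → ℝ} {U : Set E} (hU : IsOpen U)
    (hf : ContDiffOn ℝ 2 f U) {x : E} (hx : x ∈ U) :
    HasFDerivAt f (fderiv ℝ f x) x ∧
      HasFDerivAt (fderiv ℝ f) (fderiv ℝ (fderiv ℝ f) x) x := by
  have h1 : ContDiffAt ℝ 2 f x := hf.contDiffAt (hU.mem_nhds hx)
  exact ⟨(h1.differentiableAt (by norm_num)).hasFDerivAt,
    ((h1.fderiv_right (m := 1) (by norm_num)).differentiableAt (by norm_num)).hasFDerivAt⟩

variable {l : Filter α} {N : α → ℝ} {Ψ : Set E} {ψlim : E} {ψs : α → E}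
  {lk : α → E → ℝ} {Λ : E →L[ℝ] E →L[ℝ] ℝ} {σ : E →L[ℝ] ℝ}

namespace LocalLik

theorem exists_ball (h : LocalLik l N Ψ ψlim ψs lk Λ σ) (hΨ : ψlim ∈ interior Ψ) :
    ∃ δ > 0, Metric.ball ψlim δ ⊆ Ψ ∧ ∀ᶠ a in l, (∀ ψ ∈ Metric.ball ψlim δ, 0 < lk a ψ) ∧
      ContDiffOn ℝ 2 (fun ψ => Real.log (lk a ψ)) (Metric.ball ψlim δ) := by
  obtain ⟨U, hU, hmem, hs⟩ := h.smooth
  obtain ⟨δ, hδ, hb⟩ := Metric.isOpen_iff.1 (hU.inter isOpen_interior) ψlim ⟨hmem, hΨ⟩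
  refine ⟨δ, hδ, fun x hx => interior_subset (hb hx).2, hs.mono fun a ha => ?_⟩
  exact ⟨fun ψ hψ => ha.1 ψ (hb hψ).1,
    (ha.2.mono fun x hx => (hb hx).1).log fun x hx => (ha.1 x (hb hx).1).ne'⟩

/-- The derivative of the gradient stays within `ε * N a` of `-(N a • Λ)` on a small ball, so the
mean value inequality applies. The ball and the exceptional set of `a` do not depend on `x` and `y`,
so estimators may be inserted later. -/
theorem grad_expansion (h : LocalLik l N Ψ ψlim ψs lk Λ σ) (hΨ : ψlim ∈ interior Ψ)
    (hN : Tendsto N l atTop) {ε : ℝ} (hε : 0 < ε) :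
    ∃ δ > 0, ∀ᶠ a in l, ∀ x ∈ Metric.ball ψlim δ, ∀ y ∈ Metric.ball ψlim δ,
      ‖fderiv ℝ (fun ψ => Real.log (lk a ψ)) y - fderiv ℝ (fun ψ => Real.log (lk a ψ)) x
        + N a • Λ (y - x)‖ ≤ ε * N a * ‖y - x‖ := by
  obtain ⟨δ₁, hδ₁, -, hs⟩ := h.exists_ball hΨ
  have hh := h.hess.eventually_lt_const hε
  obtain ⟨pa, hpa, pb, hpb, hab⟩ := Filter.eventually_prod_iff.1 hh
  obtain ⟨δ₂, hδ₂, hb⟩ := Metric.eventually_nhds_iff_ball.1 hpb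
  refine ⟨min δ₁ δ₂, lt_min hδ₁ hδ₂, ?_⟩
  filter_upwards [hs, hpa, hN.eventually_gt_atTop 0] with a ha hpa hNa x hx y hy
  have hconv := (convex_ball ψlim (min δ₁ δ₂)).norm_image_sub_le_of_norm_hasFDerivWithin_le'
    (f := fderiv ℝ fun ψ => Real.log (lk a ψ))
    (f' := fderiv ℝ (fderiv ℝ fun ψ => Real.log (lk a ψ))) (φ := -(N a • Λ)) (C := ε * N a)
    (fun z hz => (hasFDerivAt_of_contDiffOn Metric.isOpen_ball ha.2
      (Metric.ball_subset_ball (min_le_left _ _) hz)).2.hasFDerivWithinAt)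
    (fun z hz => ?_) hx hy
  · simpa [sub_eq_add_neg, add_assoc] using hconv
  · have := hab hpa (hb z (Metric.ball_subset_ball (min_le_right _ _) hz))
    have e : fderiv ℝ (fderiv ℝ fun ψ => Real.log (lk a ψ)) z - -(N a • Λ) =
        N a • ((N a)⁻¹ • fderiv ℝ (fderiv ℝ fun ψ => Real.log (lk a ψ)) z + Λ) := by
      rw [smul_add, smul_smul, mul_inv_cancel₀ hNa.ne', one_smul, sub_neg_eq_add]
    rw [e, norm_smul, Real.norm_of_nonneg hNa.le, mul_comm]
    exact mul_le_mul_of_nonneg_right this.le hNa.le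

/-- Subtracting the quadratic Taylor polynomial at `x` leaves a function whose derivative is what
`grad_expansion` bounds. Symmetry of `Λ` is needed to differentiate `Λ (z - x) (z - x)`. -/
theorem log_expansion (h : LocalLik l N Ψ ψlim ψs lk Λ σ) (hΨ : ψlim ∈ interior Ψ)
    (hN : Tendsto N l atTop) (hsym : ∀ x y, Λ x y = Λ y x) {ε : ℝ} (hε : 0 < ε) :
    ∃ δ > 0, ∀ᶠ a in l, ∀ x ∈ Metric.ball ψlim δ, ∀ y ∈ Metric.ball ψlim δ,
      |Real.log (lk a y) - Real.log (lk a x)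
        - fderiv ℝ (fun ψ => Real.log (lk a ψ)) x (y - x)
        + N a / 2 * Λ (y - x) (y - x)| ≤ ε * N a * ‖y - x‖ ^ 2 := by
  obtain ⟨δ₁, hδ₁, -, hs⟩ := h.exists_ball hΨ
  obtain ⟨δ₂, hδ₂, hg⟩ := h.grad_expansion hΨ hN hε
  refine ⟨min δ₁ δ₂, lt_min hδ₁ hδ₂, ?_⟩
  filter_upwards [hs, hg, hN.eventually_gt_atTop 0] with a ha hg hNa x hx y hy
  set f : E → ℝ := fun ψ => Real.log (lk a ψ) with hf
  have hseg : segment ℝ x y ⊆ Metric.ball ψlim (min δ₁ δ₂) :=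
    (convex_ball ψlim (min δ₁ δ₂)).segment_subset hx hy
  let g : E → ℝ := fun z => f z - fderiv ℝ f x (z - x) + N a / 2 * Λ (z - x) (z - x)
  have hder : ∀ z ∈ segment ℝ x y, HasFDerivWithinAt g
      (fderiv ℝ f z - fderiv ℝ f x + N a • Λ (z - x)) (segment ℝ x y) z := by
    intro z hz
    have h1 := (hasFDerivAt_of_contDiffOn Metric.isOpen_ball ha.2
      (Metric.ball_subset_ball (min_le_left _ _) (hseg hz))).1
    have h2 : HasFDerivAt (fun z : E => z - x) (ContinuousLinearMap.id ℝ E) z :=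
      (hasFDerivAt_id z).sub_const x
    have h3 : HasFDerivAt (fun z : E => fderiv ℝ f x (z - x)) (fderiv ℝ f x) z := by
      exact (fderiv ℝ f x).hasFDerivAt.comp z h2
    have h4 : HasFDerivAt (fun z : E => Λ (z - x)) Λ z := by
      exact Λ.hasFDerivAt.comp z h2
    have h5 := (h4.clm_apply h2).const_mul (N a / 2)
    refine (((h1.sub h3).add h5).congr_fderiv ?_).hasFDerivWithinAt
    ext v
    have := hsym v (z - x)
    simp only [map_sub, FunLike.coe_sub, Pi.sub_apply] at this
    simp
    linear_combination (N a / 2) * this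
  have := (convex_segment x y).norm_image_sub_le_of_norm_hasFDerivWithin_le
    (C := ε * N a * ‖y - x‖) hder (fun z hz => ?_) (left_mem_segment ℝ x y)
    (right_mem_segment ℝ x y)
  · simp only [g, sub_self, map_zero, mul_zero,
      sub_zero, add_zero, Real.norm_eq_abs] at this
    calc _ = |f y - fderiv ℝ f x (y - x) + N a / 2 * Λ (y - x) (y - x) - f x| := by
          congr 1; simp only [hf]; ring
      _ ≤ _ := by rw [pow_two, ← mul_assoc]; exact this
  · refine (hg x (Metric.ball_subset_ball (min_le_right _ _) hx) z
      (Metric.ball_subset_ball (min_le_right _ _) (hseg hz))).trans ?_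
    have : ‖z - x‖ ≤ ‖y - x‖ := norm_sub_le_of_mem_segment hz
    gcongr

/-- Quadratic expansion of the log-likelihood at `√N`-consistent points. -/
theorem tendsto_log_sub (h : LocalLik l N Ψ ψlim ψs lk Λ σ) (hΨ : ψlim ∈ interior Ψ)
    (hN : Tendsto N l atTop) (hsym : ∀ x y, Λ x y = Λ y x) (hψs : Tendsto ψs l (𝓝 ψlim))
    {x : α → E} (hx : Tendsto x l (𝓝 ψlim)) {u : E}
    (hu : Tendsto (fun a => √(N a) • (x a - ψs a)) l (𝓝 u)) :
    Tendsto (fun a => Real.log (lk a (x a)) - Real.log (lk a (ψs a))) l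
      (𝓝 (σ u - Λ u u / 2)) := by
  have hrem : Tendsto (fun a => Real.log (lk a (x a)) - Real.log (lk a (ψs a))
        - fderiv ℝ (fun ψ => Real.log (lk a ψ)) (ψs a) (x a - ψs a)
        + N a / 2 * Λ (x a - ψs a) (x a - ψs a)) l (𝓝 0) := by
    rw [Metric.tendsto_nhds]
    intro ε hε
    have hu2 : ∀ᶠ a in l, ‖√(N a) • (x a - ψs a)‖ < ‖u‖ + 1 :=
      hu.norm.eventually_lt_const (lt_add_one _)
    obtain ⟨δ, hδ, hex⟩ := h.log_expansion hΨ hN hsym (ε := ε / (2 * (‖u‖ + 1) ^ 2))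
      (by positivity)
    filter_upwards [hu2, hex, hx (Metric.ball_mem_nhds _ hδ), hψs (Metric.ball_mem_nhds _ hδ),
      hN.eventually_gt_atTop 0] with a h1 h2 h3 h4 h5
    rw [Real.dist_0_eq_abs]
    refine (h2 _ h4 _ h3).trans_lt ?_
    rw [norm_smul, Real.norm_of_nonneg (Real.sqrt_nonneg _)] at h1
    have h6 : N a * ‖x a - ψs a‖ ^ 2 = (√(N a) * ‖x a - ψs a‖) ^ 2 := by
      rw [mul_pow, Real.sq_sqrt h5.le]
    rw [mul_assoc, h6]
    have h7 : (√(N a) * ‖x a - ψs a‖) ^ 2 ≤ (‖u‖ + 1) ^ 2 := by gcongr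
    calc _ ≤ ε / (2 * (‖u‖ + 1) ^ 2) * (‖u‖ + 1) ^ 2 := by gcongr
      _ = ε / 2 := by field_simp
      _ < ε := by linarith
  have h1 : Tendsto (fun a => ((√(N a))⁻¹ • fderiv ℝ (fun ψ => Real.log (lk a ψ)) (ψs a))
      (√(N a) • (x a - ψs a))) l (𝓝 (σ u)) := tendsto_clm_apply h.score hu
  have h2 : Tendsto (fun a => Λ (√(N a) • (x a - ψs a)) (√(N a) • (x a - ψs a)) / 2) l
      (𝓝 (Λ u u / 2)) :=
    (tendsto_clm_apply ((Λ.continuous.tendsto u).comp hu) hu).div_const 2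
  have h3 := (hrem.add h1).sub h2
  rw [zero_add] at h3
  refine h3.congr' ?_
  filter_upwards [hN.eventually_gt_atTop 0] with a ha
  have h4 : √(N a) ≠ 0 := (Real.sqrt_pos.2 ha).ne'
  have h5 : √(N a) * √(N a) = N a := Real.mul_self_sqrt ha.le
  simp only [map_smul, smul_apply, smul_eq_mul]
  rw [mul_inv_cancel_left₀ h4, ← mul_assoc, h5]
  ring

/-- A companion of `tendsto_log_sub` for points that converge at no known rate: the log-likelihood
then changes by `o(N)`. It serves to prove consistency, before any rate is available. -/
theorem tendsto_log_sub_div (h : LocalLik l N Ψ ψlim ψs lk Λ σ) (hΨ : ψlim ∈ interior Ψ)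
    (hN : Tendsto N l atTop) (hsym : ∀ x y, Λ x y = Λ y x) (hψs : Tendsto ψs l (𝓝 ψlim))
    {x : α → E} (hx : Tendsto x l (𝓝 ψlim)) :
    Tendsto (fun a => (N a)⁻¹ * (Real.log (lk a (x a)) - Real.log (lk a (ψs a)))) l (𝓝 0) := by
  have hd : Tendsto (fun a => x a - ψs a) l (𝓝 0) := by simpa using hx.sub hψs
  have hrem : Tendsto (fun a => (N a)⁻¹ * (Real.log (lk a (x a)) - Real.log (lk a (ψs a))
        - fderiv ℝ (fun ψ => Real.log (lk a ψ)) (ψs a) (x a - ψs a)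
        + N a / 2 * Λ (x a - ψs a) (x a - ψs a))) l (𝓝 0) := by
    obtain ⟨δ, hδ, hex⟩ := h.log_expansion hΨ hN hsym one_pos
    have hd2 : Tendsto (fun a => ‖x a - ψs a‖ ^ 2) l (𝓝 0) := by simpa using hd.norm.pow 2
    refine squeeze_zero_norm' ?_ hd2
    filter_upwards [hex, hx (Metric.ball_mem_nhds _ hδ), hψs (Metric.ball_mem_nhds _ hδ),
      hN.eventually_gt_atTop 0] with a h2 h3 h4 h5
    rw [norm_mul, norm_inv, Real.norm_of_nonneg h5.le, inv_mul_le_iff₀ h5]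
    simpa using h2 _ h4 _ h3
  have hs0 : Tendsto (fun a => (√(N a))⁻¹) l (𝓝 0) :=
    (Real.tendsto_sqrt_atTop.comp hN).inv_tendsto_atTop
  have h1 := hs0.mul (tendsto_clm_apply h.score hd)
  have h2 : Tendsto (fun a => Λ (x a - ψs a) (x a - ψs a) / 2) l (𝓝 0) := by
    have := (tendsto_clm_apply ((Λ.continuous.tendsto 0).comp hd) hd).div_const 2
    simpa using this
  have h3 := (hrem.add h1).sub h2
  simp only [map_zero, mul_zero, add_zero, sub_zero] at h3
  refine h3.congr' ?_
  filter_upwards [hN.eventually_gt_atTop 0] with a ha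
  have h4 : √(N a) ≠ 0 := (Real.sqrt_pos.2 ha).ne'
  have h5 : √(N a) * √(N a) = N a := Real.mul_self_sqrt ha.le
  simp only [smul_apply, smul_eq_mul]
  rw [← mul_assoc, ← mul_inv, h5]
  field_simp
  ring

/-- The identifiability margin is exponential in `N`, whereas the likelihoods at `x a` and at `ψlim`
differ only by a factor `exp (o(N))`. -/
theorem eventually_lt_lik (h : LocalLik l N Ψ ψlim ψs lk Λ σ) (hΨ : ψlim ∈ interior Ψ)
    (hN : Tendsto N l atTop) (hsym : ∀ x y, Λ x y = Λ y x) (hψs : Tendsto ψs l (𝓝 ψlim))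
    {x : α → E} (hx : Tendsto x l (𝓝 ψlim)) {ε : ℝ} (hε : 0 < ε) :
    ∀ᶠ a in l, ∀ ψ ∈ Ψ, ε ≤ dist ψ ψlim → lk a ψ < lk a (x a) := by
  obtain ⟨η, hη, hid⟩ := h.ident ε hε
  obtain ⟨δ, hδ, hsub, hs⟩ := h.exists_ball hΨ
  have h1 := (h.tendsto_log_sub_div hΨ hN hsym hψs hx).sub
    (h.tendsto_log_sub_div hΨ hN hsym hψs (tendsto_const_nhds (x := ψlim)))
  rw [sub_zero] at h1
  filter_upwards [hid, hs, h1.eventually_const_lt (show -η < 0 by linarith),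
    hx (Metric.ball_mem_nhds _ hδ), hN.eventually_gt_atTop 0] with a h2 h3 h4 h5 h6 ψ hψ hd
  refine (h2 ψ hψ hd).trans_lt ?_
  have p1 := h3.1 _ h5
  have p2 := h3.1 _ (Metric.mem_ball_self hδ)
  rw [← mul_sub] at h4
  have h7 : -(N a * η) < Real.log (lk a (x a)) - Real.log (lk a ψlim) := by
    have := mul_lt_mul_of_pos_left h4 h6
    rw [mul_inv_cancel_left₀ h6.ne'] at this
    linarith
  rw [← Real.log_div p1.ne' p2.ne', Real.lt_log_iff_exp_lt (div_pos p1 p2), lt_div_iff₀ p2] at h7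
  exact h7

/-- Outside a small ball every value is beaten by the one at `x a`, so a maximiser over the compact
set cut out of `F a` by the closed ball is a global one. Taking for `F a` the whole space or the
null hypothesis treats both MLEs at once. -/
theorem eventually_exists_max [ProperSpace E] (h : LocalLik l N Ψ ψlim ψs lk Λ σ)
    (hΨ : ψlim ∈ interior Ψ)
    (hN : Tendsto N l atTop) (hsym : ∀ x y, Λ x y = Λ y x) (hψs : Tendsto ψs l (𝓝 ψlim))
    {x : α → E} (hx : Tendsto x l (𝓝 ψlim)) {F : α → Set E} (hF : ∀ a, IsClosed (F a))
    (hxF : ∀ a, x a ∈ F a) :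
    ∀ᶠ a in l, ∃ ψ ∈ Ψ ∩ F a, ∀ ψ' ∈ Ψ ∩ F a, lk a ψ' ≤ lk a ψ := by
  obtain ⟨U, hU, hmemU, hsU⟩ := h.smooth
  obtain ⟨δ, hδ, hb⟩ := Metric.isOpen_iff.1 (hU.inter isOpen_interior) ψlim ⟨hmemU, hΨ⟩
  have hd2 : 0 < δ / 2 := half_pos hδ
  filter_upwards [h.eventually_lt_lik hΨ hN hsym hψs hx hd2, hsU,
    hx (Metric.ball_mem_nhds _ hd2)] with a h1 h2 h3
  have hsub : Metric.closedBall ψlim (δ / 2) ⊆ Metric.ball ψlim δ :=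
    Metric.closedBall_subset_ball (by linarith)
  have hK : IsCompact (Metric.closedBall ψlim (δ / 2) ∩ F a) :=
    (isCompact_closedBall _ _).inter_right (hF a)
  have hcont : ContinuousOn (lk a) (Metric.closedBall ψlim (δ / 2) ∩ F a) :=
    h2.2.continuousOn.mono fun z hz => (hb (hsub hz.1)).1
  have hx0 : x a ∈ Metric.closedBall ψlim (δ / 2) ∩ F a :=
    ⟨Metric.ball_subset_closedBall h3, hxF a⟩
  obtain ⟨ψ, hψ, hmax⟩ := hK.exists_isMaxOn ⟨_, hx0⟩ hcont
  refine ⟨ψ, ⟨interior_subset (hb (hsub hψ.1)).2, hψ.2⟩, fun ψ' hψ' => ?_⟩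
  by_cases hc : δ / 2 ≤ dist ψ' ψlim
  · exact (h1 ψ' hψ'.1 hc).le.trans (hmax hx0)
  · exact hmax ⟨(not_le.1 hc).le, hψ'.2⟩

theorem tendsto_max (h : LocalLik l N Ψ ψlim ψs lk Λ σ)
    (hΨ : ψlim ∈ interior Ψ)
    (hN : Tendsto N l atTop) (hsym : ∀ x y, Λ x y = Λ y x) (hψs : Tendsto ψs l (𝓝 ψlim))
    {x : α → E} (hx : Tendsto x l (𝓝 ψlim)) {F : α → Set E}
    (hxF : ∀ a, x a ∈ F a) {ψ : α → E}
    (hψ : ∀ᶠ a in l, ψ a ∈ Ψ ∩ F a ∧ ∀ ψ' ∈ Ψ ∩ F a, lk a ψ' ≤ lk a (ψ a)) :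
    Tendsto ψ l (𝓝 ψlim) := by
  rw [Metric.tendsto_nhds]
  intro ε hε
  filter_upwards [h.eventually_lt_lik hΨ hN hsym hψs hx hε, hψ,
    hx (mem_interior_iff_mem_nhds.1 hΨ)] with a h1 h2 h3
  by_contra hc
  exact absurd (h2.2 (x a) ⟨h3, hxF a⟩) (not_le.2 (h1 _ h2.1.1 (not_lt.1 hc)))

/-- Restriction to a line contained in `F a` reduces the first-order condition to one variable. This
yields the full score equation for the MLE, and its nuisance components for the null MLE. -/
theorem eventually_fderiv_eq_zero (h : LocalLik l N Ψ ψlim ψs lk Λ σ)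
    (hΨ : ψlim ∈ interior Ψ) {F : α → Set E} {ψ : α → E}
    (hψ : ∀ᶠ a in l, ψ a ∈ Ψ ∩ F a ∧ ∀ ψ' ∈ Ψ ∩ F a, lk a ψ' ≤ lk a (ψ a))
    (hlim : Tendsto ψ l (𝓝 ψlim)) :
    ∀ᶠ a in l, ∀ v : E, (∀ t : ℝ, ψ a + t • v ∈ F a) →
      fderiv ℝ (fun ψ => Real.log (lk a ψ)) (ψ a) v = 0 := by
  obtain ⟨δ, hδ, hsub, hs⟩ := h.exists_ball hΨ
  filter_upwards [hψ, hlim (Metric.ball_mem_nhds _ hδ), hs] with a h1 h2 h3 v hv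
  have hd := (hasFDerivAt_of_contDiffOn Metric.isOpen_ball h3.2 h2).1
  have hline : HasDerivAt (fun t : ℝ => ψ a + t • v) v 0 := by
    simpa using ((hasDerivAt_id (0 : ℝ)).smul_const v).const_add (ψ a)
  have hd' : HasFDerivAt (fun ψ => Real.log (lk a ψ))
      (fderiv ℝ (fun ψ => Real.log (lk a ψ)) (ψ a)) (ψ a + (0 : ℝ) • v) := by simpa using hd
  have hcomp := hd'.comp_hasDerivAt (0 : ℝ) hline
  have hmax : IsLocalMax ((fun ψ => Real.log (lk a ψ)) ∘ fun t : ℝ => ψ a + t • v) 0 := by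
    have hc : Tendsto (fun t : ℝ => ψ a + t • v) (𝓝 0) (𝓝 (ψ a)) := by
      have := hline.continuousAt.tendsto
      simpa using this
    filter_upwards [hc (Metric.isOpen_ball.mem_nhds h2)] with t ht
    simp only [Function.comp, zero_smul, add_zero]
    exact Real.log_le_log (h3.1 _ ht) (h1.2 _ ⟨hsub ht, hv t⟩)
  exact hmax.hasDerivAt_eq_zero hcomp

theorem tendsto_score (h : LocalLik l N Ψ ψlim ψs lk Λ σ) (hΨ : ψlim ∈ interior Ψ)
    (hN : Tendsto N l atTop) (hψs : Tendsto ψs l (𝓝 ψlim))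
    {x : α → E} (hx : Tendsto x l (𝓝 ψlim)) {u : E}
    (hu : Tendsto (fun a => √(N a) • (x a - ψs a)) l (𝓝 u)) :
    Tendsto (fun a => (√(N a))⁻¹ • fderiv ℝ (fun ψ => Real.log (lk a ψ)) (x a)) l
      (𝓝 (σ - Λ u)) := by
  have hrem : Tendsto (fun a => (√(N a))⁻¹ • (fderiv ℝ (fun ψ => Real.log (lk a ψ)) (x a)
      - fderiv ℝ (fun ψ => Real.log (lk a ψ)) (ψs a) + N a • Λ (x a - ψs a))) l (𝓝 0) := by
    rw [Metric.tendsto_nhds]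
    intro ε hε
    obtain ⟨δ, hδ, hex⟩ := h.grad_expansion hΨ hN (ε := ε / (2 * (‖u‖ + 1))) (by positivity)
    filter_upwards [hu.norm.eventually_lt_const (lt_add_one _), hex,
      hx (Metric.ball_mem_nhds _ hδ), hψs (Metric.ball_mem_nhds _ hδ),
      hN.eventually_gt_atTop 0] with a h1 h2 h3 h4 h5
    have h6 := Real.sqrt_pos.2 h5
    rw [dist_zero_right, norm_smul, norm_inv, Real.norm_of_nonneg h6.le]
    rw [norm_smul, Real.norm_of_nonneg h6.le] at h1
    calc _ ≤ (√(N a))⁻¹ * (ε / (2 * (‖u‖ + 1)) * N a * ‖x a - ψs a‖) := by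
          gcongr; exact h2 _ h4 _ h3
      _ = ε / (2 * (‖u‖ + 1)) * (√(N a) * ‖x a - ψs a‖) := by
          nth_rw 2 [← Real.mul_self_sqrt h5.le]; field_simp
      _ ≤ ε / (2 * (‖u‖ + 1)) * (‖u‖ + 1) := by gcongr
      _ = ε / 2 := by field_simp
      _ < ε := by linarith
  have h1 : Tendsto (fun a => Λ (√(N a) • (x a - ψs a))) l (𝓝 (Λ u)) :=
    (Λ.continuous.tendsto u).comp hu
  have h3 := (hrem.add h.score).sub h1
  rw [zero_add] at h3
  refine h3.congr' ?_
  filter_upwards [hN.eventually_gt_atTop 0] with a ha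
  have h4 : √(N a) ≠ 0 := (Real.sqrt_pos.2 ha).ne'
  have h5 : (√(N a))⁻¹ * N a = √(N a) := by
    nth_rw 2 [← Real.mul_self_sqrt ha.le]; field_simp
  rw [map_smul, smul_add, smul_sub, smul_smul, h5]
  abel

end LocalLik

/-- If `J (x a) - y a` is negligible compared with `x a`, `J` is injective and `y` converges, then
along an ultrafilter `x` converges to a preimage of the limit. -/
theorem exists_tendsto_of_approx {G : Type*} [NormedAddCommGroup G] [NormedSpace ℝ G]
    [FiniteDimensional ℝ E] (l : Ultrafilter α) (J : E →L[ℝ] G)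
    (hJ : ∀ x, J x = 0 → x = 0) {x : α → E} {y : α → G} {y₀ : G}
    (hy : Tendsto y l (𝓝 y₀)) (h : ∀ ε > 0, ∀ᶠ a in l, ‖J (x a) - y a‖ ≤ ε * ‖x a‖) :
    ∃ u, Tendsto x l (𝓝 u) ∧ J u = y₀ := by
  have : ProperSpace E := FiniteDimensional.proper ℝ E
  have hker : LinearMap.ker (J : E →ₗ[ℝ] G) = ⊥ := by
    rw [LinearMap.ker_eq_bot']; exact hJ
  obtain ⟨K, hK, hanti⟩ := (J : E →ₗ[ℝ] G).exists_antilipschitzWith hker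
  have hK' : (0 : ℝ) < K := hK
  have hb : ∀ z, ‖z‖ ≤ K * ‖J z‖ := fun z => by
    have := hanti.le_mul_dist z 0
    simpa using this
  -- The choice `ε = 1 / (2 * K)` makes the error cost at most half of `‖x a‖`, which is absorbed on
  -- the left. Thus boundedness, the `√N` rate in the applications, is a conclusion and not a
  -- hypothesis.
  have hbound : ∀ᶠ a in l, ‖x a‖ ≤ 2 * (K * (‖y₀‖ + 1)) := by
    filter_upwards [h (1 / (2 * K)) (by positivity),
      hy.norm.eventually_lt_const (lt_add_one _)] with a h1 h2
    have h3 : ‖J (x a)‖ ≤ ‖y a‖ + 1 / (2 * K) * ‖x a‖ := by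
      have := norm_add_le (J (x a) - y a) (y a)
      rw [sub_add_cancel] at this
      linarith
    have h4 := hb (x a)
    have h5 : K * (1 / (2 * K) * ‖x a‖) = ‖x a‖ / 2 := by field_simp
    have h6 : K * ‖J (x a)‖ ≤ K * (‖y₀‖ + 1) + ‖x a‖ / 2 := by
      rw [← h5, ← mul_add]; gcongr; linarith
    linarith
  have hmem : Metric.closedBall (0 : E) (2 * (K * (‖y₀‖ + 1))) ∈ l.map x := by
    rw [Ultrafilter.mem_map]
    filter_upwards [hbound] with a ha
    simpa using ha
  obtain ⟨u, -, hu⟩ := (isCompact_closedBall (0 : E) _).ultrafilter_le_nhds' (l.map x) hmem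
  have hu' : Tendsto x l (𝓝 u) := hu
  refine ⟨u, hu', ?_⟩
  have h0 : Tendsto (fun a => J (x a) - y a) l (𝓝 0) := by
    rw [Metric.tendsto_nhds]
    intro ε hε
    filter_upwards [h (ε / (2 * (‖u‖ + 1))) (by positivity),
      hu'.norm.eventually_lt_const (lt_add_one _)] with a h1 h2
    rw [dist_zero_right]
    calc _ ≤ ε / (2 * (‖u‖ + 1)) * (‖u‖ + 1) := h1.trans (by gcongr)
      _ = ε / 2 := by field_simp
      _ < ε := by linarith
  have h1 : Tendsto (fun a => J (x a)) l (𝓝 (J u)) := (J.continuous.tendsto u).comp hu'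
  have := tendsto_nhds_unique h0 (h1.sub hy)
  exact sub_eq_zero.1 this.symm

end LocalAsymptotics

end StackedMI

namespace StackedMI

/-! ### Products of likelihoods, and bilinear forms of matrices -/

section Stacking

variable {α E : Type*} [NormedAddCommGroup E] [NormedSpace ℝ E]

theorem fderiv_sum_of_contDiffOn {ι : Type*} (s : Finset ι) {f : ι → E → ℝ} {g : E → ℝ}
    {V : Set E} (hV : IsOpen V) (hf : ∀ i ∈ s, ContDiffOn ℝ 2 (f i) V)
    (hg : ∀ x ∈ V, g x = ∑ i ∈ s, f i x) {x : E} (hx : x ∈ V) :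
    fderiv ℝ g x = ∑ i ∈ s, fderiv ℝ (f i) x ∧
      fderiv ℝ (fderiv ℝ g) x = ∑ i ∈ s, fderiv ℝ (fderiv ℝ (f i)) x := by
  have h1 : ∀ y ∈ V, fderiv ℝ g y = ∑ i ∈ s, fderiv ℝ (f i) y := fun y hy => by
    have e : g =ᶠ[𝓝 y] fun x => ∑ i ∈ s, f i x := by
      filter_upwards [hV.mem_nhds hy] with z hz using hg z hz
    rw [e.fderiv_eq]
    exact (HasFDerivAt.fun_sum fun i hi => (hasFDerivAt_of_contDiffOn hV (hf i hi) hy).1).fderiv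
  refine ⟨h1 x hx, ?_⟩
  have e : fderiv ℝ g =ᶠ[𝓝 x] fun x => ∑ i ∈ s, fderiv ℝ (f i) x := by
    filter_upwards [hV.mem_nhds hx] with z hz using h1 z hz
  rw [e.fderiv_eq]
  exact (HasFDerivAt.fun_sum fun i hi => (hasFDerivAt_of_contDiffOn hV (hf i hi) hx).2).fderiv

variable {l : Filter α} {N : α → ℝ} {Ψ : Set E} {ψlim : E} {ψs : α → E}

/-- Log-likelihoods add on the common neighbourhood, hence so do informations, normalized scores and
identifiability margins. No independence between the two datasets enters. -/
theorem LocalLik.mul {lk₁ lk₂ : α → E → ℝ} {Λ₁ Λ₂ : E →L[ℝ] E →L[ℝ] ℝ} {σ₁ σ₂ : E →L[ℝ] ℝ}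
    (hψs : Tendsto ψs l (𝓝 ψlim)) (hΨ : ψlim ∈ Ψ)
    (h₁ : LocalLik l N Ψ ψlim ψs lk₁ Λ₁ σ₁) (h₂ : LocalLik l N Ψ ψlim ψs lk₂ Λ₂ σ₂) :
    LocalLik l N Ψ ψlim ψs (fun a ψ => lk₁ a ψ * lk₂ a ψ) (Λ₁ + Λ₂) (σ₁ + σ₂) := by
  obtain ⟨U₁, hU₁, hm₁, hs₁⟩ := h₁.smooth
  obtain ⟨U₂, hU₂, hm₂, hs₂⟩ := h₂.smooth
  have hV : IsOpen (U₁ ∩ U₂) := hU₁.inter hU₂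
  have hder : ∀ᶠ a in l, ∀ x ∈ U₁ ∩ U₂,
      (fderiv ℝ (fun ψ => Real.log (lk₁ a ψ * lk₂ a ψ)) x =
        fderiv ℝ (fun ψ => Real.log (lk₁ a ψ)) x + fderiv ℝ (fun ψ => Real.log (lk₂ a ψ)) x) ∧
      (fderiv ℝ (fderiv ℝ fun ψ => Real.log (lk₁ a ψ * lk₂ a ψ)) x =
        fderiv ℝ (fderiv ℝ fun ψ => Real.log (lk₁ a ψ)) x +
          fderiv ℝ (fderiv ℝ fun ψ => Real.log (lk₂ a ψ)) x) := by
    filter_upwards [hs₁, hs₂] with a ha₁ ha₂ x hx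
    have := fderiv_sum_of_contDiffOn (Finset.univ : Finset Bool)
      (f := fun b ψ => if b then Real.log (lk₁ a ψ) else Real.log (lk₂ a ψ))
      (g := fun ψ => Real.log (lk₁ a ψ * lk₂ a ψ)) hV (fun b _ => ?_) (fun y hy => ?_) hx
    · simpa using this
    · cases b
      · simpa using (ha₂.2.mono Set.inter_subset_right).log fun x hx => (ha₂.1 x hx.2).ne'
      · simpa using (ha₁.2.mono Set.inter_subset_left).log fun x hx => (ha₁.1 x hx.1).ne'
    · simpa using Real.log_mul (ha₁.1 y hy.1).ne' (ha₂.1 y hy.2).ne'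
  refine ⟨fun a ψ hψ => mul_nonneg (h₁.nonneg a ψ hψ) (h₂.nonneg a ψ hψ),
    ⟨U₁ ∩ U₂, hV, ⟨hm₁, hm₂⟩, ?_⟩, ?_, ?_, ?_⟩
  · filter_upwards [hs₁, hs₂] with a ha₁ ha₂
    exact ⟨fun ψ hψ => mul_pos (ha₁.1 ψ hψ.1) (ha₂.1 ψ hψ.2),
      (ha₁.2.mono Set.inter_subset_left).mul (ha₂.2.mono Set.inter_subset_right)⟩
  · have h0 := h₁.hess.add h₂.hess
    rw [add_zero] at h0
    refine squeeze_zero' (Eventually.of_forall fun _ => norm_nonneg (E := E →L[ℝ] E →L[ℝ] ℝ) _) ?_ h0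
    filter_upwards [hder.prod_mk (hV.mem_nhds ⟨hm₁, hm₂⟩)] with z hz
    rw [(hz.1 z.2 hz.2).2]
    refine le_trans (le_of_eq ?_) (norm_add_le (E := E →L[ℝ] E →L[ℝ] ℝ) _ _)
    congr 1
    rw [smul_add]; abel
  · refine (h₁.score.add h₂.score).congr' ?_
    filter_upwards [hder, hψs (hV.mem_nhds ⟨hm₁, hm₂⟩)] with a ha hx
    rw [(ha _ hx).1, smul_add]
  · intro ε hε
    obtain ⟨η₁, hη₁, hi₁⟩ := h₁.ident ε hε
    obtain ⟨η₂, hη₂, hi₂⟩ := h₂.ident ε hε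
    refine ⟨η₁ + η₂, add_pos hη₁ hη₂, ?_⟩
    filter_upwards [hi₁, hi₂] with a ha₁ ha₂ ψ hψ hd
    refine (mul_le_mul (ha₁ ψ hψ hd) (ha₂ ψ hψ hd) (h₂.nonneg a ψ hψ)
      (mul_nonneg (Real.exp_pos _).le (h₁.nonneg a _ hΨ))).trans (le_of_eq ?_)
    rw [mul_add, neg_add, Real.exp_add]; ring

/-- `N` remains the size of a single dataset; stacking shows only in the factor `S.card` of the
information and in the sum of the scores. -/
theorem LocalLik.multiset_prod {ι : Type*} {lk : ι → α → E → ℝ} {Λ : E →L[ℝ] E →L[ℝ] ℝ}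
    {σ : ι → E →L[ℝ] ℝ} (hψs : Tendsto ψs l (𝓝 ψlim)) (hΨ : ψlim ∈ Ψ)
    (h : ∀ i, LocalLik l N Ψ ψlim ψs (lk i) Λ (σ i)) (S : Multiset ι) (hS : S ≠ 0) :
    LocalLik l N Ψ ψlim ψs (fun a ψ => (S.map fun i => lk i a ψ).prod)
      ((S.card : ℝ) • Λ) (S.map σ).sum := by
  induction S using Multiset.induction_on with
  | empty => exact absurd rfl hS
  | cons i S ih =>
    by_cases hS' : S = 0
    · subst hS'
      simpa using h i
    · have := (h i).mul hψs hΨ (ih hS')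
      have e : Λ + (S.card : ℝ) • Λ = (((i ::ₘ S).card : ℕ) : ℝ) • Λ := by
        rw [Multiset.card_cons]; push_cast
        ext x y
        simp only [add_apply, smul_apply, smul_eq_mul]
        ring
      rw [e] at this
      simpa using this

end Stacking

section Bilin

variable {ι : Type*} [Fintype ι]

/-- The bilinear form of a matrix. -/
noncomputable def toBilin (A : Matrix ι ι ℝ) : (ι → ℝ) →L[ℝ] (ι → ℝ) →L[ℝ] ℝ :=
  ∑ a, ∑ b, A a b • (ContinuousLinearMap.proj (R := ℝ) (φ := fun _ : ι => ℝ) a).smulRight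
    (ContinuousLinearMap.proj (R := ℝ) (φ := fun _ : ι => ℝ) b)

theorem toBilin_apply (A : Matrix ι ι ℝ) (x y : ι → ℝ) : toBilin A x y = x ⬝ᵥ A *ᵥ y := by
  simp only [toBilin, sum_apply, smul_apply,
    ContinuousLinearMap.smulRight_apply, ContinuousLinearMap.proj_apply, smul_eq_mul,
    dotProduct, Matrix.mulVec, Finset.mul_sum]
  exact Finset.sum_congr rfl fun a _ => Finset.sum_congr rfl fun b _ => by ring

theorem toBilin_apply_single [DecidableEq ι] (A : Matrix ι ι ℝ) (x : ι → ℝ) (b : ι) :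
    toBilin A x (Pi.single b 1) = (x ᵥ* A) b := by
  rw [toBilin_apply, Matrix.dotProduct_mulVec]; simp

theorem eq_toBilin [DecidableEq ι] (D : (ι → ℝ) →L[ℝ] (ι → ℝ) →L[ℝ] ℝ) :
    D = toBilin (Matrix.of fun a b => D (Pi.single a 1) (Pi.single b 1)) := by
  ext x y
  rw [toBilin_apply]
  conv_lhs => rw [pi_eq_sum_univ' x, pi_eq_sum_univ' y]
  simp only [map_sum, map_smul, sum_apply, smul_apply, dotProduct, Matrix.mulVec, Matrix.of_apply,
    Finset.mul_sum, smul_eq_mul]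
  rw [Finset.sum_comm]
  exact Finset.sum_congr rfl fun a _ => Finset.sum_congr rfl fun b _ => by ring

theorem norm_toBilin_le (A : Matrix ι ι ℝ) : ‖toBilin A‖ ≤ ∑ a, ∑ b, |A a b| := by
  refine ContinuousLinearMap.opNorm_le_bound₂ _ (by positivity) fun x y => ?_
  rw [toBilin_apply]
  simp only [dotProduct, Matrix.mulVec, Finset.mul_sum, Finset.sum_mul]
  refine (norm_sum_le _ _).trans (Finset.sum_le_sum fun a _ => ?_)
  refine (norm_sum_le _ _).trans (Finset.sum_le_sum fun b _ => ?_)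
  rw [norm_mul, norm_mul, Real.norm_eq_abs (A a b)]
  have h1 := norm_le_pi_norm x a
  have h2 := norm_le_pi_norm y b
  calc ‖x a‖ * (|A a b| * ‖y b‖) ≤ ‖x‖ * (|A a b| * ‖y‖) := by gcongr
    _ = _ := by ring

theorem toBilin_add (A B : Matrix ι ι ℝ) : toBilin (A + B) = toBilin A + toBilin B := by
  ext x y
  simp only [add_apply, toBilin_apply, Matrix.add_mulVec, dotProduct_add]

end Bilin

end StackedMI

/-! ### Limits of the unrestricted and of the null MLE along an ultrafilter -/

namespace StackedMI

section RescaledGradient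

variable {α E : Type*} [NormedAddCommGroup E] [NormedSpace ℝ E]
  {l : Filter α} {N : α → ℝ} {Ψ : Set E} {ψlim : E} {ψs : α → E}
  {lk : α → E → ℝ} {Λ : E →L[ℝ] E →L[ℝ] ℝ} {σ : E →L[ℝ] ℝ}

/-- The error is measured relative to the rescaled distance itself, so no rate for `x` is
presupposed. This is the format required by `exists_tendsto_of_approx`. -/
theorem LocalLik.rescaled_grad (h : LocalLik l N Ψ ψlim ψs lk Λ σ) (hΨ : ψlim ∈ interior Ψ)
    (hN : Tendsto N l atTop) (hψs : Tendsto ψs l (𝓝 ψlim))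
    {x : α → E} (hx : Tendsto x l (𝓝 ψlim)) {ε : ℝ} (hε : 0 < ε) :
    ∀ᶠ a in l, ‖Λ (√(N a) • (x a - ψs a))
      - (√(N a))⁻¹ • (fderiv ℝ (fun ψ => Real.log (lk a ψ)) (ψs a)
        - fderiv ℝ (fun ψ => Real.log (lk a ψ)) (x a))‖ ≤ ε * ‖√(N a) • (x a - ψs a)‖ := by
  obtain ⟨δ, hδ, hex⟩ := h.grad_expansion hΨ hN hε
  filter_upwards [hex, hx (Metric.ball_mem_nhds _ hδ), hψs (Metric.ball_mem_nhds _ hδ),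
    hN.eventually_gt_atTop 0] with a h2 h3 h4 h5
  have h6 := Real.sqrt_pos.2 h5
  have h7 : (√(N a))⁻¹ * N a = √(N a) := by
    nth_rw 2 [← Real.mul_self_sqrt h5.le]; field_simp
  have e : Λ (√(N a) • (x a - ψs a))
      - (√(N a))⁻¹ • (fderiv ℝ (fun ψ => Real.log (lk a ψ)) (ψs a)
        - fderiv ℝ (fun ψ => Real.log (lk a ψ)) (x a)) =
      (√(N a))⁻¹ • (fderiv ℝ (fun ψ => Real.log (lk a ψ)) (x a)
        - fderiv ℝ (fun ψ => Real.log (lk a ψ)) (ψs a) + N a • Λ (x a - ψs a)) := by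
    rw [map_smul, smul_add, smul_sub, smul_sub, smul_smul, h7]; abel
  rw [e, norm_smul, norm_inv, norm_smul, Real.norm_of_nonneg h6.le]
  calc _ ≤ (√(N a))⁻¹ * (ε * N a * ‖x a - ψs a‖) := by gcongr; exact h2 _ h4 _ h3
    _ = ε * ((√(N a))⁻¹ * N a * ‖x a - ψs a‖) := by ring
    _ = _ := by rw [h7]

end RescaledGradient

theorem tendsto_matrix_inv {α ι : Type*} [Fintype ι] [DecidableEq ι] {l : Filter α}
    {f : α → Matrix ι ι ℝ} {A : Matrix ι ι ℝ} (hf : Tendsto f l (𝓝 A)) (hA : IsUnit A) :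
    Tendsto (fun a => (f a)⁻¹) l (𝓝 A⁻¹) := by
  have hd : A.det ≠ 0 := ((Matrix.isUnit_iff_isUnit_det A).1 hA).ne_zero
  have hc : ContinuousAt Ring.inverse A.det := by
    rw [Ring.inverse_eq_inv']
    exact continuousAt_inv₀ hd
  exact (continuousAt_matrix_inv A hc).tendsto.comp hf

theorem eventually_isUnit {α ι : Type*} [Fintype ι] [DecidableEq ι] {l : Filter α}
    {f : α → Matrix ι ι ℝ} {A : Matrix ι ι ℝ} (hf : Tendsto f l (𝓝 A)) (hA : IsUnit A) :
    ∀ᶠ a in l, IsUnit (f a) := by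
  have hd : A.det ≠ 0 := ((Matrix.isUnit_iff_isUnit_det A).1 hA).ne_zero
  have h1 : Tendsto (fun a => (f a).det) l (𝓝 A.det) :=
    ((continuous_id.matrix_det).tendsto A).comp hf
  filter_upwards [h1.eventually_ne hd] with a ha
  exact (Matrix.isUnit_iff_isUnit_det _).2 (isUnit_iff_ne_zero.2 ha)

theorem inv_smul_of_ne_zero {ι : Type*} [Fintype ι] [DecidableEq ι] (A : Matrix ι ι ℝ) {c : ℝ}
    (hc : c ≠ 0) (hA : IsUnit A) : (c • A)⁻¹ = c⁻¹ • A⁻¹ :=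
  Matrix.inv_smul' A (Units.mk0 c hc) ((Matrix.isUnit_iff_isUnit_det A).1 hA)

/-- The quadratic form `xᵀ W x`. -/
def quad {ι : Type*} [Fintype ι] (W : Matrix ι ι ℝ) (x : ι → ℝ) : ℝ := x ⬝ᵥ W *ᵥ x

theorem continuous_quad {ι : Type*} [Fintype ι] :
    Continuous fun z : Matrix ι ι ℝ × (ι → ℝ) => quad z.1 z.2 := by
  unfold quad
  exact continuous_snd.dotProduct (continuous_fst.matrix_mulVec continuous_snd)

theorem tendsto_quad {α ι : Type*} [Fintype ι] {l : Filter α} {W : α → Matrix ι ι ℝ}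
    {W₀ : Matrix ι ι ℝ} {x : α → ι → ℝ} {x₀ : ι → ℝ} (hW : Tendsto W l (𝓝 W₀))
    (hx : Tendsto x l (𝓝 x₀)) : Tendsto (fun a => quad (W a) (x a)) l (𝓝 (quad W₀ x₀)) :=
  (continuous_quad.tendsto (W₀, x₀)).comp (hW.prodMk_nhds hx)

theorem quad_smul {ι : Type*} [Fintype ι] (W : Matrix ι ι ℝ) (c : ℝ) (x : ι → ℝ) :
    quad W (c • x) = c ^ 2 * quad W x := by
  simp only [quad, Matrix.mulVec_smul, smul_dotProduct, dotProduct_smul, smul_eq_mul]; ring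

theorem smul_quad {ι : Type*} [Fintype ι] (W : Matrix ι ι ℝ) (c : ℝ) (x : ι → ℝ) :
    quad (c • W) x = c * quad W x := by
  simp only [quad, Matrix.smul_mulVec, dotProduct_smul, smul_eq_mul]

variable {p k q : ℕ}

theorem isUnit_inv_block {i : Matrix (Fin k ⊕ Fin q) (Fin k ⊕ Fin q) ℝ} (hi : i.PosDef) :
    IsUnit (i⁻¹).toBlocks₁₁ :=
  (hi.inv.submatrix Sum.inl_injective).isUnit

/-- The profile quadratic form: if `i g` vanishes in the nuisance coordinates then `gᵀ i g` is a
quadratic form in the coordinates of interest. -/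
theorem quad_eq_quad_profile {i : Matrix (Fin k ⊕ Fin q) (Fin k ⊕ Fin q) ℝ} (hi : i.PosDef)
    {g : Param k q} (hg : ∀ j, (i *ᵥ g) (Sum.inr j) = 0) :
    quad i g = quad ((i⁻¹).toBlocks₁₁)⁻¹ (thetaPart g) := by
  have hu : IsUnit i := hi.isUnit
  have hdet := (Matrix.isUnit_iff_isUnit_det i).1 hu
  have hdetW := (Matrix.isUnit_iff_isUnit_det _).1 (isUnit_inv_block hi)
  have h1 : g = i⁻¹ *ᵥ (i *ᵥ g) := by
    rw [Matrix.mulVec_mulVec, Matrix.nonsing_inv_mul _ hdet, Matrix.one_mulVec]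
  have h2 : thetaPart g = (i⁻¹).toBlocks₁₁ *ᵥ thetaPart (i *ᵥ g) := by
    conv_lhs => rw [h1]
    ext a
    simp [thetaPart, Matrix.mulVec, dotProduct, Fintype.sum_sum_type, Matrix.toBlocks₁₁] at hg ⊢
    simp [hg]
  have h3 : thetaPart (i *ᵥ g) = ((i⁻¹).toBlocks₁₁)⁻¹ *ᵥ thetaPart g := by
    conv_rhs => rw [h2]
    rw [Matrix.mulVec_mulVec, Matrix.nonsing_inv_mul _ hdetW, Matrix.one_mulVec]
  unfold quad
  rw [← h3]
  simp [dotProduct, Fintype.sum_sum_type, hg, thetaPart]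

section Device

variable {α : Type*} {M : Model p k q} {l : Ultrafilter α} {N : α → ℝ} {ψlim : Param k q}
  {ψs : α → Param k q} {x : α → List (Row p)} {s : ℝ}
  {i : Matrix (Fin k ⊕ Fin q) (Fin k ⊕ Fin q) ℝ} {σ : Param k q →L[ℝ] ℝ}

theorem toBilin_symm {i : Matrix (Fin k ⊕ Fin q) (Fin k ⊕ Fin q) ℝ} (hi : i.PosDef)
    (x y : Param k q) : toBilin i x y = toBilin i y x := by
  rw [toBilin_apply, toBilin_apply, Matrix.dotProduct_mulVec, dotProduct_comm,
    ← Matrix.mulVec_transpose]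
  have : iᵀ = i := by simpa using hi.isHermitian.eq
  rw [this]

theorem smul_toBilin_symm (hi : i.PosDef) (x y : Param k q) :
    (s • toBilin i) x y = (s • toBilin i) y x := by
  simp only [smul_apply, toBilin_symm hi x y]

theorem quad_pos (hi : i.PosDef) {x : Param k q} (hx : x ≠ 0) : 0 < quad i x := by
  simpa [quad] using hi.dotProduct_mulVec_pos hx

theorem clm_apply_eq_sum {ι : Type*} [Fintype ι] [DecidableEq ι] (f : (ι → ℝ) →L[ℝ] ℝ)
    (v : ι → ℝ) : f v = ∑ a, v a * f (Pi.single a 1) := by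
  conv_lhs => rw [pi_eq_sum_univ' v]
  simp only [map_sum, map_smul, smul_eq_mul]

theorem smul_toBilin_self (x : Param k q) : (s • toBilin i) x x = s * quad i x := by
  simp [toBilin_apply, quad]

/-- The score vanishes at the MLE, so `rescaled_grad` becomes an approximate linear equation for the
rescaled error with an injective operator; rate and limit come out together. -/
theorem exists_tendsto_mle (A : Analyst M) (hs : 0 < s) (hi : i.PosDef)
    (hΨ : ψlim ∈ interior M.Ψ) (hN : Tendsto N l atTop) (hψs : Tendsto ψs l (𝓝 ψlim))
    (h : LocalLik l N M.Ψ ψlim ψs (fun a => lik M (x a)) (s • toBilin i) σ) :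
    Tendsto (fun a => A.psiHat (x a)) l (𝓝 ψlim) ∧
      ∃ u, Tendsto (fun a => √(N a) • (A.psiHat (x a) - ψs a)) l (𝓝 u) ∧
        (s • toBilin i) u = σ := by
  have hsym := smul_toBilin_symm (s := s) hi
  have hmax : ∀ᶠ a in l, A.psiHat (x a) ∈ M.Ψ ∩ Set.univ ∧
      ∀ ψ' ∈ M.Ψ ∩ Set.univ, lik M (x a) ψ' ≤ lik M (x a) (A.psiHat (x a)) := by
    filter_upwards [h.eventually_exists_max hΨ hN hsym hψs hψs (F := fun _ => Set.univ)
      (fun _ => isClosed_univ) (fun _ => Set.mem_univ _)] with a ha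
    obtain ⟨ψ, hψ, hm⟩ := ha
    have := A.psiHat_spec (x a) ⟨ψ, hψ.1, fun ψ' h' => hm ψ' ⟨h', Set.mem_univ _⟩⟩
    exact ⟨⟨this.1, Set.mem_univ _⟩, fun ψ' h' => this.2 ψ' h'.1⟩
  have hlim := h.tendsto_max hΨ hN hsym hψs hψs (F := fun _ => Set.univ)
    (fun _ => Set.mem_univ _) hmax
  have hz := h.eventually_fderiv_eq_zero hΨ hmax hlim
  refine ⟨hlim, exists_tendsto_of_approx l (s • toBilin i) (fun v hv => ?_) h.score ?_⟩
  · by_contra hne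
    have h1 := smul_toBilin_self (s := s) (i := i) v
    rw [hv] at h1
    exact (mul_pos hs (quad_pos hi hne)).ne h1
  · intro ε hε
    filter_upwards [h.rescaled_grad hΨ hN hψs hlim hε, hz] with a h1 h2
    have h3 : fderiv ℝ (fun ψ => Real.log (lik M (x a) ψ)) (A.psiHat (x a)) = 0 := by
      ext v; exact h2 v fun _ => Set.mem_univ _
    rwa [h3, sub_zero] at h1

/-- The parameter of the null hypothesis with the nuisance part of `ψ`. -/
def withTheta (θ : Fin k → ℝ) (ψ : Param k q) : Param k q := Sum.elim θ fun j => ψ (Sum.inr j)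

/-- The constraint prescribes the `θ` coordinates of the rescaled error, and the score equation
holds in the nuisance directions only. Together they form the injective linear system `J`. -/
theorem exists_tendsto_null (A : Analyst M) (hs : 0 < s) (hi : i.PosDef)
    (hΨ : ψlim ∈ interior M.Ψ) (hN : Tendsto N l atTop) (hψs : Tendsto ψs l (𝓝 ψlim))
    (h : LocalLik l N M.Ψ ψlim ψs (fun a => lik M (x a)) (s • toBilin i) σ)
    {θ₀ : α → Fin k → ℝ} {δ : Fin k → ℝ}
    (hδ : Tendsto (fun a => √(N a) • (thetaPart (ψs a) - θ₀ a)) l (𝓝 δ)) :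
    Tendsto (fun a => A.psiNull (θ₀ a) (x a)) l (𝓝 ψlim) ∧
      ∃ u, Tendsto (fun a => √(N a) • (A.psiNull (θ₀ a) (x a) - ψs a)) l (𝓝 u) ∧
        thetaPart u = -δ ∧
        ∀ j, (s • toBilin i) u (Pi.single (Sum.inr j) 1) = σ (Pi.single (Sum.inr j) 1) := by
  have hsym := smul_toBilin_symm (s := s) hi
  have hs0 : Tendsto (fun a => (√(N a))⁻¹) l (𝓝 0) :=
    (Real.tendsto_sqrt_atTop.comp hN).inv_tendsto_atTop
  have hθ : Tendsto (fun a => thetaPart (ψs a) - θ₀ a) l (𝓝 0) := by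
    have := hs0.smul hδ
    rw [zero_smul] at this
    refine this.congr' ?_
    filter_upwards [hN.eventually_gt_atTop 0] with a ha
    rw [smul_smul, inv_mul_cancel₀ (Real.sqrt_pos.2 ha).ne', one_smul]
  have hx0 : Tendsto (fun a => withTheta (θ₀ a) (ψs a)) l (𝓝 ψlim) := by
    rw [tendsto_pi_nhds] at hψs hθ ⊢
    rintro (j | j)
    · have := (hψs (Sum.inl j)).sub (hθ j)
      simpa [withTheta, thetaPart] using this
    · exact hψs (Sum.inr j)
  let F : α → Set (Param k q) := fun a => {ψ | thetaPart ψ = θ₀ a}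
  have hcθ : Continuous (thetaPart : Param k q → Fin k → ℝ) := by
    unfold thetaPart; fun_prop
  have hF : ∀ a, IsClosed (F a) := fun a => isClosed_eq hcθ continuous_const
  have hxF : ∀ a, withTheta (θ₀ a) (ψs a) ∈ F a := fun a => rfl
  have hmax : ∀ᶠ a in l, A.psiNull (θ₀ a) (x a) ∈ M.Ψ ∩ F a ∧
      ∀ ψ' ∈ M.Ψ ∩ F a, lik M (x a) ψ' ≤ lik M (x a) (A.psiNull (θ₀ a) (x a)) := by
    filter_upwards [h.eventually_exists_max hΨ hN hsym hψs hx0 hF hxF] with a ha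
    obtain ⟨ψ, hψ, hm⟩ := ha
    have := A.psiNull_spec (θ₀ a) (x a) ⟨ψ, hψ.1, hψ.2, fun ψ' h' h'' => hm ψ' ⟨h', h''⟩⟩
    exact ⟨⟨this.1, this.2.1⟩, fun ψ' h' => this.2.2 ψ' h'.1 h'.2⟩
  have hlim := h.tendsto_max hΨ hN hsym hψs hx0 hxF hmax
  have hz := h.eventually_fderiv_eq_zero hΨ hmax hlim
  refine ⟨hlim, ?_⟩
  let prθ : Param k q →L[ℝ] (Fin k → ℝ) :=
    ContinuousLinearMap.pi fun j => ContinuousLinearMap.proj (Sum.inl j)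
  let e : Fin q → Param k q := fun j => Pi.single (Sum.inr j) 1
  let pη : Param k q →L[ℝ] (Fin q → ℝ) := ContinuousLinearMap.pi fun j =>
    (s • toBilin i).flip (e j)
  let J : Param k q →L[ℝ] (Fin k → ℝ) × (Fin q → ℝ) := prθ.prod pη
  have hpη : ∀ v j, pη v j = (s • toBilin i) v (e j) := fun v j => rfl
  have hy : Tendsto (fun a => ((-(√(N a) • (thetaPart (ψs a) - θ₀ a)) : Fin k → ℝ),
      (fun j => ((√(N a))⁻¹ • fderiv ℝ (fun ψ => Real.log (lik M (x a) ψ)) (ψs a)) (e j) :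
        Fin q → ℝ))) l (𝓝 (-δ, fun j => σ (e j))) := by
    refine hδ.neg.prodMk_nhds (tendsto_pi_nhds.2 fun j => ?_)
    exact tendsto_clm_apply h.score tendsto_const_nhds
  have hne : ∀ j, ‖e j‖ ≤ 1 := fun j => by
    simp only [e, Pi.norm_single, norm_one, le_refl]
  have hinj : ∀ v, J v = 0 → v = 0 := by
    intro v hv
    have h1 : ∀ j, v (Sum.inl j) = 0 := fun j => congrFun (congrArg Prod.fst hv) j
    have h2 : ∀ j, (s • toBilin i) v (e j) = 0 := fun j => congrFun (congrArg Prod.snd hv) j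
    by_contra hne
    have h3 := smul_toBilin_self (s := s) (i := i) v
    -- Each product of coordinates of `v` and of `i v` contains a vanishing factor, which
    -- contradicts positive definiteness.
    have h4 : (s • toBilin i) v v = 0 := by
      rw [clm_apply_eq_sum, Fintype.sum_sum_type]
      simp only [h1, zero_mul, Finset.sum_const_zero, zero_add]
      exact Finset.sum_eq_zero fun j _ => by rw [h2 j, mul_zero]
    rw [h4] at h3
    exact (mul_pos hs (quad_pos hi hne)).ne h3
  have happ : ∀ ε > 0, ∀ᶠ a in l, ‖J (√(N a) • (A.psiNull (θ₀ a) (x a) - ψs a)) -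
      ((-(√(N a) • (thetaPart (ψs a) - θ₀ a)) : Fin k → ℝ),
      (fun j => ((√(N a))⁻¹ • fderiv ℝ (fun ψ => Real.log (lik M (x a) ψ)) (ψs a)) (e j) :
        Fin q → ℝ))‖ ≤ ε * ‖√(N a) • (A.psiNull (θ₀ a) (x a) - ψs a)‖ := by
    intro ε hε
    filter_upwards [h.rescaled_grad hΨ hN hψs hlim hε, hz, hmax] with a h1 h2 h3
    refine norm_prod_le_iff.2 ⟨?_, (pi_norm_le_iff_of_nonneg (by positivity)).2 fun j => ?_⟩
    · have : thetaPart (A.psiNull (θ₀ a) (x a)) = θ₀ a := h3.1.2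
      have e0 : (J (√(N a) • (A.psiNull (θ₀ a) (x a) - ψs a))).1 -
          -(√(N a) • (thetaPart (ψs a) - θ₀ a)) = 0 := by
        ext j
        have := congrFun this j
        simp only [thetaPart] at this
        simp only [J, prθ, ContinuousLinearMap.prod_apply, ContinuousLinearMap.coe_pi',
          ContinuousLinearMap.proj_apply, Pi.sub_apply, Pi.neg_apply, Pi.smul_apply, smul_eq_mul,
          thetaPart, Pi.zero_apply, this]
        ring
      simp only [Prod.fst_sub]
      rw [e0, norm_zero]; positivity
    · have h4 : fderiv ℝ (fun ψ => Real.log (lik M (x a) ψ)) (A.psiNull (θ₀ a) (x a)) (e j) = 0 :=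
        h2 (e j) fun t => by
          have : thetaPart (A.psiNull (θ₀ a) (x a)) = θ₀ a := h3.1.2
          refine Eq.trans ?_ this
          ext c
          simp [thetaPart, e]
      have h5 := (ContinuousLinearMap.le_opNorm _ (e j)).trans
        (mul_le_mul h1 (hne j) (norm_nonneg _) (by positivity))
      rw [mul_one] at h5
      refine le_trans (le_of_eq ?_) h5
      congr 1
      simp only [Prod.snd_sub, Pi.sub_apply, sub_apply, smul_apply, h4, sub_zero]
      rfl
  obtain ⟨u, hu, hJu⟩ := exists_tendsto_of_approx l J hinj hy happ
  exact ⟨u, hu, congrArg Prod.fst hJu, fun j => congrFun (congrArg Prod.snd hJu) j⟩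

end Device

end StackedMI

/-! ### Common limit of the Wald, likelihood ratio and score statistics -/

namespace StackedMI

variable {p k q : ℕ}

section Device

variable {α : Type*} {M : Model p k q} {l : Ultrafilter α} {N : α → ℝ} {ψlim : Param k q}
  {ψs : α → Param k q} {x : α → List (Row p)} {s : ℝ}
  {i : Matrix (Fin k ⊕ Fin q) (Fin k ⊕ Fin q) ℝ} {σ : Param k q →L[ℝ] ℝ}
  {θ₀ : α → Fin k → ℝ} {δ : Fin k → ℝ} {u : Param k q}

theorem continuous_thetaPart : Continuous (thetaPart : Param k q → Fin k → ℝ) := by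
  unfold thetaPart; fun_prop

theorem thetaPart_sub (ψ φ : Param k q) : thetaPart (ψ - φ) = thetaPart ψ - thetaPart φ := rfl

theorem thetaPart_add (ψ φ : Param k q) : thetaPart (ψ + φ) = thetaPart ψ + thetaPart φ := rfl

theorem thetaPart_smul (c : ℝ) (ψ : Param k q) : thetaPart (c • ψ) = c • thetaPart ψ := rfl

theorem hess_apply (g : Param k q → ℝ) (ψ : Param k q) (a b : Fin k ⊕ Fin q) :
    hess g ψ a b = fderiv ℝ (fderiv ℝ g) ψ (Pi.single a 1) (Pi.single b 1) := by
  simp [hess, iteratedFDeriv_two_apply]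

theorem toBilin_single_single (A : Matrix (Fin k ⊕ Fin q) (Fin k ⊕ Fin q) ℝ)
    (a b : Fin k ⊕ Fin q) : toBilin A (Pi.single a 1) (Pi.single b 1) = A a b := by
  rw [toBilin_apply_single]; simp

theorem tendsto_wald (A : Analyst M) (hs : 0 < s) (hi : i.PosDef) (hN : Tendsto N l atTop)
    (hδ : Tendsto (fun a => √(N a) • (thetaPart (ψs a) - θ₀ a)) l (𝓝 δ))
    (hu : Tendsto (fun a => √(N a) • (A.psiHat (x a) - ψs a)) l (𝓝 u))
    (hlen : ∀ a, ((x a).length : ℝ) = s * N a)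
    (hv : Tendsto (fun a => A.v (A.psiHat (x a)) (fun c => ((x a).length : ℝ)⁻¹ *
      ((x a).map fun row => A.h row (A.psiHat (x a)) c).sum)) l (𝓝 (i⁻¹).toBlocks₁₁)) :
    Tendsto (fun a => s⁻¹ * device A (θ₀ a) (x a) .wald) l
      (𝓝 (quad ((i⁻¹).toBlocks₁₁)⁻¹ (thetaPart u + δ))) := by
  have h1 := ((continuous_thetaPart.tendsto u).comp hu).add hδ
  refine (tendsto_quad (tendsto_matrix_inv hv (isUnit_inv_block hi)) h1).congr' ?_
  filter_upwards [hN.eventually_gt_atTop 0, eventually_isUnit hv (isUnit_inv_block hi)]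
    with a ha hua
  have e1 : thetaPart (√(N a) • (A.psiHat (x a) - ψs a)) +
      √(N a) • (thetaPart (ψs a) - θ₀ a) = √(N a) • (A.thetaHat (x a) - θ₀ a) := by
    rw [thetaPart_smul, thetaPart_sub, ← smul_add, sub_add_sub_cancel]; rfl
  have e2 : s * N a ≠ 0 := (mul_pos hs ha).ne'
  simp only [Function.comp]
  rw [e1, quad_smul, Real.sq_sqrt ha.le]
  simp only [device, Analyst.VHat]
  rw [inv_smul_of_ne_zero _ (inv_ne_zero (by rw [hlen]; exact e2)) hua, inv_inv, hlen]
  simp only [quad, Matrix.smul_mulVec, dotProduct_smul, smul_eq_mul]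
  rw [← mul_assoc, inv_mul_cancel_left₀ hs.ne']

/-- Both MLEs satisfy the same limiting nuisance score equations, so `i (u - u₀)` vanishes in the
nuisance coordinates and the profile form applies. -/
theorem quad_sub_eq (hi : i.PosDef) {σ : Param k q →L[ℝ] ℝ} {u₀ : Param k q}
    (hs : 0 < s) (hσ : (s • toBilin i) u = σ) (hθ : thetaPart u₀ = -δ)
    (h0 : ∀ j, (s • toBilin i) u₀ (Pi.single (Sum.inr j) 1) = σ (Pi.single (Sum.inr j) 1)) :
    quad i (u - u₀) = quad ((i⁻¹).toBlocks₁₁)⁻¹ (thetaPart u + δ) := by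
  rw [quad_eq_quad_profile hi, thetaPart_sub, hθ, sub_neg_eq_add]
  intro j
  have h1 := h0 j
  rw [← hσ, smul_apply, smul_apply, smul_apply, smul_apply, smul_eq_mul, smul_eq_mul] at h1
  have h2 := mul_left_cancel₀ hs.ne' h1
  rw [toBilin_symm hi u₀, toBilin_symm hi u, toBilin_apply, toBilin_apply] at h2
  simp only [single_one_dotProduct] at h2
  rw [Matrix.mulVec_sub, Pi.sub_apply, h2, sub_self]

/-- Because `σ = s i u`, completing the square turns the difference of the two quadratic expansions
into `s / 2` times `quad i (u - u₀)`. -/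
theorem tendsto_likelihoodRatio (A : Analyst M) (hs : 0 < s) (hi : i.PosDef)
    (hΨ : ψlim ∈ interior M.Ψ) (hN : Tendsto N l atTop) (hψs : Tendsto ψs l (𝓝 ψlim))
    (h : LocalLik l N M.Ψ ψlim ψs (fun a => lik M (x a)) (s • toBilin i) σ)
    (hδ : Tendsto (fun a => √(N a) • (thetaPart (ψs a) - θ₀ a)) l (𝓝 δ))
    (hlim : Tendsto (fun a => A.psiHat (x a)) l (𝓝 ψlim))
    (hu : Tendsto (fun a => √(N a) • (A.psiHat (x a) - ψs a)) l (𝓝 u))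
    (hσ : (s • toBilin i) u = σ) :
    Tendsto (fun a => s⁻¹ * device A (θ₀ a) (x a) .likelihoodRatio) l
      (𝓝 (quad ((i⁻¹).toBlocks₁₁)⁻¹ (thetaPart u + δ))) := by
  have hsym := smul_toBilin_symm (s := s) hi
  obtain ⟨hlim0, u₀, hu₀, hθ, hη⟩ := exists_tendsto_null A hs hi hΨ hN hψs h hδ
  obtain ⟨r, hr, -, hsm⟩ := h.exists_ball hΨ
  have h1 := ((h.tendsto_log_sub hΨ hN hsym hψs hlim hu).sub
    (h.tendsto_log_sub hΨ hN hsym hψs hlim0 hu₀)).const_mul (s⁻¹ * 2)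
  have e : s⁻¹ * 2 * (σ u - (s • toBilin i) u u / 2 - (σ u₀ - (s • toBilin i) u₀ u₀ / 2)) =
      quad ((i⁻¹).toBlocks₁₁)⁻¹ (thetaPart u + δ) := by
    rw [← quad_sub_eq hi hs hσ hθ hη, ← hσ]
    have h2 : quad i (u - u₀) = toBilin i (u - u₀) (u - u₀) := by rw [toBilin_apply, quad]
    have h3 := toBilin_symm hi u u₀
    rw [h2]
    simp only [map_sub, sub_apply, smul_apply, smul_eq_mul]
    rw [← h3]
    field_simp
    ring
  rw [e] at h1
  refine h1.congr' ?_
  filter_upwards [hsm, hlim (Metric.ball_mem_nhds _ hr), hlim0 (Metric.ball_mem_nhds _ hr)]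
    with a h2 h3 h4
  simp only [device]
  rw [Real.log_div (h2.1 _ h3).ne' (h2.1 _ h4).ne']
  ring

/-- The rescaled score at the null MLE tends to `s i (u - u₀)` and the normalized information to `s
i`, so the statistic tends to `s` times `quad i (u - u₀)`. -/
theorem tendsto_score_test (A : Analyst M) (hs : 0 < s) (hi : i.PosDef)
    (hΨ : ψlim ∈ interior M.Ψ) (hN : Tendsto N l atTop) (hψs : Tendsto ψs l (𝓝 ψlim))
    (h : LocalLik l N M.Ψ ψlim ψs (fun a => lik M (x a)) (s • toBilin i) σ)
    (hδ : Tendsto (fun a => √(N a) • (thetaPart (ψs a) - θ₀ a)) l (𝓝 δ))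
    (hσ : (s • toBilin i) u = σ) :
    Tendsto (fun a => s⁻¹ * device A (θ₀ a) (x a) .score) l
      (𝓝 (quad ((i⁻¹).toBlocks₁₁)⁻¹ (thetaPart u + δ))) := by
  obtain ⟨hlim0, u₀, hu₀, hθ, hη⟩ := exists_tendsto_null A hs hi hΨ hN hψs h hδ
  have hdet := (Matrix.isUnit_iff_isUnit_det i).1 hi.isUnit
  have hu : IsUnit (s • i) := by
    rw [Matrix.isUnit_iff_isUnit_det, Matrix.det_smul]
    exact (isUnit_iff_ne_zero.2 (pow_ne_zero _ hs.ne')).mul hdet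
  have hinfo : Tendsto (fun a => (N a)⁻¹ • info M (x a) (A.psiNull (θ₀ a) (x a))) l
      (𝓝 (s • i)) := by
    refine tendsto_pi_nhds.2 fun b => tendsto_pi_nhds.2 fun c => ?_
    rw [tendsto_iff_norm_sub_tendsto_zero]
    have hp : Tendsto (fun a => (a, A.psiNull (θ₀ a) (x a))) l (l ×ˢ 𝓝 ψlim) :=
      tendsto_id.prodMk hlim0
    have h1 := h.hess.comp hp
    simp only [Function.comp_def] at h1
    refine squeeze_zero (fun _ => norm_nonneg _) (fun a => ?_) h1
    have h2 := ContinuousLinearMap.le_opNorm₂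
      ((N a)⁻¹ • fderiv ℝ (fderiv ℝ fun ψ => Real.log (lik M (x a) ψ))
        (A.psiNull (θ₀ a) (x a)) + s • toBilin i) (Pi.single b 1) (Pi.single c 1)
    rw [Pi.norm_single, Pi.norm_single, norm_one, mul_one, mul_one] at h2
    refine le_trans (le_of_eq ?_) h2
    rw [← norm_neg]
    congr 1
    simp only [add_apply, smul_apply, toBilin_single_single, Matrix.smul_apply, info,
      Matrix.neg_apply, smul_eq_mul, hess_apply]
    change -(_ * -_ - _) = _ * fderiv ℝ (fderiv ℝ (loglik M (x a))) _ _ _ + _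
    ring
  have hgrad : Tendsto (fun a => (√(N a))⁻¹ • grad (loglik M (x a)) (A.psiNull (θ₀ a) (x a))) l
      (𝓝 (s • (i *ᵥ (u - u₀)))) := by
    rw [tendsto_pi_nhds]; intro b
    have h1 := tendsto_clm_apply (h.tendsto_score hΨ hN hψs hlim0 hu₀)
      (tendsto_const_nhds (x := (Pi.single b 1 : Param k q)))
    have e : (σ - (s • toBilin i) u₀) (Pi.single b 1) = (s • (i *ᵥ (u - u₀))) b := by
      rw [← hσ, ← map_sub, smul_apply, smul_apply, toBilin_symm hi, toBilin_apply,
        single_one_dotProduct]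
      rfl
    rw [e] at h1
    exact h1
  have h1 := tendsto_quad (tendsto_matrix_inv hinfo hu) hgrad
  have e : s⁻¹ * quad (s • i)⁻¹ (s • (i *ᵥ (u - u₀))) =
      quad ((i⁻¹).toBlocks₁₁)⁻¹ (thetaPart u + δ) := by
    rw [← quad_sub_eq hi hs hσ hθ hη, quad_smul, inv_smul_of_ne_zero _ hs.ne' hi.isUnit, smul_quad]
    have : quad i⁻¹ (i *ᵥ (u - u₀)) = quad i (u - u₀) := by
      unfold quad
      rw [Matrix.mulVec_mulVec, Matrix.nonsing_inv_mul _ hdet, Matrix.one_mulVec, dotProduct_comm]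
    rw [this]
    field_simp
  have h2 := h1.const_mul s⁻¹
  rw [e] at h2
  refine h2.congr' ?_
  filter_upwards [hN.eventually_gt_atTop 0, eventually_isUnit hinfo hu] with a ha hua
  congr 1
  simp only [device]
  have e3 : info M (x a) (A.psiNull (θ₀ a) (x a)) =
      N a • ((N a)⁻¹ • info M (x a) (A.psiNull (θ₀ a) (x a))) := by
    rw [smul_smul, mul_inv_cancel₀ ha.ne', one_smul]
  conv_rhs => rw [e3, inv_smul_of_ne_zero _ ha.ne' hua]
  rw [quad_smul, inv_pow, Real.sq_sqrt ha.le, ← smul_quad]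
  rfl

/-- All three devices have the same limit, so the choice of test plays no role in the later limit
arguments. -/
theorem tendsto_device (A : Analyst M) (t : Test) (hs : 0 < s) (hi : i.PosDef)
    (hΨ : ψlim ∈ interior M.Ψ) (hN : Tendsto N l atTop) (hψs : Tendsto ψs l (𝓝 ψlim))
    (h : LocalLik l N M.Ψ ψlim ψs (fun a => lik M (x a)) (s • toBilin i) σ)
    (hδ : Tendsto (fun a => √(N a) • (thetaPart (ψs a) - θ₀ a)) l (𝓝 δ))
    (hlim : Tendsto (fun a => A.psiHat (x a)) l (𝓝 ψlim))
    (hu : Tendsto (fun a => √(N a) • (A.psiHat (x a) - ψs a)) l (𝓝 u))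
    (hσ : (s • toBilin i) u = σ)
    (hlen : ∀ a, ((x a).length : ℝ) = s * N a)
    (hv : Tendsto (fun a => A.v (A.psiHat (x a)) (fun c => ((x a).length : ℝ)⁻¹ *
      ((x a).map fun row => A.h row (A.psiHat (x a)) c).sum)) l (𝓝 (i⁻¹).toBlocks₁₁)) :
    Tendsto (fun a => s⁻¹ * device A (θ₀ a) (x a) t) l
      (𝓝 (quad ((i⁻¹).toBlocks₁₁)⁻¹ (thetaPart u + δ))) := by
  cases t
  · exact tendsto_wald A hs hi hN hδ hu hlen hv
  · exact tendsto_likelihoodRatio A hs hi hΨ hN hψs h hδ hlim hu hσ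
  · exact tendsto_score_test A hs hi hΨ hN hψs h hδ hσ

end Device

end StackedMI

/-! ### Convergence in probability as a filter, and likelihoods of completed datasets -/

namespace StackedMI

section ProbFilter

variable {Ω : Type*} [MeasurableSpace Ω] {P : Measure Ω}

/-- The filter of sets of pairs `(n, ω)` whose `n`-sections have probability tending to one.
Convergence along it is convergence in probability. -/
def probFilter (P : Measure Ω) : Filter (ℕ × Ω) where
  sets := {A | Tendsto (fun n => P {ω | (n, ω) ∉ A}) atTop (𝓝 0)}
  univ_sets := by simp
  sets_of_superset := by
    intro A B hA hAB
    exact tendsto_of_tendsto_of_tendsto_of_le_of_le tendsto_const_nhds hA (fun _ => zero_le)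
      fun n => measure_mono fun ω hω h => hω (hAB h)
  inter_sets := by
    intro A B hA hB
    have := Tendsto.add hA hB
    rw [add_zero] at this
    refine tendsto_of_tendsto_of_tendsto_of_le_of_le tendsto_const_nhds this (fun _ => zero_le)
      fun n => (measure_mono fun ω hω => ?_).trans (measure_union_le _ _)
    by_contra hc
    simp only [Set.mem_union, not_or] at hc
    exact hω ⟨not_not.1 hc.1, not_not.1 hc.2⟩

theorem eventually_probFilter {p : ℕ × Ω → Prop} :
    (∀ᶠ z in probFilter P, p z) ↔ Tendsto (fun n => P {ω | ¬ p (n, ω)}) atTop (𝓝 0) := Iff.rfl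

theorem tendsto_fst_probFilter : Tendsto Prod.fst (probFilter P) atTop := by
  rw [tendsto_atTop]
  intro N
  rw [eventually_probFilter]
  refine tendsto_const_nhds.congr' ?_
  filter_upwards [eventually_ge_atTop N] with n hn
  simp [hn]

/-- This makes limits in probability unique. -/
instance [IsProbabilityMeasure P] : (probFilter P).NeBot := by
  refine ⟨fun h => ?_⟩
  have h1 : Tendsto (fun n => P {ω | (n, ω) ∉ (∅ : Set (ℕ × Ω))}) atTop (𝓝 0) :=
    Filter.empty_mem_iff_bot.2 h
  simp only [Set.mem_empty_iff_false, not_false_eq_true, Set.ofPred_true, measure_univ] at h1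
  exact one_ne_zero (tendsto_nhds_unique tendsto_const_nhds h1)

theorem eventually_probFilter_of_ae {p : ℕ × Ω → Prop} (h : ∀ n, ∀ᵐ ω ∂P, p (n, ω)) :
    ∀ᶠ z in probFilter P, p z := by
  rw [eventually_probFilter]
  simp only [fun n => show P {ω | ¬ p (n, ω)} = 0 from h n]
  exact tendsto_const_nhds

/-- Convergence in probability tolerates an exceptional event of probability `ε / 2`, so a
stochastically bounded quantity may be assumed bounded by a constant. -/
theorem tendsto_probFilter_of_tight {X : Type*} {f : ℕ × Ω → X} {L : Filter X}
    {b : ℝ → ℕ × Ω → Prop}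
    (hb : ∀ ε : ℝ, 0 < ε → ∃ K, ∀ᶠ n in atTop, P {ω | ¬ b K (n, ω)} ≤ ENNReal.ofReal ε)
    (hf : ∀ K, Tendsto f (probFilter P ⊓ 𝓟 {z | b K z}) L) : Tendsto f (probFilter P) L := by
  intro A hA
  change Tendsto (fun n => P {ω | (n, ω) ∉ f ⁻¹' A}) atTop (𝓝 0)
  rw [ENNReal.tendsto_nhds_zero]
  intro ε hε
  obtain ⟨r, -, hr, hrε⟩ := ENNReal.lt_iff_exists_real_btwn.1 hε
  have hr0 : 0 < r := ENNReal.ofReal_pos.1 hr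
  obtain ⟨K, hK⟩ := hb (r / 2) (half_pos hr0)
  have h1 : ∀ᶠ z in probFilter P, b K z → f z ∈ A := by
    have := hf K hA
    rw [mem_map, mem_inf_principal] at this
    exact this
  have h2 := (ENNReal.tendsto_nhds_zero.1 (eventually_probFilter.1 h1)) (ENNReal.ofReal (r / 2))
    (ENNReal.ofReal_pos.2 (half_pos hr0))
  filter_upwards [hK, h2] with n hn1 hn2
  calc P {ω | (n, ω) ∉ f ⁻¹' A} ≤ P ({ω | ¬ b K (n, ω)} ∪ {ω | ¬ (b K (n, ω) → f (n, ω) ∈ A)}) :=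
        measure_mono fun ω hω => by
          by_cases hc : b K (n, ω)
          · exact Or.inr fun h => hω (h hc)
          · exact Or.inl hc
    _ ≤ _ := measure_union_le _ _
    _ ≤ ENNReal.ofReal (r / 2) + ENNReal.ofReal (r / 2) := add_le_add hn1 hn2
    _ = ENNReal.ofReal r := by
        rw [← ENNReal.ofReal_add (half_pos hr0).le (half_pos hr0).le, add_halves]
    _ ≤ ε := hrε.le

theorem tendsto_probFilter_iff {X : Type*} [PseudoMetricSpace X] {f : ℕ → Ω → X} {c : X} :
    Tendsto (fun z : ℕ × Ω => f z.1 z.2) (probFilter P) (𝓝 c) ↔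
      TendstoInMeasure P f atTop fun _ => c := by
  rw [tendstoInMeasure_iff_dist, Metric.tendsto_nhds]
  refine forall₂_congr fun ε _ => ?_
  rw [eventually_probFilter]
  simp only [not_lt]

end ProbFilter

variable {p k q m : ℕ} {M : Model p k q} {Ω : Type*} [MeasurableSpace Ω] {P : Measure Ω}
  {A : Analyst M} {E : Imputation M m Ω P} {ψlim : Param k q}
  {iFull : Matrix (Fin k ⊕ Fin q) (Fin k ⊕ Fin q) ℝ} {iMis : Matrix (Fin k) (Fin k) ℝ}
  {H : Fin A.dim → ℝ}

theorem Imputation.stack_singleton (E : Imputation M m Ω P) (n : ℕ) (ℓ : Fin m) (ω : Ω) :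
    E.stack n {ℓ} ω = List.ofFn fun i => E.Ximp n ℓ i ω := by
  simp [Imputation.stack]

theorem Imputation.sum_stack (E : Imputation M m Ω P) (n : ℕ) (S : Multiset (Fin m)) (ω : Ω)
    (g : Row p → ℝ) : ((E.stack n S ω).map g).sum =
      (S.map fun ℓ => ∑ i, g (E.Ximp n ℓ i ω)).sum := by
  conv_rhs => rw [← Multiset.sort_eq S (· ≤ ·)]
  simp only [Imputation.stack, List.map_flatten, List.sum_flatten, List.map_map, Function.comp_def,
    List.map_ofFn, List.sum_ofFn, Multiset.map_coe, Multiset.sum_coe]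

theorem Imputation.lik_stack (E : Imputation M m Ω P) (n : ℕ) (S : Multiset (Fin m)) (ω : Ω)
    (ψ : Param k q) : lik M (E.stack n S ω) ψ =
      (S.map fun ℓ => lik M (E.stack n {ℓ} ω) ψ).prod := by
  conv_rhs => rw [← Multiset.sort_eq S (· ≤ ·)]
  simp only [lik, Imputation.stack_singleton]
  simp only [Imputation.stack, List.map_flatten, List.prod_flatten, List.map_map, Function.comp_def,
    List.map_ofFn, List.prod_ofFn, Multiset.map_coe, Multiset.prod_coe]

theorem Imputation.length_stack (E : Imputation M m Ω P) (n : ℕ) (S : Multiset (Fin m)) (ω : Ω) :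
    (E.stack n S ω).length = S.card * n := by
  simp [Imputation.stack, List.length_flatten, Function.comp_def]

theorem lik_stack_singleton (E : Imputation M m Ω P) (n : ℕ) (ℓ : Fin m) (ω : Ω)
    (ψ : Param k q) : lik M (E.stack n {ℓ} ω) ψ = ∏ i, M.f ψ (E.Ximp n ℓ i ω) := by
  rw [Imputation.stack_singleton, lik, List.map_ofFn, List.prod_ofFn]; rfl

/-- Uniformity near `ψlim` is turned into convergence along a product filter, the format of the
field `hess` of `LocalLik`. -/
theorem LocalUniformLLN.tendsto {ι : Type} {h : Row p → Param k q → ι → ℝ} {H : ι → ℝ}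
    (hL : LocalUniformLLN E h ψlim H) (ℓ : Fin m) (c : ι) :
    Tendsto (fun z : (ℕ × Ω) × Param k q =>
      (z.1.1 : ℝ)⁻¹ * ∑ i, h (E.Ximp z.1.1 ℓ i z.1.2) z.2 c) (probFilter P ×ˢ 𝓝 ψlim)
      (𝓝 (H c)) := by
  rw [Metric.tendsto_nhds]
  intro ε hε
  obtain ⟨δ, hδ, ht⟩ := hL ℓ (ε / 2) (half_pos hε)
  have h1 : ∀ᶠ z in probFilter P, ∀ ψ, dist ψ ψlim < δ → ∀ c,
      |(z.1 : ℝ)⁻¹ * (∑ i, h (E.Ximp z.1 ℓ i z.2) ψ c) - H c| ≤ ε / 2 := by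
    rw [eventually_probFilter]
    refine ht.congr fun n => ?_
    congr 1
    ext ω
    simp
  filter_upwards [h1.prod_mk (Metric.ball_mem_nhds ψlim hδ)] with z hz
  rw [Real.dist_eq]
  exact (hz.1 z.2 hz.2 c).trans_lt (half_lt_self hε)

/-- Along an ultrafilter finer than `probFilter`, statements that hold with probability tending to
one hold eventually, and a bounded normalized score converges by compactness. The random likelihood
is then a deterministic `LocalLik`. -/
theorem exists_localLik_single (hR : Regular A E ψlim iFull iMis H)
    (l : Ultrafilter (ℕ × Ω)) (hl : ↑l ≤ probFilter P) (ℓ : Fin m) {K : ℝ}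
    (hK : ∀ᶠ z in (l : Filter (ℕ × Ω)),
      ‖grad (loglik M (E.stack z.1 {ℓ} z.2)) (E.psiStar z.1)‖ ≤ K * √(z.1 : ℝ)) :
    ∃ σ, LocalLik (l : Filter (ℕ × Ω)) (fun z => (z.1 : ℝ)) M.Ψ ψlim (fun z => E.psiStar z.1)
      (fun z => lik M (E.stack z.1 {ℓ} z.2)) (toBilin iFull) σ := by
  have hN : Tendsto (fun z : ℕ × Ω => (z.1 : ℝ)) l atTop :=
    tendsto_natCast_atTop_atTop.comp (tendsto_fst_probFilter.mono_left hl)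
  obtain ⟨U, hU, hmU, hsm⟩ := hR.smooth
  have hgood : ∀ᶠ z in (l : Filter (ℕ × Ω)), ∀ i : Fin z.1,
      (∀ ψ ∈ U, 0 < M.f ψ (E.Ximp z.1 ℓ i z.2)) ∧
        ContDiffOn ℝ 2 (fun ψ => M.f ψ (E.Ximp z.1 ℓ i z.2)) U :=
    hl (eventually_probFilter_of_ae fun n => ae_all_iff.2 fun i => hsm n ℓ i)
  have hlog : ∀ᶠ z in (l : Filter (ℕ × Ω)), ∀ ψ ∈ U,
      fderiv ℝ (fderiv ℝ fun ψ => Real.log (lik M (E.stack z.1 {ℓ} z.2) ψ)) ψ =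
        ∑ i, fderiv ℝ (fderiv ℝ fun ψ => Real.log (M.f ψ (E.Ximp z.1 ℓ i z.2))) ψ := by
    filter_upwards [hgood] with z hz ψ hψ
    refine (fderiv_sum_of_contDiffOn Finset.univ hU
      (f := fun i ψ => Real.log (M.f ψ (E.Ximp z.1 ℓ i z.2)))
      (fun i _ => (hz i).2.log fun x hx => ((hz i).1 x hx).ne') (fun y hy => ?_) hψ).2
    rw [lik_stack_singleton, Real.log_prod fun i _ => ((hz i).1 y hy).ne']
  -- the normalized score converges along the ultrafilter
  obtain ⟨g, hg⟩ : ∃ g, Tendsto (fun z : ℕ × Ω =>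
      (√(z.1 : ℝ))⁻¹ • grad (loglik M (E.stack z.1 {ℓ} z.2)) (E.psiStar z.1)) l (𝓝 g) := by
    have hmem : Metric.closedBall (0 : Param k q) K ∈ l.map (fun z : ℕ × Ω =>
        (√(z.1 : ℝ))⁻¹ • grad (loglik M (E.stack z.1 {ℓ} z.2)) (E.psiStar z.1)) := by
      rw [Ultrafilter.mem_map]
      filter_upwards [hK, hN.eventually_gt_atTop 0] with z hz hz0
      have h6 := Real.sqrt_pos.2 hz0
      simp only [Set.mem_preimage, mem_closedBall_zero_iff]
      rw [norm_smul, norm_inv, Real.norm_of_nonneg h6.le, inv_mul_le_iff₀ h6, mul_comm]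
      exact hz
    obtain ⟨u, -, hu⟩ := (isCompact_closedBall (0 : Param k q) _).ultrafilter_le_nhds' _ hmem
    exact ⟨u, hu⟩
  refine ⟨∑ a, g a • ContinuousLinearMap.proj (R := ℝ) (φ := fun _ : Fin k ⊕ Fin q => ℝ) a,
    fun z ψ hψ => ?_, ⟨U, hU, hmU, ?_⟩, ?_, ?_, fun ε hε => ?_⟩
  · rw [lik_stack_singleton]
    exact Finset.prod_nonneg fun i _ => M.f_nonneg ψ hψ _
  · filter_upwards [hgood] with z hz
    simp only [funext fun ψ => lik_stack_singleton E z.1 ℓ z.2 ψ]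
    exact ⟨fun ψ hψ => Finset.prod_pos fun i _ => (hz i).1 ψ hψ,
      contDiffOn_prod fun i _ => (hz i).2⟩
  · have h1 : Tendsto (fun z : (ℕ × Ω) × Param k q => ∑ a, ∑ b,
        |-((z.1.1 : ℝ)⁻¹ * ∑ i, info M [E.Ximp z.1.1 ℓ i z.1.2] z.2 a b) + iFull a b|)
        ((l : Filter (ℕ × Ω)) ×ˢ 𝓝 ψlim) (𝓝 0) := by
      rw [show (0 : ℝ) = ∑ a, ∑ b, |-(iFull a b) + iFull a b| by simp]
      refine tendsto_finsetSum _ fun a _ => tendsto_finsetSum _ fun b _ => ?_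
      exact ((((hR.info_lln.tendsto ℓ (a, b)).mono_left (prod_mono hl le_rfl)).neg).add_const
        _).abs
    refine squeeze_zero' (Eventually.of_forall fun _ =>
      norm_nonneg (E := Param k q →L[ℝ] Param k q →L[ℝ] ℝ) _) ?_ h1
    filter_upwards [hlog.prod_mk (hU.mem_nhds hmU)] with z hz
    rw [hz.1 z.2 hz.2]
    rw [eq_toBilin ((z.1.1 : ℝ)⁻¹ • ∑ i, fderiv ℝ (fderiv ℝ fun ψ =>
      Real.log (M.f ψ (E.Ximp z.1.1 ℓ i z.1.2))) z.2), ← toBilin_add]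
    refine (norm_toBilin_le _).trans (le_of_eq ?_)
    refine Finset.sum_congr rfl fun a _ => Finset.sum_congr rfl fun b _ => ?_
    congr 1
    simp only [Matrix.add_apply, Matrix.of_apply, smul_apply, sum_apply, smul_eq_mul, info,
      Matrix.neg_apply, hess_apply, Finset.sum_neg_distrib, mul_neg, neg_neg]
    have e : ∀ y, loglik M [y] = fun ψ => Real.log (M.f ψ y) := fun y => by
      ext; simp [loglik, lik]
    simp only [e]
  · have h1 : Tendsto (fun z : ℕ × Ω => ∑ a,
        ((√(z.1 : ℝ))⁻¹ • grad (loglik M (E.stack z.1 {ℓ} z.2)) (E.psiStar z.1)) a •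
          ContinuousLinearMap.proj (R := ℝ) (φ := fun _ : Fin k ⊕ Fin q => ℝ) a) l
        (𝓝 (∑ a, g a • ContinuousLinearMap.proj (R := ℝ) (φ := fun _ : Fin k ⊕ Fin q => ℝ) a)) :=
      tendsto_finsetSum _ fun a _ => ((tendsto_pi_nhds.1 hg a).smul_const _)
    refine h1.congr fun z => ?_
    ext v
    rw [smul_apply]
    conv_rhs => rw [clm_apply_eq_sum]
    simp only [sum_apply, smul_apply, ContinuousLinearMap.proj_apply, smul_eq_mul, Pi.smul_apply,
      Finset.mul_sum, grad]
    refine Finset.sum_congr rfl fun a _ => ?_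
    change _ = (√(z.1 : ℝ))⁻¹ * (v a * fderiv ℝ (loglik M _) _ _)
    ring
  · obtain ⟨η, hη, ht⟩ := hR.identifiable ℓ ε hε
    refine ⟨η, hη, hl ?_⟩
    change ∀ᶠ z in probFilter P, _
    rw [eventually_probFilter]
    refine ht.congr fun n => ?_
    congr 1
    ext ω
    simp

end StackedMI

/-! ### Contrasts, and the quadratic approximation of `THat` -/

namespace StackedMI

section Contrast

variable {m : ℕ}

/-- The normalized contrast of the averages over `Q.1` and over `Q.2`. -/
noncomputable def contrast (Q : Finset (Fin m) × Finset (Fin m)) (ℓ : Fin m) : ℝ :=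
  √((Q.1.card : ℝ) * Q.2.card) / √((Q.1.card : ℝ) + Q.2.card - 2 * (Q.1 ∩ Q.2).card) *
    ((if ℓ ∈ Q.1 then (Q.1.card : ℝ)⁻¹ else 0) - (if ℓ ∈ Q.2 then (Q.2.card : ℝ)⁻¹ else 0))

theorem card_symmDiff_pos {Q : Finset (Fin m) × Finset (Fin m)} (hQ : Q ∈ pairs m) :
    0 < (Q.1.card : ℝ) + Q.2.card - 2 * (Q.1 ∩ Q.2).card := by
  obtain ⟨-, h1, h2, h3⟩ := Finset.mem_filter.1 hQ
  have a1 := Finset.card_le_card (Finset.inter_subset_left (s₁ := Q.1) (s₂ := Q.2))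
  have a2 := Finset.card_le_card (Finset.inter_subset_right (s₁ := Q.1) (s₂ := Q.2))
  have : 2 * (Q.1 ∩ Q.2).card < Q.1.card + Q.2.card := by
    by_contra hc
    have e1 := Finset.eq_of_subset_of_card_le
      (Finset.inter_subset_left (s₁ := Q.1) (s₂ := Q.2)) (by omega)
    have e2 := Finset.eq_of_subset_of_card_le
      (Finset.inter_subset_right (s₁ := Q.1) (s₂ := Q.2)) (by omega)
    exact h3 (e1.symm.trans e2)
  have h : (2 : ℝ) * (Q.1 ∩ Q.2).card < Q.1.card + Q.2.card := by exact_mod_cast this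
  linarith

theorem card_pos_of_mem_pairs {Q : Finset (Fin m) × Finset (Fin m)} (hQ : Q ∈ pairs m) :
    (0 : ℝ) < Q.1.card ∧ (0 : ℝ) < Q.2.card := by
  obtain ⟨-, h1, h2, -⟩ := Finset.mem_filter.1 hQ
  exact ⟨by exact_mod_cast h1.card_pos, by exact_mod_cast h2.card_pos⟩

theorem sum_ite_mul_ite (S T : Finset (Fin m)) (a b : ℝ) :
    ∑ ℓ, (if ℓ ∈ S then a else 0) * (if ℓ ∈ T then b else 0) = (S ∩ T).card * (a * b) := by
  have : ∀ ℓ, (if ℓ ∈ S then a else 0) * (if ℓ ∈ T then b else 0) =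
      if ℓ ∈ S ∩ T then a * b else 0 := fun ℓ => by
    by_cases h1 : ℓ ∈ S <;> by_cases h2 : ℓ ∈ T <;> simp [h1, h2]
  simp only [this, Finset.sum_ite_mem, Finset.univ_inter, Finset.sum_const, nsmul_eq_mul]

/-- `rho` is the Gram matrix of the contrast vectors, hence the correlation between two contrasts of
independent standardized noises. -/
theorem sum_contrast_mul (Q Q' : Finset (Fin m) × Finset (Fin m)) :
    ∑ ℓ, contrast Q ℓ * contrast Q' ℓ = rho Q Q' := by
  have e : ∀ a b : ℝ, ∀ ℓ, contrast Q ℓ * contrast Q' ℓ =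
      √((Q.1.card : ℝ) * Q.2.card) / √((Q.1.card : ℝ) + Q.2.card - 2 * (Q.1 ∩ Q.2).card) *
      (√((Q'.1.card : ℝ) * Q'.2.card) /
        √((Q'.1.card : ℝ) + Q'.2.card - 2 * (Q'.1 ∩ Q'.2).card)) *
      ((if ℓ ∈ Q.1 then (Q.1.card : ℝ)⁻¹ else 0) * (if ℓ ∈ Q'.1 then (Q'.1.card : ℝ)⁻¹ else 0)
      - (if ℓ ∈ Q.1 then (Q.1.card : ℝ)⁻¹ else 0) * (if ℓ ∈ Q'.2 then (Q'.2.card : ℝ)⁻¹ else 0)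
      - (if ℓ ∈ Q.2 then (Q.2.card : ℝ)⁻¹ else 0) * (if ℓ ∈ Q'.1 then (Q'.1.card : ℝ)⁻¹ else 0)
      + (if ℓ ∈ Q.2 then (Q.2.card : ℝ)⁻¹ else 0) *
        (if ℓ ∈ Q'.2 then (Q'.2.card : ℝ)⁻¹ else 0)) := fun a b ℓ => by
    unfold contrast; ring
  rw [Finset.sum_congr rfl fun ℓ _ => e 0 0 ℓ, ← Finset.mul_sum, Finset.sum_add_distrib,
    Finset.sum_sub_distrib, Finset.sum_sub_distrib]
  simp only [sum_ite_mul_ite, rho]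
  rw [show (Q.1.card : ℝ) * Q.2.card * Q'.1.card * Q'.2.card =
    (Q.1.card * Q.2.card) * (Q'.1.card * Q'.2.card) by ring,
    Real.sqrt_mul (x := (Q.1.card : ℝ) * Q.2.card) (by positivity), div_mul_div_comm]
  simp only [div_eq_mul_inv, mul_inv]

/-- Because of this a contrast of estimates does not change when a common centre is subtracted. -/
theorem sum_contrast {Q : Finset (Fin m) × Finset (Fin m)} (hQ : Q ∈ pairs m) :
    ∑ ℓ, contrast Q ℓ = 0 := by
  obtain ⟨h1, h2⟩ := card_pos_of_mem_pairs hQ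
  simp only [contrast, ← Finset.mul_sum, Finset.sum_sub_distrib, Finset.sum_ite_mem,
    Finset.univ_inter, Finset.sum_const, nsmul_eq_mul]
  rw [mul_inv_cancel₀ h1.ne', mul_inv_cancel₀ h2.ne', sub_self, mul_zero]

theorem rho_self {Q : Finset (Fin m) × Finset (Fin m)} (hQ : Q ∈ pairs m) : rho Q Q = 1 := by
  obtain ⟨h1, h2⟩ := card_pos_of_mem_pairs hQ
  have h3 := card_symmDiff_pos hQ
  unfold rho
  rw [Real.mul_self_sqrt h3.le, show (Q.1.card : ℝ) * Q.2.card * Q.1.card * Q.2.card =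
    (Q.1.card * Q.2.card) * (Q.1.card * Q.2.card) by ring, Real.sqrt_mul_self (by positivity),
    Finset.inter_self, Finset.inter_self, Finset.inter_comm Q.2 Q.1]
  field_simp
  ring

/-- Cauchy–Schwarz for the contrast vectors, which have length one by `rho_self`. -/
theorem abs_rho_le_one {Q Q' : Finset (Fin m) × Finset (Fin m)} (hQ : Q ∈ pairs m)
    (hQ' : Q' ∈ pairs m) : |rho Q Q'| ≤ 1 := by
  have h := Finset.sum_mul_sq_le_sq_mul_sq Finset.univ (contrast Q) (contrast Q')
  have e : ∀ R : Finset (Fin m) × Finset (Fin m), R ∈ pairs m →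
      ∑ ℓ, contrast R ℓ ^ 2 = 1 := fun R hR => by
    rw [← rho_self hR, ← sum_contrast_mul]; exact Finset.sum_congr rfl fun _ _ => pow_two _
  rw [sum_contrast_mul, e Q hQ, e Q' hQ', mul_one] at h
  exact (sq_le_one_iff_abs_le_one _).1 h

end Contrast

section QuadAlgebra

variable {ι : Type*} [Fintype ι] {W : Matrix ι ι ℝ}

/-- The within-between decomposition of a weighted sum of squares. The common shift `d` cancels,
which is why local alternatives have the same limit as the null hypothesis. -/
theorem quad_combination (hW : Wᵀ = W) {a b : ℝ} (hab : a + b ≠ 0) (x y d : ι → ℝ) :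
    a * quad W (x + d) + b * quad W (y + d)
      - (a + b) * quad W ((a + b)⁻¹ • (a • x + b • y) + d) =
      a * b / (a + b) * quad W (x - y) := by
  have hs : ∀ u v : ι → ℝ, v ⬝ᵥ W *ᵥ u = u ⬝ᵥ W *ᵥ v := fun u v => by
    rw [Matrix.dotProduct_mulVec, dotProduct_comm, ← Matrix.mulVec_transpose, hW]
  simp only [quad, Matrix.mulVec_add, Matrix.mulVec_sub, Matrix.mulVec_smul, add_dotProduct,
    dotProduct_add, sub_dotProduct, dotProduct_sub, smul_dotProduct, dotProduct_smul, smul_eq_mul]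
  rw [hs x y, hs x d, hs y d]
  field_simp
  ring

end QuadAlgebra

variable {p k q m : ℕ} {M : Model p k q} {Ω : Type*} [MeasurableSpace Ω] {P : Measure Ω}
  {A : Analyst M} {E : Imputation M m Ω P} {ψlim : Param k q}
  {iFull : Matrix (Fin k ⊕ Fin q) (Fin k ⊕ Fin q) ℝ} {iMis : Matrix (Fin k) (Fin k) ℝ}
  {H : Fin A.dim → ℝ}

theorem tendsto_average_stack (hR : Regular A E ψlim iFull iMis H)
    {l : Filter (ℕ × Ω)} (hl : l ≤ probFilter P) {S : Multiset (Fin m)} (hS : S ≠ 0)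
    {ψ : ℕ × Ω → Param k q} (hψ : Tendsto ψ l (𝓝 ψlim)) :
    Tendsto (fun z => fun c => ((E.stack z.1 S z.2).length : ℝ)⁻¹ *
      ((E.stack z.1 S z.2).map fun row => A.h row (ψ z) c).sum) l (𝓝 H) := by
  rw [tendsto_pi_nhds]
  intro c
  have hc : (S.card : ℝ) ≠ 0 := by
    simpa using hS
  have hp : Tendsto (fun z => (z, ψ z)) l (probFilter P ×ˢ 𝓝 ψlim) :=
    (tendsto_id.mono_right hl).prodMk hψ
  have h1 : ∀ T : Multiset (Fin m), Tendsto (fun z : ℕ × Ω => (z.1 : ℝ)⁻¹ *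
      (T.map fun ℓ => ∑ i, A.h (E.Ximp z.1 ℓ i z.2) (ψ z) c).sum) l (𝓝 (T.card * H c)) := by
    intro T
    induction T using Multiset.induction_on with
    | empty => simpa using tendsto_const_nhds
    | cons ℓ T ih =>
      have := ((hR.var_lln.tendsto ℓ c).comp hp).add ih
      simp only [Multiset.map_cons, Multiset.sum_cons, mul_add, Multiset.card_cons]
      rw [Nat.cast_succ, add_mul, one_mul, add_comm _ (H c)]
      exact this
  have h2 := (h1 S).const_mul (S.card : ℝ)⁻¹
  rw [inv_mul_cancel_left₀ hc] at h2
  refine h2.congr fun z => ?_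
  rw [Imputation.sum_stack, Imputation.length_stack]
  push_cast
  rw [mul_inv, mul_assoc]

/-- The limiting normal equation has information `|S| i` and, on the right, the sum of the single
scores. By linearity and injectivity its solution is the average of the single solutions, whatever
the dependence between imputations. -/
theorem tendsto_dHat (hR : Regular A E ψlim iFull iMis H) (t : Test) {δ : Fin k → ℝ}
    (hδ : Tendsto (fun n : ℕ => √(n : ℝ) • (thetaPart (E.psiStar n) - E.theta₀ n)) atTop (𝓝 δ))
    (l : Ultrafilter (ℕ × Ω)) (hl : ↑l ≤ probFilter P) {K : ℝ}
    (hK : ∀ᶠ z in (l : Filter (ℕ × Ω)), ∀ ℓ : Fin m,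
      ‖grad (loglik M (E.stack z.1 {ℓ} z.2)) (E.psiStar z.1)‖ ≤ K * √(z.1 : ℝ)) :
    ∃ h : Fin m → Fin k → ℝ,
      (∀ ℓ, Tendsto (fun z : ℕ × Ω => √(z.1 : ℝ) •
        (E.thetaImp A z.1 ℓ z.2 - thetaPart (E.psiStar z.1))) l (𝓝 (h ℓ))) ∧
      ∀ S : Multiset (Fin m), S ≠ 0 → Tendsto (fun z : ℕ × Ω => E.dHat A t z.1 S z.2) l
        (𝓝 (quad ((iFull⁻¹).toBlocks₁₁)⁻¹ ((S.card : ℝ)⁻¹ • (S.map h).sum + δ))) := by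
  have hfst : Tendsto Prod.fst (l : Filter (ℕ × Ω)) atTop := tendsto_fst_probFilter.mono_left hl
  have hN : Tendsto (fun z : ℕ × Ω => (z.1 : ℝ)) l atTop := tendsto_natCast_atTop_atTop.comp hfst
  have hψs : Tendsto (fun z : ℕ × Ω => E.psiStar z.1) l (𝓝 ψlim) := hR.tendsto_psiStar.comp hfst
  have hδ' := hδ.comp hfst
  have hi := hR.posDef_full
  have hΨ := hR.mem_interior
  choose σ hσ using fun ℓ => exists_localLik_single hR l hl ℓ (hK.mono fun (z : ℕ × Ω) hz => hz ℓ)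
  have hLS : ∀ S : Multiset (Fin m), S ≠ 0 → LocalLik (l : Filter (ℕ × Ω)) (fun z => (z.1 : ℝ))
      M.Ψ ψlim (fun z => E.psiStar z.1) (fun z => lik M (E.stack z.1 S z.2))
      ((S.card : ℝ) • toBilin iFull) (S.map σ).sum := fun S hS => by
    have := LocalLik.multiset_prod hψs (interior_subset hΨ) hσ S hS
    refine cast ?_ this
    congr 1
    ext z ψ
    rw [E.lik_stack z.1 S z.2 ψ]
  have hpos : ∀ S : Multiset (Fin m), S ≠ 0 → (0 : ℝ) < S.card := fun S hS => by
    exact_mod_cast Multiset.card_pos.2 hS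
  have hmle := fun (S : Multiset (Fin m)) (hS : S ≠ 0) =>
    exists_tendsto_mle A (hpos S hS) hi hΨ hN hψs (hLS S hS)
  have hs1 : ∀ ℓ : Fin m, ({ℓ} : Multiset (Fin m)) ≠ 0 := fun ℓ => Multiset.singleton_ne_zero ℓ
  choose u hu hΛu using fun ℓ : Fin m => (hmle {ℓ} (hs1 ℓ)).2
  have hΛu' : ∀ ℓ, toBilin iFull (u ℓ) = σ ℓ := fun ℓ => by
    have := hΛu ℓ
    ext v
    rw [Multiset.map_singleton, Multiset.sum_singleton] at this
    rw [← this, smul_apply]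
    simp
  refine ⟨fun ℓ => thetaPart (u ℓ), fun ℓ => (continuous_thetaPart.tendsto _).comp (hu ℓ),
    fun S hS => ?_⟩
  obtain ⟨hlim, v, hv, hΛv⟩ := hmle S hS
  have hsum : ∀ T : Multiset (Fin m), toBilin iFull (T.map u).sum = (T.map σ).sum := fun T => by
    induction T using Multiset.induction_on with
    | empty => simp
    | cons ℓ T ih => simp [ih, hΛu']
  have hveq : v = (S.card : ℝ)⁻¹ • (S.map u).sum := by
    have h0 : toBilin iFull ((S.card : ℝ) • v - (S.map u).sum) = 0 := by
      ext w
      rw [map_sub, hsum, ← hΛv, map_smul]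
      simp
    have h1 : (S.card : ℝ) • v - (S.map u).sum = 0 := by
      by_contra hne
      have h2 := quad_pos hi hne
      rw [quad, ← toBilin_apply, h0] at h2
      simp at h2
    rw [← sub_eq_zero.1 h1, smul_smul, inv_mul_cancel₀ (hpos S hS).ne', one_smul]
  have hθ : ∀ T : Multiset (Fin m), thetaPart (T.map u).sum =
      (T.map fun ℓ => thetaPart (u ℓ)).sum := fun T => by
    induction T using Multiset.induction_on with
    | empty => simp; rfl
    | cons ℓ T ih => simp [thetaPart_add, ih]
  have hvlim := hR.var_cont.tendsto.comp
    (hlim.prodMk_nhds (tendsto_average_stack hR hl hS hlim))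
  have := tendsto_device A t (hpos S hS) hi hΨ hN hψs (hLS S hS) hδ' hlim hv hΛv
    (fun z => by rw [Imputation.length_stack]; push_cast; rfl) (by rw [← hR.var_eq]; exact hvlim)
  rw [hveq, thetaPart_smul, hθ] at this
  exact this

theorem transpose_profile (hi : iFull.PosDef) :
    (((iFull⁻¹).toBlocks₁₁)⁻¹)ᵀ = ((iFull⁻¹).toBlocks₁₁)⁻¹ := by
  have : ((iFull⁻¹).toBlocks₁₁).PosDef := hi.inv.submatrix Sum.inl_injective
  simpa using this.inv.isHermitian.eq

theorem tendsto_THat_of_dHat (hi : iFull.PosDef) {t : Test} {δ : Fin k → ℝ}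
    {l : Filter (ℕ × Ω)} {h : Fin m → Fin k → ℝ}
    (hd : ∀ S : Multiset (Fin m), S ≠ 0 → Tendsto (fun z : ℕ × Ω => E.dHat A t z.1 S z.2) l
        (𝓝 (quad ((iFull⁻¹).toBlocks₁₁)⁻¹ ((S.card : ℝ)⁻¹ • (S.map h).sum + δ))))
    {Q : Finset (Fin m) × Finset (Fin m)} (hQ : Q ∈ pairs m) :
    Tendsto (fun z => E.THat A t z.1 Q z.2) l
      (𝓝 (quad ((iFull⁻¹).toBlocks₁₁)⁻¹ (∑ ℓ, contrast Q ℓ • h ℓ))) := by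
  obtain ⟨h1, h2⟩ := card_pos_of_mem_pairs hQ
  have h3 := card_symmDiff_pos hQ
  have n1 : Q.1.val ≠ 0 := fun h0 => by simp [Finset.card, h0] at h1
  have n2 : Q.2.val ≠ 0 := fun h0 => by simp [Finset.card, h0] at h2
  have n3 : Q.1.val + Q.2.val ≠ 0 := fun h0 => n1 (by simpa using (add_eq_zero.1 h0).1)
  have key := ((((hd _ n1).const_mul (Q.1.card : ℝ)).add
    ((hd _ n2).const_mul (Q.2.card : ℝ))).sub
    ((hd _ n3).const_mul ((Q.1.card : ℝ) + Q.2.card))).const_mul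
    (((Q.1.card : ℝ) + Q.2.card) / ((Q.1.card : ℝ) + Q.2.card - 2 * (Q.1 ∩ Q.2).card))
  refine cast ?_ key
  congr 2
  set W := ((iFull⁻¹).toBlocks₁₁)⁻¹
  set x : Fin k → ℝ := (Q.1.card : ℝ)⁻¹ • ∑ ℓ ∈ Q.1, h ℓ with hx
  set y : Fin k → ℝ := (Q.2.card : ℝ)⁻¹ • ∑ ℓ ∈ Q.2, h ℓ with hy
  have e3 : (((Q.1.val + Q.2.val).card : ℕ) : ℝ)⁻¹ • ((Q.1.val + Q.2.val).map h).sum =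
      ((Q.1.card : ℝ) + Q.2.card)⁻¹ • ((Q.1.card : ℝ) • x + (Q.2.card : ℝ) • y) := by
    rw [hx, hy, smul_smul, smul_smul, mul_inv_cancel₀ h1.ne', mul_inv_cancel₀ h2.ne', one_smul,
      one_smul, Multiset.map_add, Multiset.sum_add, Multiset.card_add]
    push_cast
    rfl
  have e4 : ∑ ℓ, contrast Q ℓ • h ℓ = (√((Q.1.card : ℝ) * Q.2.card) /
      √((Q.1.card : ℝ) + Q.2.card - 2 * (Q.1 ∩ Q.2).card)) • (x - y) := by
    simp only [contrast, mul_smul, ← Finset.smul_sum, sub_smul, Finset.sum_sub_distrib, ite_smul,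
      zero_smul, Finset.sum_ite_mem, Finset.univ_inter, hx, hy]
  -- The factor `a * b / (a + b)` times the prefactor of `THat` is the square of the normalization
  -- in `contrast`.
  have e5 := quad_combination (W := W) (transpose_profile hi) (add_pos h1 h2).ne' x y δ
  rw [e4, quad_smul, div_pow, Real.sq_sqrt (by positivity), Real.sq_sqrt h3.le, e3]
  change _ * (_ * quad W (x + δ) + _ * quad W (y + δ) - _) = _
  rw [e5]
  have := add_pos h1 h2
  field_simp

/-- To prove convergence in probability it suffices to consider ultrafilters along which the
normalized scores of all completed datasets are bounded. -/
theorem tendsto_probFilter_of_score (hR : Regular A E ψlim iFull iMis H) {X : Type*}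
    {f : ℕ × Ω → X} {L : Filter X}
    (hf : ∀ l : Ultrafilter (ℕ × Ω), ↑l ≤ probFilter P → ∀ K : ℝ,
      (∀ᶠ z in (l : Filter (ℕ × Ω)), ∀ ℓ : Fin m,
        ‖grad (loglik M (E.stack z.1 {ℓ} z.2)) (E.psiStar z.1)‖ ≤ K * √(z.1 : ℝ)) →
      Tendsto f l L) : Tendsto f (probFilter P) L := by
  refine tendsto_probFilter_of_tight (b := fun K z => ∀ ℓ : Fin m,
    ‖grad (loglik M (E.stack z.1 {ℓ} z.2)) (E.psiStar z.1)‖ ≤ K * √(z.1 : ℝ)) ?_ fun K => ?_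
  · intro ε hε
    -- The denominator `m + 1` leaves room for a union bound over `m` datasets and is never zero.
    choose K hK using fun ℓ => hR.score_tight ℓ (ε / (m + 1)) (by positivity)
    obtain ⟨K₀, hK₀⟩ := (Set.finite_range K).bddAbove
    refine ⟨K₀, ?_⟩
    filter_upwards [eventually_all.2 hK] with n hn
    calc P {ω | ¬ ∀ ℓ : Fin m,
          ‖grad (loglik M (E.stack n {ℓ} ω)) (E.psiStar n)‖ ≤ K₀ * √(n : ℝ)}
        ≤ P (⋃ ℓ : Fin m, {ω | K ℓ * √(n : ℝ) <
            ‖grad (loglik M (E.stack n {ℓ} ω)) (E.psiStar n)‖}) := by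
          refine measure_mono fun ω hω => ?_
          obtain ⟨ℓ, hℓ⟩ := not_forall.1 hω
          refine Set.mem_iUnion.2 ⟨ℓ, lt_of_le_of_lt ?_ (not_le.1 hℓ)⟩
          exact mul_le_mul_of_nonneg_right (hK₀ ⟨ℓ, rfl⟩) (Real.sqrt_nonneg _)
      _ ≤ ∑ ℓ : Fin m, P {ω | K ℓ * √(n : ℝ) <
            ‖grad (loglik M (E.stack n {ℓ} ω)) (E.psiStar n)‖} := measure_iUnion_fintype_le _ _
      _ ≤ ∑ ℓ : Fin m, ENNReal.ofReal (ε / (m + 1)) := Finset.sum_le_sum fun ℓ _ => hn ℓ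
      _ ≤ ENNReal.ofReal ε := by
          rw [← ENNReal.ofReal_sum_of_nonneg fun _ _ => by positivity]
          refine ENNReal.ofReal_le_ofReal ?_
          simp only [Finset.sum_const, Finset.card_univ, Fintype.card_fin, nsmul_eq_mul]
          rw [mul_div_assoc', div_le_iff₀ (by positivity)]
          nlinarith
  · rw [tendsto_iff_ultrafilter]
    intro l hl
    exact hf l (hl.trans inf_le_left) K ((hl.trans inf_le_right) (mem_principal_self _))

/-- Along every admissible ultrafilter both terms have the same limit, so their difference vanishes
in probability although neither term need converge in probability. By `sum_contrast` the centre may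
be changed from the true value to the observed-data MLE. -/
theorem tendsto_THat_sub (hR : Regular A E ψlim iFull iMis H) (hLA : LocalAlternative E) (t : Test)
    {Q : Finset (Fin m) × Finset (Fin m)} (hQ : Q ∈ pairs m) :
    Tendsto (fun z : ℕ × Ω => E.THat A t z.1 Q z.2 - quad ((iFull⁻¹).toBlocks₁₁)⁻¹
      (√(z.1 : ℝ) • ∑ ℓ, contrast Q ℓ • (E.thetaImp A z.1 ℓ z.2 - E.thetaObs z.1 z.2)))
      (probFilter P) (𝓝 0) := by
  obtain ⟨C, δ₀, hC, hδ₀⟩ := hLA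
  have hδ : Tendsto (fun n : ℕ => √(n : ℝ) • (thetaPart (E.psiStar n) - E.theta₀ n)) atTop
      (𝓝 (C⁻¹ *ᵥ δ₀)) := by
    have hc : Continuous fun v : Fin k → ℝ => C⁻¹ *ᵥ v := by fun_prop
    refine ((hc.tendsto δ₀).comp hδ₀).congr fun n => ?_
    simp only [Function.comp, Matrix.mulVec_smul]
    rw [Matrix.mulVec_mulVec, Matrix.nonsing_inv_mul _ ((Matrix.isUnit_iff_isUnit_det _).1 hC),
      Matrix.one_mulVec]
  refine tendsto_probFilter_of_score hR fun l hl1 K hl2 => ?_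
  obtain ⟨h, hh, hd⟩ := tendsto_dHat hR t hδ l hl1 hl2
  have h1 := tendsto_THat_of_dHat hR.posDef_full hd hQ
  have h2 : Tendsto (fun z : ℕ × Ω => √(z.1 : ℝ) •
      ∑ ℓ, contrast Q ℓ • (E.thetaImp A z.1 ℓ z.2 - E.thetaObs z.1 z.2)) l
      (𝓝 (∑ ℓ, contrast Q ℓ • h ℓ)) := by
    have := tendsto_finsetSum Finset.univ fun ℓ _ => (hh ℓ).const_smul (contrast Q ℓ)
    refine this.congr fun z => ?_
    have e : ∀ c : Fin k → ℝ, ∑ ℓ, contrast Q ℓ • (E.thetaImp A z.1 ℓ z.2 - c) =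
        ∑ ℓ, contrast Q ℓ • E.thetaImp A z.1 ℓ z.2 := fun c => by
      simp only [smul_sub, Finset.sum_sub_distrib, ← Finset.sum_smul, sum_contrast hQ, zero_smul,
        sub_zero]
    simp only [smul_comm (contrast Q _) (√(z.1 : ℝ)), ← Finset.smul_sum]
    rw [e, e]
  have h3 := h1.sub (tendsto_quad (W := fun _ => ((iFull⁻¹).toBlocks₁₁)⁻¹) tendsto_const_nhds h2)
  rwa [sub_self] at h3

end StackedMI

/-! ### Eigenvalues of the missing information, and the limiting matrices -/

namespace StackedMI

/-- Every subsequence has a further subsequence that converges almost surely, to which dominated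
convergence applies. -/
theorem tendsto_integral_of_tendstoInMeasure_of_bound {Ω F : Type*} [MeasurableSpace Ω]
    {P : Measure Ω} [IsProbabilityMeasure P] [NormedAddCommGroup F] [NormedSpace ℝ F]
    {f : ℕ → Ω → F} {c : F} {K : ℝ} (hm : ∀ n, AEStronglyMeasurable (f n) P)
    (hb : ∀ n, ∀ᵐ ω ∂P, ‖f n ω‖ ≤ K) (h : TendstoInMeasure P f atTop fun _ => c) :
    Tendsto (fun n => ∫ ω, f n ω ∂P) atTop (𝓝 (∫ _, c ∂P)) := by
  refine tendsto_of_subseq_tendsto fun ns hns => ?_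
  obtain ⟨ms, -, hms⟩ := (h.comp hns).exists_seq_tendsto_ae
  exact ⟨ms, tendsto_integral_of_dominated_convergence (fun _ => K) (fun n => hm _)
    (integrable_const K) (fun n => hb _) hms⟩

section Algebra

open Polynomial

variable {k : ℕ}

theorem exists_perm_of_map_univ_eq {f g : Fin k → ℝ}
    (h : Multiset.map f Finset.univ.val = Multiset.map g Finset.univ.val) :
    ∃ σ : Equiv.Perm (Fin k), f = g ∘ σ := by
  rw [Fin.univ_val_map, Fin.univ_val_map, Multiset.coe_eq_coe] at h
  have h1 : (List.ofFn (f ∘ Tuple.sort f)).Perm (List.ofFn (g ∘ Tuple.sort g)) :=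
    ((Tuple.sort f).ofFn_comp_perm f).trans (h.trans ((Tuple.sort g).ofFn_comp_perm g).symm)
  have h2 := List.ofFn_injective (h1.eq_of_pairwise'
    (List.sortedLE_ofFn_iff.2 (Tuple.monotone_sort f)).pairwise
    (List.sortedLE_ofFn_iff.2 (Tuple.monotone_sort g)).pairwise)
  refine ⟨(Tuple.sort f).symm.trans (Tuple.sort g), funext fun j => ?_⟩
  have := congrFun h2 ((Tuple.sort f).symm j)
  simpa using this

/-- For `x ≠ -1`, `x - ((1 - F)⁻¹ - 1) = (x + 1) (x / (x + 1) - F) (1 - F)⁻¹`, so both polynomials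
agree at infinitely many points. The matrix `F` need not be symmetric, and no diagonalization is
used. -/
theorem charpoly_inv_one_sub_sub_one {F : Matrix (Fin k) (Fin k) ℝ} {f : Fin k → ℝ}
    (hF : F.charpoly = ∏ j, (X - C (f j))) (h : IsUnit (1 - F)) :
    ((1 - F)⁻¹ - 1).charpoly = ∏ j, (X - C (f j / (1 - f j))) := by
  have hdet : IsUnit (1 - F).det := (Matrix.isUnit_iff_isUnit_det _).1 h
  have hev : ∀ x : ℝ, (Matrix.scalar (Fin k) x - F).det = ∏ j, (x - f j) := fun x => by
    rw [← Matrix.eval_charpoly, hF, eval_prod]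
    simp
  have h1 : (1 - F).det = ∏ j, (1 - f j) := by
    rw [← hev 1, map_one]
  have hne : ∀ j, 1 - f j ≠ 0 := fun j hj => by
    rw [h1, Finset.prod_eq_zero (Finset.mem_univ j) hj] at hdet
    exact not_isUnit_zero hdet
  refine eq_of_infinite_eval_eq _ _ (((Set.finite_singleton (-1 : ℝ)).infinite_compl).mono ?_)
  intro x hx
  have hx1 : x + 1 ≠ 0 := fun h0 => hx (eq_neg_of_add_eq_zero_left h0)
  change eval x _ = eval x _
  rw [Matrix.eval_charpoly, eval_prod]
  have e1 : Matrix.scalar (Fin k) x - ((1 - F)⁻¹ - 1) =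
      ((x + 1) • (Matrix.scalar (Fin k) (x / (x + 1)) - F)) * (1 - F)⁻¹ := by
    have e2 : (x + 1) • (Matrix.scalar (Fin k) (x / (x + 1)) - F) =
        (x + 1) • (1 - F) - 1 := by
      have e3 : Matrix.scalar (Fin k) (x / (x + 1)) = (x / (x + 1)) • (1 : Matrix _ _ ℝ) := by
        rw [Matrix.scalar_apply, Matrix.smul_one_eq_diagonal]
      rw [e3, smul_sub, smul_smul, mul_div_cancel₀ _ hx1, smul_sub, add_smul x 1 (1 : Matrix _ _ ℝ),
        one_smul]
      abel
    rw [e2, sub_mul, Matrix.smul_mul, Matrix.mul_nonsing_inv _ hdet, one_mul, Matrix.scalar_apply,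
      ← Matrix.smul_one_eq_diagonal, add_smul, one_smul]
    abel
  rw [e1, Matrix.det_mul, Matrix.det_smul, hev, Matrix.det_nonsing_inv, h1, Ring.inverse_eq_inv',
    ← Finset.prod_inv_distrib, Fintype.card_fin, mul_assoc, ← Finset.prod_mul_distrib]
  rw [show (x + 1) ^ k = ∏ _j : Fin k, (x + 1) by simp, ← Finset.prod_mul_distrib]
  refine Finset.prod_congr rfl fun j _ => ?_
  have := hne j
  simp only [eval_sub, eval_X, eval_C]
  field_simp
  ring

/-- The eigenvalues supplied by the spectral theorem agree with `r` only as a multiset, so the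
columns of the eigenvector matrix are permuted to match the given order. -/
theorem exists_orthogonal_quad_eq {S : Matrix (Fin k) (Fin k) ℝ} (hS : S.IsHermitian)
    {r : Fin k → ℝ} (hr : S.charpoly = ∏ j, (X - C (r j))) :
    ∃ O : Matrix (Fin k) (Fin k) ℝ, O * Oᵀ = 1 ∧ Oᵀ * O = 1 ∧
      ∀ y, quad S y = ∑ j, r j * (Oᵀ *ᵥ y) j ^ 2 := by
  have h1 : Multiset.map hS.eigenvalues Finset.univ.val = Multiset.map r Finset.univ.val := by
    have := hS.roots_charpoly_eq_eigenvalues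
    rw [hr, roots_prod _ _ (Finset.prod_ne_zero_iff.2 fun j _ => X_sub_C_ne_zero _)] at this
    simpa using this.symm
  obtain ⟨σ, hσ⟩ := exists_perm_of_map_univ_eq h1
  set U : Matrix (Fin k) (Fin k) ℝ := hS.eigenvectorUnitary.1 with hU
  have hU1 : U * Uᵀ = 1 := by
    have := Unitary.coe_mul_star_self hS.eigenvectorUnitary
    rwa [Unitary.coe_star, Matrix.star_eq_conjTranspose,
      Matrix.conjTranspose_eq_transpose_of_trivial] at this
  have hU2 : Uᵀ * U = 1 := mul_eq_one_comm.1 hU1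
  have hspec : S = U * Matrix.diagonal hS.eigenvalues * Uᵀ := by
    conv_lhs => rw [hS.spectral_theorem, Unitary.conjStarAlgAut_apply]
    rw [← Matrix.conjTranspose_eq_transpose_of_trivial, ← Matrix.star_eq_conjTranspose]
    rfl
  refine ⟨U.submatrix id σ.symm, ?_, ?_, fun y => ?_⟩
  · rw [Matrix.transpose_submatrix, Matrix.submatrix_mul_equiv, hU1, Matrix.submatrix_id_id]
  · rw [Matrix.transpose_submatrix]
    have := Matrix.submatrix_mul_equiv Uᵀ U σ.symm (Equiv.refl (Fin k)) σ.symm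
    rw [show (⇑(Equiv.refl (Fin k))) = id from rfl] at this
    rw [this, hU2, Matrix.submatrix_one_equiv]
  · conv_lhs => rw [hspec]
    rw [quad, ← Matrix.mulVec_mulVec, ← Matrix.mulVec_mulVec, Matrix.dotProduct_mulVec,
      ← Matrix.mulVec_transpose, dotProduct]
    conv_rhs => rw [← Equiv.sum_comp σ]
    refine Finset.sum_congr rfl fun j _ => ?_
    have h2 : ((U.submatrix id σ.symm)ᵀ *ᵥ y) (σ j) = (Uᵀ *ᵥ y) j := by
      simp [Matrix.mulVec, dotProduct]
    rw [Matrix.mulVec_diagonal, h2, hσ]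
    simp only [Function.comp]
    ring

end Algebra

variable {p k q m : ℕ} {M : Model p k q} {Ω : Type*} [MeasurableSpace Ω] {P : Measure Ω}
  {A : Analyst M} {E : Imputation M m Ω P} {ψlim : Param k q}
  {iFull : Matrix (Fin k ⊕ Fin q) (Fin k ⊕ Fin q) ℝ} {iMis : Matrix (Fin k) (Fin k) ℝ}
  {H : Fin A.dim → ℝ}

theorem tendsto_VImp (hR : Regular A E ψlim iFull iMis H) (ℓ : Fin m) :
    Tendsto (fun z : ℕ × Ω => (z.1 : ℝ) • E.VImp A z.1 ℓ z.2) (probFilter P)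
      (𝓝 (iFull⁻¹).toBlocks₁₁) := by
  refine tendsto_probFilter_of_score hR fun l hl K hK => ?_
  have hfst : Tendsto Prod.fst (l : Filter (ℕ × Ω)) atTop := tendsto_fst_probFilter.mono_left hl
  have hN : Tendsto (fun z : ℕ × Ω => (z.1 : ℝ)) l atTop := tendsto_natCast_atTop_atTop.comp hfst
  obtain ⟨σ, hσ⟩ := exists_localLik_single hR l hl ℓ (hK.mono fun (z : ℕ × Ω) hz => hz ℓ)
  rw [← one_smul ℝ (toBilin iFull)] at hσ
  have hlim := (exists_tendsto_mle A one_pos hR.posDef_full hR.mem_interior hN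
    (hR.tendsto_psiStar.comp hfst) hσ).1
  have := hR.var_cont.tendsto.comp (hlim.prodMk_nhds
    (tendsto_average_stack hR hl (Multiset.singleton_ne_zero ℓ) hlim))
  rw [hR.var_eq] at this
  refine Tendsto.congr' ?_ this
  filter_upwards [hN.eventually_gt_atTop 0] with z hz
  rw [Imputation.VImp, Analyst.VHat, smul_smul, Imputation.length_stack, Multiset.card_singleton,
    one_mul, mul_inv_cancel₀ hz.ne', one_smul]
  simp only [Function.comp, Imputation.length_stack, Multiset.card_singleton, one_mul]

theorem tendsto_Icom (hR : Regular A E ψlim iFull iMis H) :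
    Tendsto (fun n : ℕ => (n : ℝ)⁻¹ • E.Icom n) atTop (𝓝 iFull.toBlocks₁₁) := by
  have hc : Continuous fun B : Matrix (Fin k ⊕ Fin q) (Fin k ⊕ Fin q) ℝ => B.toBlocks₁₁ := by
    unfold Matrix.toBlocks₁₁
    fun_prop
  exact (hc.tendsto _).comp hR.tendsto_full

theorem tendsto_Iobs (hR : Regular A E ψlim iFull iMis H) :
    Tendsto (fun n : ℕ => (n : ℝ)⁻¹ • E.Iobs n) atTop (𝓝 (iFull.toBlocks₁₁ - iMis)) := by
  refine ((tendsto_Icom hR).sub hR.tendsto_mis).congr fun n => ?_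
  rw [Imputation.Iobs, smul_sub]

theorem posDef_toBlocks₁₁ (hR : Regular A E ψlim iFull iMis H) : iFull.toBlocks₁₁.PosDef :=
  hR.posDef_full.submatrix Sum.inl_injective

theorem tendsto_smul_inv {ι : Type*} [Fintype ι] [DecidableEq ι] {C : ℕ → Matrix ι ι ℝ}
    {C₀ : Matrix ι ι ℝ} (h : Tendsto (fun n : ℕ => (n : ℝ)⁻¹ • C n) atTop (𝓝 C₀))
    (hC : IsUnit C₀) : Tendsto (fun n : ℕ => (n : ℝ) • (C n)⁻¹) atTop (𝓝 C₀⁻¹) := by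
  refine (tendsto_matrix_inv h hC).congr' ?_
  filter_upwards [eventually_isUnit h hC, eventually_gt_atTop 0] with n h1 h2
  have h3 : (n : ℝ) ≠ 0 := by exact_mod_cast h2.ne'
  have h4 : IsUnit (C n) := by
    have := (Matrix.isUnit_iff_isUnit_det _).1 h1
    rw [Matrix.det_smul] at this
    exact (Matrix.isUnit_iff_isUnit_det _).2 (isUnit_of_mul_isUnit_right this)
  have := inv_smul_of_ne_zero (C n) (inv_ne_zero h3) h4
  rw [this, inv_inv]

theorem tendsto_Bmat (hR : Regular A E ψlim iFull iMis H) :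
    Tendsto (fun n : ℕ => (n : ℝ) • E.Bmat n) atTop
      (𝓝 ((iFull.toBlocks₁₁ - iMis)⁻¹ - iFull.toBlocks₁₁⁻¹)) := by
  refine ((tendsto_smul_inv (tendsto_Iobs hR) hR.posDef_obs.isUnit).sub
    (tendsto_smul_inv (tendsto_Icom hR) (posDef_toBlocks₁₁ hR).isUnit)).congr fun n => ?_
  rw [Imputation.Bmat, smul_sub, Imputation.Tmat, Imputation.Vmat]

/-- Validity of `V̂` for proper imputation forces the complete-data variance of `θ̂` to be the
inverse of the `θθ`-block of the information. -/
theorem toBlocks₁₁_inv [StandardBorelSpace Ω] [IsProbabilityMeasure P] {t : Test}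
    (hM : MeasurableStatistics A E t) (hR : Regular A E ψlim iFull iMis H)
    (hP : ProperImputation A E) (ℓ : Fin m) : (iFull⁻¹).toBlocks₁₁ = (iFull.toBlocks₁₁)⁻¹ := by
  have h1 : Tendsto (fun z : ℕ × Ω => (E.Tmat z.1)⁻¹ * (E.VImp A z.1 ℓ z.2 - E.Vmat z.1))
      (probFilter P) (𝓝 0) := by
    refine tendsto_pi_nhds.2 fun a => tendsto_pi_nhds.2 fun b => ?_
    rw [Metric.tendsto_nhds]
    intro ε hε
    rw [eventually_probFilter]
    have hmeas : ∀ n, MeasurableSet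
        {ω | ∃ a b, ε ≤ |((E.Tmat n)⁻¹ * (E.VImp A n ℓ ω - E.Vmat n)) a b|} := fun n => by
      simp only [Set.ofPred_exists]
      refine MeasurableSet.iUnion fun a => MeasurableSet.iUnion fun b =>
        measurableSet_le measurable_const (Measurable.abs ?_)
      simp only [Matrix.mul_apply, Matrix.sub_apply]
      exact Finset.measurable_sum _ fun c _ => ((hM.var n ℓ c b).sub_const _).const_mul _
    -- Conditional probabilities are bounded by one, so their convergence to zero in probability
    -- passes to their means, the unconditional probabilities.
    have h2 := tendsto_integral_of_tendstoInMeasure_of_bound (K := 1)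
      (fun n => stronglyMeasurable_condExp.mono (E.obsSigma_le n) |>.aestronglyMeasurable)
      (fun n => ?_) (hP.var ℓ ε hε)
    · rw [integral_zero] at h2
      have h3 : Tendsto (fun n => P {ω | ∃ a b, ε ≤
          |((E.Tmat n)⁻¹ * (E.VImp A n ℓ ω - E.Vmat n)) a b|}) atTop (𝓝 0) := by
        have := ENNReal.tendsto_ofReal h2
        rw [ENNReal.ofReal_zero] at this
        refine this.congr fun n => ?_
        rw [integral_condExp (E.obsSigma_le n), integral_indicator_const _ (hmeas n), smul_eq_mul, mul_one, ofReal_measureReal]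
      refine tendsto_of_tendsto_of_tendsto_of_le_of_le tendsto_const_nhds h3 (fun _ => zero_le)
        fun n => measure_mono fun ω hω => ?_
      refine ⟨a, b, ?_⟩
      have : ¬ _ := hω
      rw [Matrix.zero_apply, Real.dist_0_eq_abs, not_lt] at this
      exact this
    · have h4 := condExp_mono (m := E.obsSigma n) (μ := P)
        ((integrable_const (1 : ℝ)).indicator (hmeas n)) (integrable_const (1 : ℝ))
        (Eventually.of_forall fun ω => Set.indicator_le_self' (fun _ _ => zero_le_one) ω)
      have h5 := condExp_nonneg (m := E.obsSigma n) (μ := P)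
        (f := Set.indicator {ω | ∃ a b, ε ≤ |((E.Tmat n)⁻¹ * (E.VImp A n ℓ ω - E.Vmat n)) a b|}
          fun _ => (1 : ℝ))
        (Eventually.of_forall fun ω => Set.indicator_nonneg (fun _ _ => zero_le_one) ω)
      rw [condExp_const (E.obsSigma_le n)] at h4
      filter_upwards [h4, h5] with ω h6 h7
      rw [Real.norm_of_nonneg h7]
      exact h6
  have hJ := hR.posDef_obs.isUnit
  have hfst := tendsto_fst_probFilter (P := P)
  -- The law of large numbers for `V̂` gives a second limit of the same matrix. Uniqueness of limits
  -- makes it zero, and the invertible factor is cancelled.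
  have h2 : Tendsto (fun z : ℕ × Ω => (E.Tmat z.1)⁻¹ * (E.VImp A z.1 ℓ z.2 - E.Vmat z.1))
      (probFilter P) (𝓝 ((iFull.toBlocks₁₁ - iMis) *
        ((iFull⁻¹).toBlocks₁₁ - (iFull.toBlocks₁₁)⁻¹))) := by
    refine (((tendsto_Iobs hR).comp hfst).mul ((tendsto_VImp hR ℓ).sub
      ((tendsto_smul_inv (tendsto_Icom hR) (posDef_toBlocks₁₁ hR).isUnit).comp hfst))).congr' ?_
    filter_upwards [hfst.eventually (eventually_isUnit (tendsto_Iobs hR) hJ),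
      hfst.eventually (eventually_gt_atTop 0)] with z h3 h4
    have h5 : (z.1 : ℝ) ≠ 0 := by exact_mod_cast h4.ne'
    have h6 : IsUnit (E.Iobs z.1).det := by
      have := (Matrix.isUnit_iff_isUnit_det _).1 h3
      rw [Matrix.det_smul] at this
      exact isUnit_of_mul_isUnit_right this
    simp only [Function.comp]
    rw [Imputation.Tmat, Imputation.Vmat, Matrix.nonsing_inv_nonsing_inv _ h6, ← smul_sub,
      Matrix.smul_mul, Matrix.mul_smul, smul_smul, inv_mul_cancel₀ h5, one_smul]
  have h3 := tendsto_nhds_unique h2 h1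
  rw [← sub_eq_zero]
  have := congrArg (fun B => (iFull.toBlocks₁₁ - iMis)⁻¹ * B) h3
  simpa [← Matrix.mul_assoc, Matrix.nonsing_inv_mul _ ((Matrix.isUnit_iff_isUnit_det _).1 hJ)]
    using this

end StackedMI

/-! ### Gaussian characteristic functions, and the square root of `B` -/

namespace StackedMI

/-- The law of independent standard normal variables indexed by `ι`. -/
noncomputable def gaussianPi (ι : Type*) [Fintype ι] : Measure (ι → ℝ) :=
  Measure.pi fun _ => gaussianReal 0 1

instance (ι : Type*) [Fintype ι] : IsProbabilityMeasure (gaussianPi ι) := by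
  unfold gaussianPi; infer_instance

theorem integral_cexp_gaussianPi {ι : Type*} [Fintype ι] (u : ι → ℝ) :
    ∫ z, Complex.exp ((u ⬝ᵥ z : ℝ) * Complex.I) ∂(gaussianPi ι) =
      Complex.exp (-(u ⬝ᵥ u : ℝ) / 2) := by
  have h1 : ∀ z : ι → ℝ, Complex.exp ((u ⬝ᵥ z : ℝ) * Complex.I) =
      ∏ i, Complex.exp (u i * z i * Complex.I) := fun z => by
    rw [← Complex.exp_sum, dotProduct]
    push_cast
    rw [Finset.sum_mul]
  simp only [h1, gaussianPi]
  rw [integral_fintype_prod_eq_prod (𝕜 := ℂ) (fun i (x : ℝ) => Complex.exp (u i * x * Complex.I))]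
  simp only [← charFun_apply_real, charFun_gaussianReal]
  rw [← Complex.exp_sum, dotProduct]
  congr 1
  push_cast
  rw [neg_div, Finset.sum_div, ← Finset.sum_neg_distrib]
  refine Finset.sum_congr rfl fun i _ => ?_
  simp
  ring

theorem integrable_cexp_gaussianPi {ι : Type*} [Fintype ι] (u : ι → ℝ) :
    Integrable (fun z => Complex.exp ((u ⬝ᵥ z : ℝ) * Complex.I)) (gaussianPi ι) := by
  refine Integrable.of_bound (C := 1) (Continuous.aestronglyMeasurable (by fun_prop)) ?_
  exact Eventually.of_forall fun z => by rw [Complex.norm_exp_ofReal_mul_I]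

theorem integral_cos_gaussianPi {ι : Type*} [Fintype ι] (u : ι → ℝ) :
    ∫ z, Real.cos (u ⬝ᵥ z) ∂(gaussianPi ι) = Real.exp (-(u ⬝ᵥ u) / 2) := by
  have h1 := congrArg Complex.re (integral_cexp_gaussianPi u)
  have h2 := integral_re (integrable_cexp_gaussianPi u)
  simp only [RCLike.re_eq_complex_re, Complex.exp_ofReal_mul_I_re] at h2
  rw [h2, h1]
  norm_cast

theorem integral_sin_gaussianPi {ι : Type*} [Fintype ι] (u : ι → ℝ) :
    ∫ z, Real.sin (u ⬝ᵥ z) ∂(gaussianPi ι) = 0 := by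
  have h1 := congrArg Complex.im (integral_cexp_gaussianPi u)
  have h2 := integral_im (integrable_cexp_gaussianPi u)
  simp only [RCLike.im_eq_complex_im, Complex.exp_ofReal_mul_I_im] at h2
  rw [h2, h1]
  norm_cast

/-- Trigonometric test functions. -/
noncomputable def cosTest {k : ℕ} (u : Fin k → ℝ) : BoundedContinuousFunction (Fin k → ℝ) ℝ :=
  BoundedContinuousFunction.ofNormedAddCommGroup (fun z => Real.cos (u ⬝ᵥ z)) (by fun_prop) 1
    fun z => by simpa using Real.abs_cos_le_one _

noncomputable def sinTest {k : ℕ} (u : Fin k → ℝ) : BoundedContinuousFunction (Fin k → ℝ) ℝ :=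
  BoundedContinuousFunction.ofNormedAddCommGroup (fun z => Real.sin (u ⬝ᵥ z)) (by fun_prop) 1
    fun z => by simpa using Real.abs_sin_le_one _

variable {p k q m : ℕ} {M : Model p k q} {Ω : Type*} [MeasurableSpace Ω] {P : Measure Ω}
  {A : Analyst M} {E : Imputation M m Ω P} {ψlim : Param k q}
  {iFull : Matrix (Fin k ⊕ Fin q) (Fin k ⊕ Fin q) ℝ} {iMis : Matrix (Fin k) (Fin k) ℝ}
  {H : Fin A.dim → ℝ}

/-- Conditional asymptotic normality excludes the default value `0` of `B^{-1/2}`. -/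
theorem eventually_nonneg_inv_Bmat [StandardBorelSpace Ω] [IsProbabilityMeasure P]
    (hP : ProperImputation A E) (ℓ : Fin m) : ∀ᶠ n in atTop, 0 ≤ (E.Bmat n)⁻¹ := by
  rcases isEmpty_or_nonempty (Fin k) with h0 | ⟨⟨j⟩⟩
  · exact Eventually.of_forall fun n => le_of_eq (Subsingleton.elim _ _)
  have h1 := hP.normal ℓ (cosTest (Pi.single j 1))
  have h2 : ∫ z, cosTest (Pi.single j 1) z ∂(stdNormal k) = Real.exp (-1 / 2) := by
    have := integral_cos_gaussianPi (Pi.single j (1 : ℝ))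
    rw [single_one_dotProduct, Pi.single_eq_same] at this
    exact this
  rw [h2] at h1
  have h3 : Real.exp (-1 / 2) < 1 := by
    rw [Real.exp_lt_one_iff]; norm_num
  rw [tendstoInMeasure_iff_dist] at h1
  filter_upwards [(h1 (1 - Real.exp (-1 / 2)) (sub_pos.2 h3)).eventually
    (gt_mem_nhds zero_lt_one)] with n hn
  by_contra hneg
  -- `CFC.sqrt` takes the value zero outside the nonnegative cone. The cosine test function would
  -- then be constantly one, too far from its Gaussian mean `exp (-1 / 2)`.
  have h4 : invSqrt (E.Bmat n) = 0 := CFC.sqrt_of_not_nonneg hneg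
  have h5 : (fun ω => cosTest (Pi.single j 1)
      (invSqrt (E.Bmat n) *ᵥ (E.thetaImp A n ℓ ω - E.thetaObs n ω))) = fun _ => 1 := by
    funext ω
    simp [h4, cosTest]
  rw [h5, condExp_const (E.obsSigma_le n)] at hn
  refine absurd hn (not_lt.2 (le_of_eq ?_))
  rw [← measure_univ (μ := P)]
  congr 1
  symm
  refine Set.eq_univ_of_forall fun ω => ?_
  change _ ≤ dist (1 : ℝ) _
  rw [Real.dist_eq, abs_of_nonneg (sub_pos.2 h3).le]

theorem posSemidef_of_tendsto {ι α : Type*} [Fintype ι] {l : Filter α} [l.NeBot]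
    {S : α → Matrix ι ι ℝ} {S₀ : Matrix ι ι ℝ} (h : Tendsto S l (𝓝 S₀))
    (hS : ∀ᶠ a in l, (S a).PosSemidef) : S₀.PosSemidef := by
  refine Matrix.PosSemidef.of_dotProduct_mulVec_nonneg ?_ fun x => ?_
  · have hc : Continuous fun B : Matrix ι ι ℝ => Bᴴ := by fun_prop
    refine tendsto_nhds_unique (((hc.tendsto _).comp h).congr' ?_) h
    filter_upwards [hS] with a ha using ha.isHermitian
  · refine ge_of_tendsto ((tendsto_quad h (tendsto_const_nhds (x := x)))) ?_
    filter_upwards [hS] with a ha using by simpa [quad] using ha.dotProduct_mulVec_nonneg x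

/-- Continuity of the positive square root. -/
theorem tendsto_of_mul_self_tendsto {ι α : Type*} [Fintype ι] [DecidableEq ι] {l : Filter α}
    {S : α → Matrix ι ι ℝ} {b : Matrix ι ι ℝ} (hS : ∀ᶠ a in l, (S a).PosSemidef)
    (h : Tendsto (fun a => S a * S a) l (𝓝 b)) : Tendsto S l (𝓝 (CFC.sqrt b)) := by
  rw [tendsto_iff_ultrafilter]
  intro g hg
  obtain ⟨K, hK⟩ := (Set.finite_range fun a => √(b a a + 1)).bddAbove
  -- For symmetric `S a` the diagonal of `S a * S a` contains the row sums of squares, so the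
  -- entries stay bounded. Compactness then gives a limit along `g`, identified by uniqueness of the
  -- positive semidefinite root.
  have hbd : ∀ᶠ a in (g : Filter α), ∀ i j, |S a i j| ≤ K := by
    have h1 : ∀ i, Tendsto (fun a => (S a * S a) i i) g (𝓝 (b i i)) := fun i =>
      tendsto_pi_nhds.1 (tendsto_pi_nhds.1 (h.mono_left hg) i) i
    filter_upwards [hg hS, eventually_all.2 fun i => (h1 i).eventually
      (gt_mem_nhds (lt_add_one (b i i)))] with a ha h2 i j
    refine le_trans (Real.abs_le_sqrt ?_) (hK ⟨i, rfl⟩)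
    refine le_trans ?_ (h2 i).le
    have hsym : ∀ c, S a c i = S a i c := fun c => by
      simpa using congrFun (congrFun ha.isHermitian i) c
    rw [Matrix.mul_apply]
    simp only [hsym, ← pow_two]
    exact Finset.single_le_sum (f := fun c => S a i c ^ 2) (fun c _ => sq_nonneg _)
      (Finset.mem_univ j)
  have hcomp : IsCompact (Set.univ.pi fun _ : ι => Set.univ.pi fun _ : ι => Set.Icc (-K) K) :=
    isCompact_univ_pi fun _ => isCompact_univ_pi fun _ => isCompact_Icc
  obtain ⟨S₀, -, hS₀⟩ := hcomp.ultrafilter_le_nhds' (g.map S) (by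
    change ∀ᶠ a in (g : Filter α), _
    filter_upwards [hbd] with a ha i _ j _ using abs_le.1 (ha i j))
  have hS₀' : Tendsto S g (𝓝 S₀) := hS₀
  have h1 := posSemidef_of_tendsto hS₀' (hg hS)
  have h2 := tendsto_nhds_unique (hS₀'.mul hS₀') (h.mono_left hg)
  rw [CFC.sqrt_unique h2 h1.nonneg]
  exact hS₀'

theorem eventually_isUnit_Bmat (hR : Regular A E ψlim iFull iMis H) :
    ∀ᶠ n : ℕ in atTop, IsUnit (E.Bmat n) := by
  filter_upwards [eventually_isUnit (tendsto_Bmat hR) hR.posDef_B.isUnit] with n hn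
  have := (Matrix.isUnit_iff_isUnit_det _).1 hn
  rw [Matrix.det_smul] at this
  exact (Matrix.isUnit_iff_isUnit_det _).2 (isUnit_of_mul_isUnit_right this)

theorem eventually_invSqrt_Bmat [StandardBorelSpace Ω] [IsProbabilityMeasure P]
    (hR : Regular A E ψlim iFull iMis H) (hP : ProperImputation A E) (ℓ : Fin m) :
    ∀ᶠ n : ℕ in atTop, (invSqrt (E.Bmat n)).PosSemidef ∧ IsUnit (invSqrt (E.Bmat n)) ∧
      invSqrt (E.Bmat n) * invSqrt (E.Bmat n) = (E.Bmat n)⁻¹ := by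
  filter_upwards [eventually_isUnit_Bmat hR, eventually_nonneg_inv_Bmat hP ℓ] with n h1 h2
  have h3 : invSqrt (E.Bmat n) * invSqrt (E.Bmat n) = (E.Bmat n)⁻¹ := CFC.sqrt_mul_sqrt_self _ h2
  refine ⟨Matrix.nonneg_iff_posSemidef.1 (CFC.sqrt_nonneg _), ?_, h3⟩
  have h4 := (Matrix.isUnit_iff_isUnit_det _).1 ((Matrix.isUnit_nonsing_inv_iff).2 h1)
  rw [← h3, Matrix.det_mul] at h4
  exact (Matrix.isUnit_iff_isUnit_det _).2 (isUnit_of_mul_isUnit_left h4)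

/-- The inverse of `invSqrt B` plays the role of `B^{1/2}`: it is positive semidefinite and its
square is `B`. -/
theorem tendsto_inv_invSqrt_Bmat [StandardBorelSpace Ω] [IsProbabilityMeasure P]
    (hR : Regular A E ψlim iFull iMis H) (hP : ProperImputation A E) (ℓ : Fin m) :
    Tendsto (fun n : ℕ => √(n : ℝ) • (invSqrt (E.Bmat n))⁻¹) atTop
      (𝓝 (CFC.sqrt ((iFull.toBlocks₁₁ - iMis)⁻¹ - iFull.toBlocks₁₁⁻¹))) := by
  refine tendsto_of_mul_self_tendsto ?_ ((tendsto_Bmat hR).congr' ?_)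
  · filter_upwards [eventually_invSqrt_Bmat hR hP ℓ] with n hn
    exact hn.1.inv.smul (Real.sqrt_nonneg _)
  · filter_upwards [eventually_invSqrt_Bmat hR hP ℓ, eventually_isUnit_Bmat hR] with n hn h1
    rw [Matrix.smul_mul, Matrix.mul_smul, smul_smul, Real.mul_self_sqrt n.cast_nonneg,
      ← Matrix.mul_inv_rev, hn.2.2,
      Matrix.nonsing_inv_nonsing_inv _ ((Matrix.isUnit_iff_isUnit_det _).1 h1)]

/-- In the basis of principal axes, the limiting quadratic form of the standardized imputation
noise has the odds of missing information as coefficients. -/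
theorem exists_orthogonal_limit (hR : Regular A E ψlim iFull iMis H) {r : Fin k → ℝ}
    (hr : IsOMI iFull.toBlocks₁₁ iMis r) :
    ∃ O : Matrix (Fin k) (Fin k) ℝ, O * Oᵀ = 1 ∧ Oᵀ * O = 1 ∧
      ∀ y, quad iFull.toBlocks₁₁
        (CFC.sqrt ((iFull.toBlocks₁₁ - iMis)⁻¹ - iFull.toBlocks₁₁⁻¹) *ᵥ y) =
          ∑ j, r j * (Oᵀ *ᵥ y) j ^ 2 := by
  obtain ⟨f, -, hf, hrf⟩ := hr
  have hWu := (posDef_toBlocks₁₁ hR).isUnit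
  have hWs := (posDef_toBlocks₁₁ hR).isHermitian
  have hJ := hR.posDef_obs.isUnit
  have hb := hR.posDef_B.posSemidef.nonneg
  set W := iFull.toBlocks₁₁
  set b := (W - iMis)⁻¹ - W⁻¹
  set β := CFC.sqrt b
  have hWd := (Matrix.isUnit_iff_isUnit_det _).1 hWu
  have hβ : β * β = b := CFC.sqrt_mul_sqrt_self _ hb
  have hβs : βᵀ = β := by
    simpa using (Matrix.nonneg_iff_posSemidef.1 (CFC.sqrt_nonneg b)).isHermitian.eq
  have hFW : (1 - iMis * W⁻¹) * W = W - iMis := by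
    rw [sub_mul, one_mul, Matrix.mul_assoc, Matrix.nonsing_inv_mul _ hWd, Matrix.mul_one]
  have hF : IsUnit (1 - iMis * W⁻¹) := by
    have := (Matrix.isUnit_iff_isUnit_det _).1 hJ
    rw [← hFW, Matrix.det_mul] at this
    exact (Matrix.isUnit_iff_isUnit_det _).2 (isUnit_of_mul_isUnit_left this)
  -- This links `B` to the odds of missing information. The symmetric matrix `β * W * β` has the
  -- same characteristic polynomial as `W * b`, by cyclicity.
  have hWb : W * b = (1 - iMis * W⁻¹)⁻¹ - 1 := by
    rw [show b = (W - iMis)⁻¹ - W⁻¹ from rfl, ← hFW, Matrix.mul_inv_rev, mul_sub,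
      ← Matrix.mul_assoc, Matrix.mul_nonsing_inv _ hWd, one_mul]
  have hchar : (β * W * β).charpoly = ∏ j, (Polynomial.X - Polynomial.C (r j)) := by
    rw [Matrix.mul_assoc, Matrix.charpoly_mul_comm, Matrix.mul_assoc, hβ, hWb,
      charpoly_inv_one_sub_sub_one hf hF]
    simp only [hrf]
  have hS : (β * W * β).IsHermitian := by
    rw [Matrix.IsHermitian, Matrix.conjTranspose_mul, Matrix.conjTranspose_mul, hWs.eq]
    simp only [Matrix.conjTranspose_eq_transpose_of_trivial, hβs, Matrix.mul_assoc]
  obtain ⟨O, h1, h2, h3⟩ := exists_orthogonal_quad_eq hS hchar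
  refine ⟨O, h1, h2, fun y => ?_⟩
  rw [← h3, quad, quad, ← Matrix.mulVec_mulVec, ← Matrix.mulVec_mulVec, Matrix.dotProduct_mulVec y,
    ← Matrix.mulVec_transpose, hβs]

end StackedMI

/-! ### Conditional independence, and the joint characteristic function of the noises -/

namespace StackedMI

section ConditionalIndependence

variable {Ω ι : Type*} [Fintype ι] {m' : MeasurableSpace Ω} [mΩ : MeasurableSpace Ω]
  [StandardBorelSpace Ω] {P : Measure Ω} [IsProbabilityMeasure P]

/-- Conditionally independent real variables are independent under almost every conditional
distribution. -/
theorem ae_iIndepFun_condExpKernel (hm' : m' ≤ mΩ) {h : ι → Ω → ℝ} (hh : ∀ i, Measurable (h i))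
    (hind : iCondIndepFun m' hm' h P) : ∀ᵐ ω ∂P, iIndepFun h (condExpKernel P m' ω) := by
  -- Half-lines with rational end points generate the Borel sets and form a countable family, so the
  -- exceptional null sets can be merged into one.
  have h1 : ∀ (s : Finset ι) (c : ι → ℚ), ∀ᵐ ω ∂P,
      condExpKernel P m' ω (⋂ i ∈ s, h i ⁻¹' Set.Iio (c i : ℝ)) =
        ∏ i ∈ s, condExpKernel P m' ω (h i ⁻¹' Set.Iio (c i : ℝ)) := fun s c =>
    ae_of_ae_trim hm' (hind s (f := fun i => h i ⁻¹' Set.Iio (c i : ℝ))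
      fun i _ => ⟨_, measurableSet_Iio, rfl⟩)
  filter_upwards [ae_all_iff.2 fun s => ae_all_iff.2 fun c => h1 s c] with ω hω
  rw [iIndepFun_iff_iIndep]
  refine iIndepSets.iIndep (fun i => (hh i).comap_le)
    (fun i => {t | ∃ u ∈ (⋃ a : ℚ, {Set.Iio (a : ℝ)}), h i ⁻¹' u = t})
    (fun i => Real.isPiSystem_Iio_rat.comap (h i)) (fun i => ?_) ?_
  · rw [BorelSpace.measurable_eq (α := ℝ), Real.borel_eq_generateFrom_Iio_rat,
      MeasurableSpace.comap_generateFrom]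
    rfl
  · rw [iIndepSets_iff]
    intro s f hf
    have h2 : ∀ i, ∃ c : ℚ, i ∈ s → f i = h i ⁻¹' Set.Iio (c : ℝ) := fun i => by
      by_cases hi : i ∈ s
      · obtain ⟨u, hu, hfu⟩ := hf i hi
        obtain ⟨c, hc⟩ := Set.mem_iUnion.1 hu
        exact ⟨c, fun _ => by rw [← hfu, hc]⟩
      · exact ⟨0, fun h => absurd h hi⟩
    choose c hc using h2
    rw [Set.iInter₂_congr hc, hω s c]
    exact Finset.prod_congr rfl fun i hi => by rw [hc i hi]

theorem condExp_prod_of_iCondIndepFun (hm' : m' ≤ mΩ) {h : ι → Ω → ℝ}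
    (hh : ∀ i, Measurable (h i)) (hind : iCondIndepFun m' hm' h P) {φ : ℝ → ℂ}
    (hφ : Measurable φ) (hb : ∀ x, ‖φ x‖ ≤ 1) :
    P[fun ω => ∏ i, φ (h i ω) | m'] =ᵐ[P] fun ω => ∏ i, (P[fun ω => φ (h i ω) | m']) ω := by
  have hint : ∀ i, Integrable (fun ω => φ (h i ω)) P := fun i =>
    Integrable.of_bound (C := 1) (hφ.comp (hh i)).aestronglyMeasurable
      (Eventually.of_forall fun ω => hb _)
  have hintp : Integrable (fun ω => ∏ i, φ (h i ω)) P := by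
    refine Integrable.of_bound (C := 1) (Measurable.aestronglyMeasurable
      (Finset.measurable_prod _ fun i _ => hφ.comp (hh i))) (Eventually.of_forall fun ω => ?_)
    rw [norm_prod]
    exact Finset.prod_le_one (fun i _ => norm_nonneg _) fun i _ => hb _
  filter_upwards [ae_iIndepFun_condExpKernel hm' hh hind,
    condExp_ae_eq_integral_condExpKernel hm' hintp,
    ae_all_iff.2 fun i => condExp_ae_eq_integral_condExpKernel hm' (hint i)] with ω h1 h2 h3
  rw [h2]
  simp only [h3]
  exact h1.integral_fun_prod_comp (f := fun _ => φ) (fun i => (hh i).aemeasurable)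
    fun i => hφ.aestronglyMeasurable

theorem tendsto_integral_of_tendsto_condExp {m' : ℕ → MeasurableSpace Ω} (hm' : ∀ n, m' n ≤ mΩ)
    {f : ℕ → Ω → ℂ} {c : ℂ} (hf : ∀ n, AEStronglyMeasurable (f n) P) (hb : ∀ n ω, ‖f n ω‖ ≤ 1)
    (h : Tendsto (fun z : ℕ × Ω => (P[f z.1 | m' z.1]) z.2) (probFilter P) (𝓝 c)) :
    Tendsto (fun n => ∫ ω, f n ω ∂P) atTop (𝓝 c) := by
  have h2 := tendsto_integral_of_tendstoInMeasure_of_bound (K := 1)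
    (fun n => (stronglyMeasurable_condExp.mono (hm' n)).aestronglyMeasurable)
    (fun n => ?_) (tendsto_probFilter_iff.1 h)
  · rw [integral_const, probReal_univ, one_smul] at h2
    exact h2.congr fun n => integral_condExp (hm' n)
  · have hi : Integrable (f n) P :=
      Integrable.of_bound (hf n) 1 (Eventually.of_forall (hb n))
    filter_upwards [condExp_ae_eq_integral_condExpKernel (hm' n) hi] with ω hω
    rw [hω]
    exact (norm_integral_le_of_norm_le_const (C := 1) (Eventually.of_forall (hb n))).trans
      (by simp)

end ConditionalIndependence

section JointLimit

variable {p k q m : ℕ} {M : Model p k q} {Ω : Type*} [MeasurableSpace Ω] {P : Measure Ω}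
  {A : Analyst M} {E : Imputation M m Ω P} {ψlim : Param k q}
  {iFull : Matrix (Fin k ⊕ Fin q) (Fin k ⊕ Fin q) ℝ} {iMis : Matrix (Fin k) (Fin k) ℝ}
  {H : Fin A.dim → ℝ}

/-- The standardized imputation noise `B^{-1/2}(θ̂^ℓ - θ̂_obs)`. -/
noncomputable def noise (A : Analyst M) (E : Imputation M m Ω P) (n : ℕ) (ℓ : Fin m) (ω : Ω) :
    Fin k → ℝ := invSqrt (E.Bmat n) *ᵥ (E.thetaImp A n ℓ ω - E.thetaObs n ω)

theorem measurable_thetaObs (E : Imputation M m Ω P) (n : ℕ) :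
    Measurable[E.obsSigma n] (E.thetaObs n) :=
  (continuous_thetaPart.measurable.comp (E.measurable_psiObs n)).comp (comap_measurable _)

theorem measurable_noise {t : Test} (hM : MeasurableStatistics A E t) (n : ℕ) (ℓ : Fin m) :
    Measurable (noise A E n ℓ) := by
  have h1 : Measurable (E.thetaObs n) := (measurable_thetaObs E n).mono (E.obsSigma_le n) le_rfl
  have h2 : Continuous fun x : Fin k → ℝ => invSqrt (E.Bmat n) *ᵥ x := by fun_prop
  exact h2.measurable.comp ((hM.theta n ℓ).sub h1)

theorem integrable_cexp_ofReal [IsProbabilityMeasure P] {f : Ω → ℝ} (hf : Measurable f) :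
    Integrable (fun ω => Complex.exp (f ω * Complex.I)) P := by
  refine Integrable.of_bound (C := 1) (Measurable.aestronglyMeasurable (by fun_prop)) ?_
  exact Eventually.of_forall fun z => by rw [Complex.norm_exp_ofReal_mul_I]

variable [StandardBorelSpace Ω] [IsProbabilityMeasure P]

/-- The conditional characteristic function of the noise converges in probability. -/
theorem tendsto_condExp_cexp_noise {t : Test} (hM : MeasurableStatistics A E t)
    (hP : ProperImputation A E) (ℓ : Fin m) (u : Fin k → ℝ) :
    Tendsto (fun z : ℕ × Ω =>
      (P[fun ω => Complex.exp ((u ⬝ᵥ noise A E z.1 ℓ ω : ℝ) * Complex.I) | E.obsSigma z.1]) z.2)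
      (probFilter P) (𝓝 (Complex.exp (-(u ⬝ᵥ u : ℝ) / 2))) := by
  have hc := tendsto_probFilter_iff.2 (integral_cos_gaussianPi u ▸ hP.normal ℓ (cosTest u))
  have hs := tendsto_probFilter_iff.2 (integral_sin_gaussianPi u ▸ hP.normal ℓ (sinTest u))
  have h1 := ((Complex.continuous_ofReal.tendsto _).comp hc).add
    (((Complex.continuous_ofReal.tendsto _).comp hs).mul_const Complex.I)
  have h2 : (Real.exp (-(u ⬝ᵥ u) / 2) : ℂ) + (0 : ℝ) * Complex.I =
      Complex.exp (-(u ⬝ᵥ u : ℝ) / 2) := by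
    push_cast; ring
  change Tendsto _ _ (𝓝 ((Real.exp (-(u ⬝ᵥ u) / 2) : ℂ) + (0 : ℝ) * Complex.I)) at h1
  rw [h2] at h1
  refine Tendsto.congr' ?_ h1
  refine eventually_probFilter_of_ae fun n => ?_
  have hmeas : Measurable fun ω => u ⬝ᵥ noise A E n ℓ ω :=
    (Continuous.measurable (by fun_prop : Continuous fun x : Fin k → ℝ => u ⬝ᵥ x)).comp
      (measurable_noise hM n ℓ)
  have ic : Integrable (fun ω => Real.cos (u ⬝ᵥ noise A E n ℓ ω)) P :=
    Integrable.of_bound (C := 1) (Measurable.aestronglyMeasurable (by fun_prop))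
      (Eventually.of_forall fun ω => by simpa using Real.abs_cos_le_one _)
  have is : Integrable (fun ω => Real.sin (u ⬝ᵥ noise A E n ℓ ω)) P :=
    Integrable.of_bound (C := 1) (Measurable.aestronglyMeasurable (by fun_prop))
      (Eventually.of_forall fun ω => by simpa using Real.abs_sin_le_one _)
  -- Conditional normality is stated for real test functions, so the exponential is split into
  -- cosine and sine, and conditional expectation is commuted with the two embeddings into `ℂ`.
  have e1 : (fun ω => Complex.exp ((u ⬝ᵥ noise A E n ℓ ω : ℝ) * Complex.I)) =
      (fun ω => Complex.ofRealCLM (Real.cos (u ⬝ᵥ noise A E n ℓ ω))) +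
      (fun ω => ((ContinuousLinearMap.mul ℝ ℂ).flip Complex.I).comp Complex.ofRealCLM
        (Real.sin (u ⬝ᵥ noise A E n ℓ ω))) := by
    funext ω
    change _ = ((Real.cos _ : ℝ) : ℂ) + ((Real.sin _ : ℝ) : ℂ) * Complex.I
    rw [Complex.exp_mul_I, Complex.ofReal_cos, Complex.ofReal_sin]
  have e2 := condExp_add (Complex.ofRealCLM.integrable_comp ic)
    ((((ContinuousLinearMap.mul ℝ ℂ).flip Complex.I).comp Complex.ofRealCLM).integrable_comp is)
    (E.obsSigma n)
  have e3 := Complex.ofRealCLM.comp_condExp_comm (m := E.obsSigma n) ic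
  have e4 := (((ContinuousLinearMap.mul ℝ ℂ).flip Complex.I).comp
    Complex.ofRealCLM).comp_condExp_comm (m := E.obsSigma n) is
  filter_upwards [e2, e3, e4] with ω w2 w3 w4
  rw [e1]
  refine Eq.trans ?_ w2.symm
  rw [Pi.add_apply]
  refine congrArg₂ (· + ·) (w3.trans ?_) (w4.trans ?_) <;> rfl

/-- The observed-data MLE is a function of `X_obs`. Its phase factors `g ℓ` have modulus one and can
be pulled out of the conditional expectations; what remains involves only the conditionally
independent imputed estimates. -/
theorem condExp_prod_cexp_noise {t : Test} (hM : MeasurableStatistics A E t)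
    (hP : ProperImputation A E) (u : Fin m → Fin k → ℝ) (n : ℕ) :
    P[fun ω => ∏ ℓ, Complex.exp ((u ℓ ⬝ᵥ noise A E n ℓ ω : ℝ) * Complex.I) | E.obsSigma n]
      =ᵐ[P] fun ω => ∏ ℓ,
        (P[fun ω => Complex.exp ((u ℓ ⬝ᵥ noise A E n ℓ ω : ℝ) * Complex.I) | E.obsSigma n]) ω := by
  set R := invSqrt (E.Bmat n)
  have hcont : ∀ v : Fin k → ℝ, Continuous fun x : Fin k → ℝ => v ⬝ᵥ R *ᵥ x := fun v => by fun_prop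
  let h : Fin m → Ω → ℝ := fun ℓ ω => u ℓ ⬝ᵥ R *ᵥ E.thetaImp A n ℓ ω
  let g : Fin m → Ω → ℂ := fun ℓ ω => Complex.exp ((-(u ℓ ⬝ᵥ R *ᵥ E.thetaObs n ω) : ℝ) * Complex.I)
  have hh : ∀ ℓ, Measurable (h ℓ) := fun ℓ => (hcont _).measurable.comp (hM.theta n ℓ)
  have hg : ∀ ℓ, Measurable[E.obsSigma n] (g ℓ) := fun ℓ => by
    have h1 := (hcont (u ℓ)).measurable.comp (measurable_thetaObs E n)
    have h2 : Measurable fun x : ℝ => Complex.exp ((-x : ℝ) * Complex.I) := by fun_prop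
    exact h2.comp h1
  have hgn : ∀ ℓ ω, ‖g ℓ ω‖ = 1 := fun ℓ ω => Complex.norm_exp_ofReal_mul_I _
  have hind : iCondIndepFun (E.obsSigma n) (E.obsSigma_le n) h P :=
    (hP.indep n).comp (fun ℓ x => u ℓ ⬝ᵥ R *ᵥ x.1)
      fun ℓ => (hcont (u ℓ)).measurable.comp measurable_fst
  have key := condExp_prod_of_iCondIndepFun (E.obsSigma_le n) hh hind
    (φ := fun x => Complex.exp (x * Complex.I)) (by fun_prop)
    (fun x => (Complex.norm_exp_ofReal_mul_I x).le)
  have e1 : ∀ ℓ ω, Complex.exp ((u ℓ ⬝ᵥ noise A E n ℓ ω : ℝ) * Complex.I) =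
      g ℓ ω * Complex.exp (h ℓ ω * Complex.I) := fun ℓ ω => by
    rw [← Complex.exp_add]
    congr 1
    simp only [noise, h, Matrix.mulVec_sub, dotProduct_sub]
    push_cast
    ring
  have ih : ∀ ℓ, Integrable (fun ω => Complex.exp (h ℓ ω * Complex.I)) P := fun ℓ =>
    integrable_cexp_ofReal (hh ℓ)
  have ip : Integrable (fun ω => ∏ ℓ, Complex.exp (h ℓ ω * Complex.I)) P := by
    have : Measurable fun ω => ∑ ℓ, h ℓ ω := Finset.measurable_sum _ fun ℓ _ => hh ℓ
    refine (integrable_cexp_ofReal this).congr (Eventually.of_forall fun ω => ?_)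
    simp only [← Complex.exp_sum, ← Finset.sum_mul, Complex.ofReal_sum]
  have pull : ∀ {a b : Ω → ℂ}, Measurable[E.obsSigma n] a → (∀ ω, ‖a ω‖ = 1) → Integrable b P →
      P[fun ω => a ω * b ω | E.obsSigma n] =ᵐ[P] fun ω => a ω * (P[b | E.obsSigma n]) ω :=
    fun {a b} ha hn hb => by
      have := condExp_bilin_of_stronglyMeasurable_left (m := E.obsSigma n)
        (ContinuousLinearMap.mul ℝ ℂ)
        ha.stronglyMeasurable (g := b) (μ := P) ?_ hb
      · exact this
      · refine hb.bdd_mul (c := 1) ?_ (Eventually.of_forall fun ω => (hn ω).le)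
        exact (ha.mono (E.obsSigma_le n) le_rfl).aestronglyMeasurable
  have p1 := pull (a := fun ω => ∏ ℓ, g ℓ ω) (Finset.measurable_prod _ fun ℓ _ => hg ℓ)
    (fun ω => by rw [norm_prod]; exact Finset.prod_eq_one fun ℓ _ => hgn ℓ ω) ip
  have p2 := fun ℓ => pull (hg ℓ) (hgn ℓ) (ih ℓ)
  simp only [e1, Finset.prod_mul_distrib]
  filter_upwards [key, p1, ae_all_iff.2 p2] with ω w1 w2 w3
  rw [w2, w1, ← Finset.prod_mul_distrib]
  exact Finset.prod_congr rfl fun ℓ _ => (w3 ℓ).symm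

/-- Joint characteristic function of the noises of all imputations. -/
theorem tendsto_integral_prod_cexp_noise {t : Test} (hM : MeasurableStatistics A E t)
    (hP : ProperImputation A E) (u : Fin m → Fin k → ℝ) :
    Tendsto (fun n => ∫ ω, ∏ ℓ, Complex.exp ((u ℓ ⬝ᵥ noise A E n ℓ ω : ℝ) * Complex.I) ∂P) atTop
      (𝓝 (Complex.exp (-((∑ ℓ, u ℓ ⬝ᵥ u ℓ : ℝ)) / 2))) := by
  have h1 : Tendsto (fun z : ℕ × Ω => (P[fun ω => ∏ ℓ,
      Complex.exp ((u ℓ ⬝ᵥ noise A E z.1 ℓ ω : ℝ) * Complex.I) | E.obsSigma z.1]) z.2)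
      (probFilter P) (𝓝 (∏ ℓ, Complex.exp (-(u ℓ ⬝ᵥ u ℓ : ℝ) / 2))) := by
    refine Tendsto.congr' ?_ (tendsto_finsetProd Finset.univ fun ℓ _ =>
      tendsto_condExp_cexp_noise hM hP ℓ (u ℓ))
    refine eventually_probFilter_of_ae fun n => ?_
    filter_upwards [condExp_prod_cexp_noise hM hP u n] with ω hω using hω.symm
  have e : ∏ ℓ, Complex.exp (-(u ℓ ⬝ᵥ u ℓ : ℝ) / 2) =
      Complex.exp (-((∑ ℓ, u ℓ ⬝ᵥ u ℓ : ℝ)) / 2) := by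
    rw [← Complex.exp_sum, ← Finset.sum_div, Finset.sum_neg_distrib, Complex.ofReal_sum]
  rw [e] at h1
  -- The conditional limit is nonrandom, so taking expectations gives the joint limit without
  -- conditioning.
  refine tendsto_integral_of_tendsto_condExp E.obsSigma_le
    (f := fun n ω => ∏ ℓ, Complex.exp ((u ℓ ⬝ᵥ noise A E n ℓ ω : ℝ) * Complex.I))
    (fun n => ?_) (fun n ω => ?_) h1
  · refine Finset.aestronglyMeasurable_fun_prod _ fun ℓ _ => Measurable.aestronglyMeasurable ?_
    have : Continuous fun x : Fin k → ℝ => Complex.exp ((u ℓ ⬝ᵥ x : ℝ) * Complex.I) := by fun_prop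
    exact this.measurable.comp (measurable_noise hM n ℓ)
  · rw [norm_prod]
    exact (Finset.prod_eq_one fun ℓ _ => Complex.norm_exp_ofReal_mul_I _).le

end JointLimit

end StackedMI

/-! ### Joint limit law of the statistics of two pairs -/

namespace StackedMI

section Pair

variable {k : ℕ}

/-- A pair of `k`-dimensional standard normal vectors with cross-correlation `ρ`, in terms of
`2k` independent standard normal variables. -/
noncomputable def correlatedPair (ρ : ℝ) (z : Fin k ⊕ Fin k → ℝ) :
    EuclideanSpace ℝ (Fin k ⊕ Fin k) :=
  WithLp.toLp 2 (Sum.elim (fun j => z (Sum.inl j))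
    fun j => ρ * z (Sum.inl j) + √(1 - ρ ^ 2) * z (Sum.inr j))

theorem continuous_correlatedPair (ρ : ℝ) : Continuous (correlatedPair (k := k) ρ) := by
  refine (PiLp.continuous_toLp 2 _).comp (continuous_pi fun a => ?_)
  rcases a with j | j <;> simp only [Sum.elim_inl, Sum.elim_inr] <;> fun_prop

theorem charFun_correlatedPair {ρ : ℝ} (hρ : |ρ| ≤ 1) (w : EuclideanSpace ℝ (Fin k ⊕ Fin k)) :
    charFun ((gaussianPi (Fin k ⊕ Fin k)).map (correlatedPair ρ)) w =
      Complex.exp (-((∑ j, w (Sum.inl j) ^ 2 + 2 * ρ * ∑ j, w (Sum.inl j) * w (Sum.inr j) +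
        ∑ j, w (Sum.inr j) ^ 2 : ℝ)) / 2) := by
  have hσ : √(1 - ρ ^ 2) ^ 2 = 1 - ρ ^ 2 := Real.sq_sqrt (by
    nlinarith [sq_abs ρ, abs_nonneg ρ])
  rw [charFun_apply, integral_map (continuous_correlatedPair ρ).aemeasurable
    (Continuous.aestronglyMeasurable (by fun_prop))]
  let u : Fin k ⊕ Fin k → ℝ := Sum.elim (fun j => w (Sum.inl j) + ρ * w (Sum.inr j))
    fun j => √(1 - ρ ^ 2) * w (Sum.inr j)
  have h1 : ∀ z, inner ℝ (correlatedPair ρ z) w = u ⬝ᵥ z := fun z => by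
    simp only [correlatedPair, PiLp.inner_apply, Fintype.sum_sum_type, dotProduct, u,
      Sum.elim_inl, Sum.elim_inr, RCLike.inner_apply, conj_trivial, ← Finset.sum_add_distrib]
    exact Finset.sum_congr rfl fun j _ => by ring
  simp only [h1]
  rw [integral_cexp_gaussianPi]
  congr 4
  simp only [Fintype.sum_sum_type, dotProduct, u, Sum.elim_inl, Sum.elim_inr, Finset.mul_sum,
    ← Finset.sum_add_distrib]
  refine Finset.sum_congr rfl fun j _ => ?_
  linear_combination (w (Sum.inr j)) ^ 2 * hσ

end Pair

variable {p k q m : ℕ} {M : Model p k q} {Ω : Type*} [MeasurableSpace Ω] {P : Measure Ω}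
  {A : Analyst M} {E : Imputation M m Ω P} {ψlim : Param k q}
  {iFull : Matrix (Fin k ⊕ Fin q) (Fin k ⊕ Fin q) ℝ} {iMis : Matrix (Fin k) (Fin k) ℝ}
  {H : Fin A.dim → ℝ}

/-- The contrasts of the noises belonging to two pairs, in the coordinates `Oᵀ`. -/
noncomputable def noisePair (A : Analyst M) (E : Imputation M m Ω P)
    (O : Matrix (Fin k) (Fin k) ℝ) (Q Q' : Finset (Fin m) × Finset (Fin m)) (n : ℕ) (ω : Ω) :
    EuclideanSpace ℝ (Fin k ⊕ Fin k) :=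
  WithLp.toLp 2 (Sum.elim (Oᵀ *ᵥ ∑ ℓ, contrast Q ℓ • noise A E n ℓ ω)
    (Oᵀ *ᵥ ∑ ℓ, contrast Q' ℓ • noise A E n ℓ ω))

theorem measurable_noisePair {t : Test} (hM : MeasurableStatistics A E t)
    (O : Matrix (Fin k) (Fin k) ℝ) (Q Q' : Finset (Fin m) × Finset (Fin m)) (n : ℕ) :
    Measurable (noisePair A E O Q Q' n) := by
  have h1 : ∀ Q : Finset (Fin m) × Finset (Fin m),
      Measurable fun ω => Oᵀ *ᵥ ∑ ℓ, contrast Q ℓ • noise A E n ℓ ω := fun Q =>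
    (Continuous.measurable (by fun_prop : Continuous fun x : Fin k → ℝ => Oᵀ *ᵥ x)).comp
      (Finset.measurable_sum _ fun ℓ _ => (measurable_noise hM n ℓ).const_smul (contrast Q ℓ))
  refine (PiLp.continuous_toLp 2 _).measurable.comp (measurable_pi_iff.2 fun a => ?_)
  rcases a with j | j
  · exact (measurable_pi_apply j).comp (h1 Q)
  · exact (measurable_pi_apply j).comp (h1 Q')

/-- By Lévy's continuity theorem it suffices to compare characteristic functions. A frequency `w`
for the two contrasts is the frequency `u ℓ` for the single noises; since `O` preserves inner
products, `∑ ℓ, u ℓ ⬝ᵥ u ℓ` involves the contrasts only through their Gram matrix. -/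
theorem tendstoInDistribution_noisePair [StandardBorelSpace Ω] [IsProbabilityMeasure P] {t : Test}
    (hM : MeasurableStatistics A E t) (hP : ProperImputation A E)
    {O : Matrix (Fin k) (Fin k) ℝ} (hO : Oᵀ * O = 1) {Q Q' : Finset (Fin m) × Finset (Fin m)}
    (hQ : Q ∈ pairs m) (hQ' : Q' ∈ pairs m) :
    TendstoInDistribution (noisePair A E O Q Q') atTop (correlatedPair (rho Q Q')) (fun _ => P)
      (gaussianPi (Fin k ⊕ Fin k)) where
  forall_aemeasurable n := (measurable_noisePair hM O Q Q' n).aemeasurable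
  aemeasurable_limit := (continuous_correlatedPair _).aemeasurable
  tendsto := by
    refine ProbabilityMeasure.tendsto_iff_tendsto_charFun.2 fun w => ?_
    change Tendsto (fun n => charFun (P.map (noisePair A E O Q Q' n)) w) atTop
      (𝓝 (charFun ((gaussianPi (Fin k ⊕ Fin k)).map (correlatedPair (rho Q Q'))) w))
    rw [charFun_correlatedPair (abs_rho_le_one hQ hQ')]
    let w₁ : Fin k → ℝ := fun j => w (Sum.inl j)
    let w₂ : Fin k → ℝ := fun j => w (Sum.inr j)
    let u : Fin m → Fin k → ℝ := fun ℓ => contrast Q ℓ • O *ᵥ w₁ + contrast Q' ℓ • O *ᵥ w₂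
    have hiso : ∀ x y : Fin k → ℝ, (O *ᵥ x) ⬝ᵥ (O *ᵥ y) = x ⬝ᵥ y := fun x y => by
      rw [Matrix.dotProduct_mulVec, ← Matrix.mulVec_transpose, Matrix.mulVec_mulVec, hO,
        Matrix.one_mulVec]
    have hu : ∑ ℓ, u ℓ ⬝ᵥ u ℓ = ∑ j, w (Sum.inl j) ^ 2 +
        2 * rho Q Q' * ∑ j, w (Sum.inl j) * w (Sum.inr j) + ∑ j, w (Sum.inr j) ^ 2 := by
      have e1 : ∀ ℓ, u ℓ ⬝ᵥ u ℓ = (contrast Q ℓ * contrast Q ℓ) * (w₁ ⬝ᵥ w₁) +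
          2 * (contrast Q ℓ * contrast Q' ℓ) * (w₁ ⬝ᵥ w₂) +
          (contrast Q' ℓ * contrast Q' ℓ) * (w₂ ⬝ᵥ w₂) := fun ℓ => by
        simp only [u, add_dotProduct, dotProduct_add, smul_dotProduct, dotProduct_smul, hiso,
          smul_eq_mul, dotProduct_comm w₂ w₁]
        ring
      simp only [e1, Finset.sum_add_distrib, ← Finset.sum_mul, ← Finset.mul_sum,
        sum_contrast_mul, rho_self hQ,
        rho_self hQ', one_mul]
      simp only [dotProduct, w₁, w₂, pow_two]
    have hlim := tendsto_integral_prod_cexp_noise hM hP u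
    rw [hu] at hlim
    refine hlim.congr fun n => ?_
    rw [charFun_apply, integral_map (measurable_noisePair hM O Q Q' n).aemeasurable
      (Continuous.aestronglyMeasurable (by fun_prop))]
    refine integral_congr_ae (Eventually.of_forall fun ω => ?_)
    have e2 : inner ℝ (noisePair A E O Q Q' n ω) w = ∑ ℓ, u ℓ ⬝ᵥ noise A E n ℓ ω := by
      have e3 : ∀ (x y : Fin k → ℝ), ∑ j, (Oᵀ *ᵥ x) j * y j = x ⬝ᵥ (O *ᵥ y) := fun x y => by
        rw [Matrix.dotProduct_mulVec, ← Matrix.mulVec_transpose, dotProduct]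
      simp only [noisePair, PiLp.inner_apply, Fintype.sum_sum_type, Sum.elim_inl, Sum.elim_inr,
        RCLike.inner_apply, conj_trivial]
      simp only [mul_comm (w _)]
      rw [e3 _ w₁, e3 _ w₂, sum_dotProduct, sum_dotProduct, ← Finset.sum_add_distrib]
      refine Finset.sum_congr rfl fun ℓ _ => ?_
      simp only [u, add_dotProduct, smul_dotProduct, dotProduct_comm (noise A E n ℓ ω)]
    simp only [e2, Complex.ofReal_sum, Finset.sum_mul, Complex.exp_sum]

theorem measurable_THat {t : Test} (hM : MeasurableStatistics A E t) (n : ℕ)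
    {Q : Finset (Fin m) × Finset (Fin m)} (hQ : Q ∈ pairs m) : Measurable (E.THat A t n Q) := by
  obtain ⟨h1, h2⟩ := card_pos_of_mem_pairs hQ
  have n1 : Q.1.val ≠ 0 := fun h0 => by simp [Finset.card, h0] at h1
  have n2 : Q.2.val ≠ 0 := fun h0 => by simp [Finset.card, h0] at h2
  have n3 : Q.1.val + Q.2.val ≠ 0 := fun h0 => n1 (by simpa using (add_eq_zero.1 h0).1)
  exact ((((hM.d n _ n1).const_mul _).add ((hM.d n _ n2).const_mul _)).sub
    ((hM.d n _ n3).const_mul _)).const_mul _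

/-- Joint limit of the statistics of two pairs. -/
theorem tendstoInDistribution_THat [StandardBorelSpace Ω] [IsProbabilityMeasure P] {t : Test}
    (hM : MeasurableStatistics A E t) (hR : Regular A E ψlim iFull iMis H)
    (hLA : LocalAlternative E) (hP : ProperImputation A E) {r : Fin k → ℝ}
    (hr : IsOMI iFull.toBlocks₁₁ iMis r) {Q Q' : Finset (Fin m) × Finset (Fin m)}
    (hQ : Q ∈ pairs m) (hQ' : Q' ∈ pairs m) :
    TendstoInDistribution (fun n ω => (E.THat A t n Q ω, E.THat A t n Q' ω)) atTop
      (fun z : Fin k ⊕ Fin k → ℝ => (∑ j, r j * z (Sum.inl j) ^ 2,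
        ∑ j, r j * (rho Q Q' * z (Sum.inl j) + √(1 - rho Q Q' ^ 2) * z (Sum.inr j)) ^ 2))
      (fun _ => P) (gaussianPi (Fin k ⊕ Fin k)) := by
  obtain ⟨O, hO, hO', hquad⟩ := exists_orthogonal_limit hR hr
  obtain ⟨ℓ, -⟩ := (Finset.mem_filter.1 hQ).2.1
  -- The profile information of `θ` reduces to `i_com`, the matrix that determines `r` together with
  -- `B`.
  have hW : ((iFull⁻¹).toBlocks₁₁)⁻¹ = iFull.toBlocks₁₁ := by
    rw [toBlocks₁₁_inv hM hR hP ℓ, Matrix.nonsing_inv_nonsing_inv _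
      ((Matrix.isUnit_iff_isUnit_det _).1 (posDef_toBlocks₁₁ hR).isUnit)]
  have hS := tendsto_inv_invSqrt_Bmat hR hP ℓ
  set β := CFC.sqrt ((iFull.toBlocks₁₁ - iMis)⁻¹ - iFull.toBlocks₁₁⁻¹)
  set W := iFull.toBlocks₁₁
  let S : ℕ → Fin k → Fin k → ℝ := fun n => √(n : ℝ) • (invSqrt (E.Bmat n))⁻¹
  let f : (Fin k → ℝ) → (Fin k → Fin k → ℝ) → ℝ := fun y B => quad W (Matrix.of B *ᵥ O *ᵥ y)
  have hf : Continuous fun x : (Fin k → ℝ) × (Fin k → Fin k → ℝ) => f x.1 x.2 := by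
    have h1 : Continuous fun x : (Fin k → ℝ) × (Fin k → Fin k → ℝ) =>
        Matrix.of x.2 *ᵥ O *ᵥ x.1 :=
      Continuous.matrix_mulVec (A := fun x : (Fin k → ℝ) × (Fin k → Fin k → ℝ) =>
        Matrix.of x.2) continuous_snd (by fun_prop)
    exact continuous_quad.comp ((continuous_const (y := W)).prodMk h1)
  have hβ : ∀ y, f y β = ∑ j, r j * y j ^ 2 := fun y => by
    change quad W (β *ᵥ O *ᵥ y) = _
    rw [hquad, Matrix.mulVec_mulVec, hO', Matrix.one_mulVec]
  let g : EuclideanSpace ℝ (Fin k ⊕ Fin k) × (Fin k → Fin k → ℝ) → ℝ × ℝ := fun x =>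
    (f (fun j => x.1 (Sum.inl j)) x.2, f (fun j => x.1 (Sum.inr j)) x.2)
  have hg : Continuous g := by
    refine Continuous.prodMk ?_ ?_
    · exact hf.comp (Continuous.prodMk (by fun_prop) continuous_snd)
    · exact hf.comp (Continuous.prodMk (by fun_prop) continuous_snd)
  -- Slutsky's theorem: the deterministic factor `√n B^{1/2}` is the second argument of `g` and
  -- converges to `β`.
  have key := (tendstoInDistribution_noisePair hM hP hO' hQ hQ').continuous_comp_prodMk_of_tendstoInMeasure_const
    hg (Y := fun n _ => S n) (c := β) (tendsto_probFilter_iff.1 (hS.comp tendsto_fst_probFilter))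
    (fun n => aemeasurable_const)
  have hlim : (fun z => g (correlatedPair (rho Q Q') z, β)) = fun z : Fin k ⊕ Fin k → ℝ =>
      (∑ j, r j * z (Sum.inl j) ^ 2,
        ∑ j, r j * (rho Q Q' * z (Sum.inl j) + √(1 - rho Q Q' ^ 2) * z (Sum.inr j)) ^ 2) := by
    funext z
    simp only [g, hβ, correlatedPair, Sum.elim_inl, Sum.elim_inr]
  rw [hlim] at key
  refine tendstoInDistribution_of_tendstoInMeasure_sub _ _ key ?_
    fun n => ((measurable_THat hM n hQ).prodMk (measurable_THat hM n hQ')).aemeasurable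
  -- Undoing the rotation `O` and the standardization by `invSqrt` recovers the argument of the
  -- quadratic form in `tendsto_THat_sub`.
  have hsub : ∀ R ∈ pairs m, Tendsto (fun z : ℕ × Ω => E.THat A t z.1 R z.2 -
      f (Oᵀ *ᵥ ∑ ℓ, contrast R ℓ • noise A E z.1 ℓ z.2) (S z.1)) (probFilter P) (𝓝 0) :=
    fun R hQR => by
      have h1 := tendsto_THat_sub hR hLA t hQR
      rw [hW] at h1
      refine h1.congr' ?_
      filter_upwards [tendsto_fst_probFilter.eventually (eventually_invSqrt_Bmat hR hP ℓ)] with z hz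
      have h2 := (Matrix.isUnit_iff_isUnit_det _).1 hz.2.1
      congr 2
      change _ = (√(z.1 : ℝ) • (invSqrt (E.Bmat z.1))⁻¹) *ᵥ O *ᵥ _
      rw [Matrix.mulVec_mulVec _ O, hO, Matrix.one_mulVec, Matrix.smul_mulVec]
      simp only [noise, ← Matrix.mulVec_smul, ← Matrix.mulVec_sum]
      rw [Matrix.mulVec_mulVec, Matrix.nonsing_inv_mul _ h2, Matrix.one_mulVec]
  have := (hsub Q hQ).prodMk_nhds (hsub Q' hQ')
  exact tendsto_probFilter_iff.1 this

end StackedMI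

/-! ### Gaussian moments, and a second-order expansion of powers -/

namespace StackedMI

theorem integral_gaussianReal_sq : ∫ x, x ^ 2 ∂(gaussianReal 0 1) = 1 := by
  have h := variance_fun_id_gaussianReal (μ := 0) (v := 1)
  rw [variance_of_integral_eq_zero (by fun_prop) (by simp)] at h
  simpa using h

/-- This is the fourth derivative at zero of `exp (t ^ 2 / 2)`. Each differentiation replaces the
polynomial factor `a` by `a' + t a`. -/
theorem integral_gaussianReal_pow_four : ∫ x, x ^ 4 ∂(gaussianReal 0 1) = 3 := by
  have h1 : mgf id (gaussianReal 0 1) = fun t => Real.exp (t ^ 2 / 2) := by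
    rw [mgf_id_gaussianReal]
    simp
  have h2 : (0 : ℝ) ∈ interior (integrableExpSet id (gaussianReal 0 1)) := by
    simp
  have h3 := iteratedDeriv_mgf_zero h2 4
  have hd : ∀ (a b : ℝ → ℝ), (∀ t, HasDerivAt a (b t) t) →
      deriv (fun t => a t * Real.exp (t ^ 2 / 2)) =
        fun t => (b t + a t * t) * Real.exp (t ^ 2 / 2) := fun a b hab => by
    funext t
    have e : HasDerivAt (fun t : ℝ => Real.exp (t ^ 2 / 2)) (Real.exp (t ^ 2 / 2) * t) t := by
      have h4 : HasDerivAt (fun t : ℝ => t ^ 2 / 2) t t := by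
        simpa using (hasDerivAt_pow 2 t).div_const 2
      exact h4.exp
    have h5 : HasDerivAt (fun t => a t * Real.exp (t ^ 2 / 2)) _ t := (hab t).mul e
    rw [h5.deriv]
    ring
  rw [h1] at h3
  have d1 := hd (fun _ => 1) (fun _ => 0) fun t => hasDerivAt_const _ _
  have d2 := hd (fun t => t) (fun _ => 1) fun t => hasDerivAt_id t
  have d3 := hd (fun t => 1 + t ^ 2) (fun t => 2 * t) fun t => by
    simpa using (hasDerivAt_pow 2 t).const_add 1
  have d4 := hd (fun t => 3 * t + t ^ 3) (fun t => 3 + 3 * t ^ 2) fun t => by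
    have h4 : HasDerivAt (fun t : ℝ => 3 * t + t ^ 3) _ t :=
      ((hasDerivAt_id t).const_mul 3).add (hasDerivAt_pow 3 t)
    simpa using h4
  have e0 : (fun t : ℝ => Real.exp (t ^ 2 / 2)) = fun t => 1 * Real.exp (t ^ 2 / 2) := by simp
  rw [e0, iteratedDeriv_succ', d1] at h3
  simp only [zero_add, one_mul] at h3
  rw [iteratedDeriv_succ', d2, iteratedDeriv_succ'] at h3
  have e3 : (fun t : ℝ => (1 + t * t) * Real.exp (t ^ 2 / 2)) =
      fun t => (1 + t ^ 2) * Real.exp (t ^ 2 / 2) := by funext t; ring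
  rw [e3, d3, iteratedDeriv_succ'] at h3
  have e4 : (fun t : ℝ => (2 * t + (1 + t ^ 2) * t) * Real.exp (t ^ 2 / 2)) =
      fun t => (3 * t + t ^ 3) * Real.exp (t ^ 2 / 2) := by funext t; ring
  rw [e4, d4, iteratedDeriv_zero] at h3
  simpa using h3.symm

section Moments

variable {ι : Type*} [Fintype ι]

/-- Functions with moments of all orders under the standard normal law. -/
def AllMoments (f : (ι → ℝ) → ℝ) : Prop := ∀ p : ℝ≥0∞, p ≠ ∞ → MemLp f p (gaussianPi ι)

namespace AllMoments

variable {f g : (ι → ℝ) → ℝ}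

theorem coord (i : ι) : AllMoments fun z : ι → ℝ => z i := fun p hp =>
  (memLp_id_gaussianReal' p hp).comp_measurePreserving
    (measurePreserving_eval (fun _ : ι => gaussianReal 0 1) i)

theorem const (c : ℝ) : AllMoments fun _ : ι → ℝ => c := fun _ _ => memLp_const c

theorem add (hf : AllMoments f) (hg : AllMoments g) : AllMoments fun z => f z + g z :=
  fun p hp => (hf p hp).add (hg p hp)

/-- A product is in `L^p` as soon as both factors are in `L^{2p}`, which is why all finite orders
are required at once. -/
theorem mul (hf : AllMoments f) (hg : AllMoments g) : AllMoments fun z => f z * g z :=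
  fun p hp => by
    have h2 : p * 2 ≠ ∞ := ENNReal.mul_ne_top hp (by simp)
    have : ENNReal.HolderTriple (p * 2) (p * 2) p := ⟨by
      rw [← two_mul, ENNReal.mul_inv (by simp) (by simp), mul_comm, mul_assoc,
        ENNReal.inv_mul_cancel (by simp) (by simp), mul_one]⟩
    exact MemLp.mul' (hg _ h2) (hf _ h2)

theorem abs (hf : AllMoments f) : AllMoments fun z => |f z| := fun p hp => (hf p hp).norm

theorem pow (hf : AllMoments f) (n : ℕ) : AllMoments fun z => f z ^ n := by
  induction n with
  | zero => simpa using const 1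
  | succ n ih => simpa only [pow_succ] using ih.mul hf

theorem sum {κ : Type*} (s : Finset κ) {F : κ → (ι → ℝ) → ℝ} (h : ∀ a ∈ s, AllMoments (F a)) :
    AllMoments fun z => ∑ a ∈ s, F a z := fun p hp => memLp_finsetSum s fun a ha => h a ha p hp

theorem integrable (hf : AllMoments f) : Integrable f (gaussianPi ι) :=
  memLp_one_iff_integrable.1 (hf 1 (by simp))

end AllMoments

end Moments

/-- A crude Taylor remainder; what matters is the factor `b ^ 2`, which produces `ρ ^ 2` when `b` is
proportional to `ρ`. -/
theorem abs_add_pow_sub_le (a b : ℝ) (n : ℕ) :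
    |(a + b) ^ n - a ^ n - n * a ^ (n - 1) * b| ≤ n ^ 2 * b ^ 2 * (1 + |a| + |b|) ^ n := by
  have hS : 1 ≤ 1 + |a| + |b| := by linarith [abs_nonneg a, abs_nonneg b]
  induction n with
  | zero => simp
  | succ n ih =>
    have e : (a + b) ^ (n + 1) - a ^ (n + 1) - ((n + 1 : ℕ) : ℝ) * a ^ (n + 1 - 1) * b =
        (a + b) * ((a + b) ^ n - a ^ n - n * a ^ (n - 1) * b) + n * a ^ (n - 1) * b ^ 2 := by
      rcases n with _ | n
      · simp
      · push_cast
        ring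
    rw [e]
    have h1 : |a + b| ≤ 1 + |a| + |b| := (abs_add_le a b).trans (by linarith)
    have h2 : |a| ^ (n - 1) ≤ (1 + |a| + |b|) ^ (n + 1) :=
      (pow_le_pow_left₀ (abs_nonneg a) (by linarith [abs_nonneg b]) _).trans
        (pow_le_pow_right₀ hS (by omega))
    calc |(a + b) * ((a + b) ^ n - a ^ n - n * a ^ (n - 1) * b) + n * a ^ (n - 1) * b ^ 2|
        ≤ |a + b| * |(a + b) ^ n - a ^ n - n * a ^ (n - 1) * b| +
          n * |a| ^ (n - 1) * b ^ 2 := by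
          refine (abs_add_le _ _).trans (le_of_eq ?_)
          rw [abs_mul, abs_mul, abs_mul, abs_pow, abs_pow, sq_abs, Nat.abs_cast]
      _ ≤ (1 + |a| + |b|) * (n ^ 2 * b ^ 2 * (1 + |a| + |b|) ^ n) +
          n * (1 + |a| + |b|) ^ (n + 1) * b ^ 2 := by
          gcongr
      _ ≤ ((n + 1 : ℕ) : ℝ) ^ 2 * b ^ 2 * (1 + |a| + |b|) ^ (n + 1) := by
          have h3 : 0 ≤ b ^ 2 * (1 + |a| + |b|) ^ (n + 1) := by positivity
          have h4 : (0 : ℝ) ≤ n := n.cast_nonneg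
          push_cast
          rw [pow_succ (1 + |a| + |b|) n] at *
          nlinarith

end StackedMI

/-! ### Covariance of powers of correlated weighted chi-squares -/

namespace StackedMI

theorem integral_gaussianPi_sum {ι κ : Type*} [Fintype ι] [Fintype κ] (f : (ι → ℝ) → ℝ)
    (g : (κ → ℝ) → ℝ) :
    ∫ z, f (fun i => z (Sum.inl i)) * g (fun j => z (Sum.inr j)) ∂(gaussianPi (ι ⊕ κ)) =
      (∫ x, f x ∂(gaussianPi ι)) * ∫ y, g y ∂(gaussianPi κ) := by
  have h := measurePreserving_sumPiEquivProdPi (X := fun _ : ι ⊕ κ => ℝ)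
    (fun _ => gaussianReal 0 1)
  rw [← integral_prod_mul]
  exact h.integral_comp' (fun x : (ι → ℝ) × (κ → ℝ) => f x.1 * g x.2)

/-- Changing the sign of the first block of coordinates preserves the Gaussian law, so the integral
equals its own negative. -/
theorem integral_gaussianPi_eq_zero_of_odd {ι κ : Type*} [Fintype ι] [Fintype κ]
    {f : (ι ⊕ κ → ℝ) → ℝ} (hf : Continuous f)
    (hodd : ∀ z, f (fun a => Sum.elim (fun i => -z (Sum.inl i)) (fun j => z (Sum.inr j)) a) =
      -f z) : ∫ z, f z ∂(gaussianPi (ι ⊕ κ)) = 0 := by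
  let s : ι ⊕ κ → ℝ → ℝ := Sum.elim (fun _ x => -x) fun _ x => x
  have hs : ∀ a, MeasurePreserving (s a) (gaussianReal 0 1) (gaussianReal 0 1) := by
    rintro (i | j)
    · refine ⟨measurable_neg, ?_⟩
      have := gaussianReal_map_neg (μ := 0) (v := 1)
      rwa [neg_zero] at this
    · exact MeasurePreserving.id _
  have hp : MeasurePreserving (fun (z : ι ⊕ κ → ℝ) a => s a (z a)) (gaussianPi (ι ⊕ κ))
      (gaussianPi (ι ⊕ κ)) := measurePreserving_pi _ _ hs
  have h1 : ∫ z, f z ∂(gaussianPi (ι ⊕ κ)) = ∫ z, -f z ∂(gaussianPi (ι ⊕ κ)) := by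
    conv_lhs => rw [← hp.map_eq]
    rw [integral_map hp.measurable.aemeasurable hf.aestronglyMeasurable]
    refine integral_congr_ae (Eventually.of_forall fun z => ?_)
    simp only
    rw [← hodd z]
    congr 1
    funext a
    rcases a with i | j <;> rfl
  rw [integral_neg] at h1
  linarith

theorem integral_sq_mul_sq {ι : Type*} [Fintype ι] [DecidableEq ι] (i j : ι) :
    ∫ z, z i ^ 2 * z j ^ 2 ∂(gaussianPi ι) = if i = j then 3 else 1 := by
  by_cases h : i = j
  · subst h
    rw [if_pos rfl, ← integral_gaussianReal_pow_four]
    have hp := measurePreserving_eval (fun _ : ι => gaussianReal 0 1) i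
    rw [← hp.map_eq, integral_map hp.measurable.aemeasurable
      (Continuous.aestronglyMeasurable (by fun_prop))]
    refine integral_congr_ae (Eventually.of_forall fun z => ?_)
    simp only [Function.eval]
    ring
  · rw [if_neg h]
    have e : ∀ z : ι → ℝ, z i ^ 2 * z j ^ 2 =
        ∏ a, (fun (a : ι) (x : ℝ) => if a = i ∨ a = j then x ^ 2 else 1) a (z a) := fun z => by
      rw [Finset.prod_eq_mul (a := i) (b := j) h]
      · simp
      · intro c _ hc
        simp [hc.1, hc.2]
      · simp
      · simp
    rw [gaussianPi, integral_congr_ae (Eventually.of_forall e),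
      integral_fintype_prod_eq_prod (𝕜 := ℝ)
        (fun (a : ι) (x : ℝ) => if a = i ∨ a = j then x ^ 2 else 1)]
    refine Finset.prod_eq_one fun a _ => ?_
    split_ifs
    · exact integral_gaussianReal_sq
    · simp

section PairMoment

variable {k : ℕ}

/-- `E(T^τ T'^τ)` for weighted chi-squares `T`, `T'` built from standard normal vectors with
cross-correlation `ρ`. -/
noncomputable def pairMoment (r : Fin k → ℝ) (τ : ℕ) (ρ : ℝ) : ℝ :=
  ∫ z : Fin k ⊕ Fin k → ℝ, (∑ j, r j * z (Sum.inl j) ^ 2) ^ τ *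
    (∑ j, r j * (ρ * z (Sum.inl j) + √(1 - ρ ^ 2) * z (Sum.inr j)) ^ 2) ^ τ
    ∂(gaussianPi (Fin k ⊕ Fin k))

/-- The second factor is expanded around `σ ^ 2 * y` with increment `ρ * w`. The first-order term in
`b`, which is later integrated to zero, is subtracted; every other deviation from `x ^ n * y ^ n`
carries a factor `ρ ^ 2`, with a cofactor free of `ρ`. -/
theorem pow_mul_pow_sub_le (x y b ρ σ : ℝ) (hρ : |ρ| ≤ 1) (hσ : σ ^ 2 = 1 - ρ ^ 2) (n : ℕ) :
    |x ^ n * (ρ ^ 2 * x + 2 * ρ * σ * b + σ ^ 2 * y) ^ n - x ^ n * y ^ n -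
      2 * ρ * σ * n * (σ ^ 2) ^ (n - 1) * (x ^ n * y ^ (n - 1) * b)| ≤
      ρ ^ 2 * (|x| ^ n * (n ^ 2 * (|x| + 2 * |b|) ^ 2 * (1 + |y| + (|x| + 2 * |b|)) ^ n +
        n * |y| ^ n + n * |y| ^ (n - 1) * |x|)) := by
  have hρ2 : ρ ^ 2 ≤ 1 := by
    rw [← sq_abs]; nlinarith [abs_nonneg ρ]
  have hσ0 : 0 ≤ σ ^ 2 := sq_nonneg σ
  have hσ2 : σ ^ 2 ≤ 1 := by nlinarith [sq_nonneg ρ]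
  have hσ1 : |σ| ≤ 1 := by rwa [← sq_le_one_iff_abs_le_one]
  set w := ρ * x + 2 * σ * b with hw
  have hwb : |w| ≤ |x| + 2 * |b| := by
    refine (abs_add_le _ _).trans ?_
    rw [abs_mul, abs_mul, abs_mul, abs_two]
    have := mul_le_mul_of_nonneg_right hρ (abs_nonneg x)
    have := mul_le_mul_of_nonneg_right hσ1 (abs_nonneg b)
    linarith
  have hexp := abs_add_pow_sub_le (σ ^ 2 * y) (ρ * w) n
  set e := (σ ^ 2 * y + ρ * w) ^ n - (σ ^ 2 * y) ^ n - n * (σ ^ 2 * y) ^ (n - 1) * (ρ * w)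
  have he : |e| ≤ ρ ^ 2 * (n ^ 2 * (|x| + 2 * |b|) ^ 2 * (1 + |y| + (|x| + 2 * |b|)) ^ n) := by
    have h1 : |σ ^ 2 * y| ≤ |y| := by
      rw [abs_mul, abs_of_nonneg hσ0]
      exact mul_le_of_le_one_left (abs_nonneg y) hσ2
    have h2 : |ρ * w| ≤ |x| + 2 * |b| := by
      rw [abs_mul]
      exact (mul_le_of_le_one_left (abs_nonneg w) hρ).trans hwb
    have h3 : w ^ 2 ≤ (|x| + 2 * |b|) ^ 2 := by
      rw [← sq_abs w]
      exact pow_le_pow_left₀ (abs_nonneg w) hwb 2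
    calc |e| ≤ n ^ 2 * (ρ * w) ^ 2 * (1 + |σ ^ 2 * y| + |ρ * w|) ^ n := hexp
      _ = ρ ^ 2 * (n ^ 2 * w ^ 2 * (1 + |σ ^ 2 * y| + |ρ * w|) ^ n) := by ring
      _ ≤ _ := by gcongr
  -- Bernoulli's inequality, with `σ ^ 2 = 1 - ρ ^ 2`.
  have hσn : |(σ ^ 2) ^ n - 1| ≤ ρ ^ 2 * n := by
    have h1 : (σ ^ 2) ^ n ≤ 1 := pow_le_one₀ hσ0 hσ2
    have h2 := one_add_mul_le_pow (a := -ρ ^ 2) (by linarith) n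
    rw [abs_sub_comm, abs_of_nonneg (by linarith), hσ]
    have h3 : 1 + -ρ ^ 2 = 1 - ρ ^ 2 := by ring
    rw [h3] at h2
    linarith
  have hkey : x ^ n * (ρ ^ 2 * x + 2 * ρ * σ * b + σ ^ 2 * y) ^ n - x ^ n * y ^ n -
      2 * ρ * σ * n * (σ ^ 2) ^ (n - 1) * (x ^ n * y ^ (n - 1) * b) =
      x ^ n * (e + ((σ ^ 2) ^ n - 1) * y ^ n +
        ρ ^ 2 * (n * (σ ^ 2) ^ (n - 1) * y ^ (n - 1) * x)) := by
    have h1 : ρ ^ 2 * x + 2 * ρ * σ * b + σ ^ 2 * y = σ ^ 2 * y + ρ * w := by rw [hw]; ring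
    have h2 : (σ ^ 2 * y + ρ * w) ^ n =
        e + (σ ^ 2 * y) ^ n + n * (σ ^ 2 * y) ^ (n - 1) * (ρ * w) := by ring
    rw [h1, h2, mul_pow, mul_pow, hw]
    ring
  rw [hkey, abs_mul, abs_pow]
  have h5 : |((σ ^ 2) ^ n - 1) * y ^ n| ≤ ρ ^ 2 * (n * |y| ^ n) := by
    rw [abs_mul, abs_pow, ← mul_assoc]
    gcongr
  have h6 : |ρ ^ 2 * (n * (σ ^ 2) ^ (n - 1) * y ^ (n - 1) * x)| ≤
      ρ ^ 2 * (n * |y| ^ (n - 1) * |x|) := by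
    rw [abs_mul, abs_mul, abs_mul, abs_mul, abs_of_nonneg (sq_nonneg ρ),
      Nat.abs_cast, abs_pow (σ ^ 2), abs_of_nonneg hσ0, abs_pow y]
    have : (σ ^ 2) ^ (n - 1) ≤ 1 := pow_le_one₀ hσ0 hσ2
    gcongr
    exact mul_le_of_le_one_right n.cast_nonneg this
  calc |x| ^ n * |e + ((σ ^ 2) ^ n - 1) * y ^ n +
        ρ ^ 2 * (n * (σ ^ 2) ^ (n - 1) * y ^ (n - 1) * x)|
      ≤ |x| ^ n * (ρ ^ 2 * (n ^ 2 * (|x| + 2 * |b|) ^ 2 * (1 + |y| + (|x| + 2 * |b|)) ^ n) +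
        ρ ^ 2 * (n * |y| ^ n) + ρ ^ 2 * (n * |y| ^ (n - 1) * |x|)) := by
        refine mul_le_mul_of_nonneg_left ?_ (by positivity)
        exact (abs_add_three _ _ _).trans (add_le_add (add_le_add he h5) h6)
    _ = _ := by ring

theorem quadratic_correlated (r : Fin k → ℝ) (ρ σ : ℝ) (z : Fin k ⊕ Fin k → ℝ) :
    ∑ j, r j * (ρ * z (Sum.inl j) + σ * z (Sum.inr j)) ^ 2 =
      ρ ^ 2 * ∑ j, r j * z (Sum.inl j) ^ 2 +
        2 * ρ * σ * ∑ j, r j * (z (Sum.inl j) * z (Sum.inr j)) +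
        σ ^ 2 * ∑ j, r j * z (Sum.inr j) ^ 2 := by
  simp only [Finset.mul_sum, ← Finset.sum_add_distrib]
  exact Finset.sum_congr rfl fun j _ => by ring

theorem allMoments_quadratic {ι κ : Type*} [Fintype ι] [Fintype κ] (r : κ → ℝ) (a b : κ → ι) :
    AllMoments fun z : ι → ℝ => ∑ j, r j * (z (a j) * z (b j)) :=
  .sum _ fun j _ => (AllMoments.const (r j)).mul ((AllMoments.coord _).mul (AllMoments.coord _))

theorem integral_pow_mul_pow (r : Fin k → ℝ) (τ τ' : ℕ) :
    ∫ z : Fin k ⊕ Fin k → ℝ, (∑ j, r j * z (Sum.inl j) ^ 2) ^ τ *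
      (∑ j, r j * z (Sum.inr j) ^ 2) ^ τ' ∂(gaussianPi (Fin k ⊕ Fin k)) =
      tMoment r τ * tMoment r τ' :=
  integral_gaussianPi_sum (fun x : Fin k → ℝ => (∑ j, r j * x j ^ 2) ^ τ)
    fun y : Fin k → ℝ => (∑ j, r j * y j ^ 2) ^ τ'

/-- Source of the factor `ρ ^ 2` in the variance formula. The mixed form `B` changes sign with the
first block while `X` and `Y` do not, so the term linear in `B` has mean zero; the rest is dominated
by `ρ ^ 2 * D` with `D` integrable and independent of `ρ`. -/
theorem exists_abs_pairMoment_sub_le (r : Fin k → ℝ) (τ : ℕ) :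
    ∃ K, ∀ ρ, |ρ| ≤ 1 → |pairMoment r τ ρ - tMoment r τ ^ 2| ≤ ρ ^ 2 * K := by
  let X : (Fin k ⊕ Fin k → ℝ) → ℝ := fun z => ∑ j, r j * z (Sum.inl j) ^ 2
  let Y : (Fin k ⊕ Fin k → ℝ) → ℝ := fun z => ∑ j, r j * z (Sum.inr j) ^ 2
  let B : (Fin k ⊕ Fin k → ℝ) → ℝ := fun z => ∑ j, r j * (z (Sum.inl j) * z (Sum.inr j))
  have hX : AllMoments X := by
    simpa only [← pow_two] using allMoments_quadratic r Sum.inl Sum.inl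
  have hY : AllMoments Y := by
    simpa only [← pow_two] using allMoments_quadratic r Sum.inr Sum.inr
  have hB : AllMoments B := allMoments_quadratic r Sum.inl Sum.inr
  let D : (Fin k ⊕ Fin k → ℝ) → ℝ := fun z => |X z| ^ τ *
    (τ ^ 2 * (|X z| + 2 * |B z|) ^ 2 * (1 + |Y z| + (|X z| + 2 * |B z|)) ^ τ +
      τ * |Y z| ^ τ + τ * |Y z| ^ (τ - 1) * |X z|)
  have hw : AllMoments fun z => |X z| + 2 * |B z| := hX.abs.add ((AllMoments.const 2).mul hB.abs)
  have hD : AllMoments D := (hX.abs.pow τ).mul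
    (((((AllMoments.const _).mul (hw.pow 2)).mul
      ((((AllMoments.const 1).add hY.abs).add hw).pow τ)).add
      ((AllMoments.const _).mul (hY.abs.pow τ))).add
      (((AllMoments.const _).mul (hY.abs.pow _)).mul hX.abs))
  refine ⟨∫ z, D z ∂(gaussianPi (Fin k ⊕ Fin k)), fun ρ hρ => ?_⟩
  set σ := √(1 - ρ ^ 2) with hσ
  have hσ2 : σ ^ 2 = 1 - ρ ^ 2 := Real.sq_sqrt (by nlinarith [sq_abs ρ, abs_nonneg ρ])
  have i1 : AllMoments fun z => X z ^ τ * (ρ ^ 2 * X z + 2 * ρ * σ * B z + σ ^ 2 * Y z) ^ τ :=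
    (hX.pow τ).mul (((((AllMoments.const _).mul hX).add ((AllMoments.const _).mul hB)).add
      ((AllMoments.const _).mul hY)).pow τ)
  have i2 : AllMoments fun z => X z ^ τ * Y z ^ τ := (hX.pow τ).mul (hY.pow τ)
  have i3 : AllMoments fun z => X z ^ τ * Y z ^ (τ - 1) * B z :=
    ((hX.pow τ).mul (hY.pow _)).mul hB
  have h0 : ∫ z, X z ^ τ * Y z ^ (τ - 1) * B z ∂(gaussianPi (Fin k ⊕ Fin k)) = 0 := by
    refine integral_gaussianPi_eq_zero_of_odd (by fun_prop) fun z => ?_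
    simp only [X, Y, B, Sum.elim_inl, Sum.elim_inr, neg_sq, neg_mul, mul_neg,
      Finset.sum_neg_distrib]
  have i12 : Integrable (fun z => X z ^ τ * (ρ ^ 2 * X z + 2 * ρ * σ * B z + σ ^ 2 * Y z) ^ τ -
      X z ^ τ * Y z ^ τ) (gaussianPi (Fin k ⊕ Fin k)) := i1.integrable.sub i2.integrable
  have h1 : pairMoment r τ ρ - tMoment r τ ^ 2 = ∫ z, (X z ^ τ * (ρ ^ 2 * X z + 2 * ρ * σ * B z +
      σ ^ 2 * Y z) ^ τ - X z ^ τ * Y z ^ τ - 2 * ρ * σ * τ * (σ ^ 2) ^ (τ - 1) *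
        (X z ^ τ * Y z ^ (τ - 1) * B z)) ∂(gaussianPi (Fin k ⊕ Fin k)) := by
    rw [integral_sub i12 (i3.integrable.const_mul _),
      integral_sub i1.integrable i2.integrable, integral_const_mul, h0, mul_zero, sub_zero,
      pow_two (tMoment r τ), ← integral_pow_mul_pow]
    simp only [pairMoment, quadratic_correlated, X, Y, B, hσ]
  rw [h1, ← integral_const_mul]
  refine abs_integral_le_integral_abs.trans (integral_mono ?_ ?_ fun z => ?_)
  · exact (i12.sub (i3.integrable.const_mul _)).abs
  · exact hD.integrable.const_mul _
  · exact pow_mul_pow_sub_le (X z) (Y z) (B z) ρ σ hρ hσ2 τ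

theorem tMoment_one (r : Fin k → ℝ) : tMoment r 1 = ∑ j, r j := by
  have h : ∀ j : Fin k, ∫ z, z j ^ 2 ∂(gaussianPi (Fin k)) = 1 := fun j => by
    have hp := measurePreserving_eval (fun _ : Fin k => gaussianReal 0 1) j
    rw [← integral_gaussianReal_sq, ← hp.map_eq, integral_map hp.measurable.aemeasurable
      (Continuous.aestronglyMeasurable (by fun_prop))]
    rfl
  change ∫ z, (∑ j, r j * z j ^ 2) ^ 1 ∂(gaussianPi (Fin k)) = _
  simp only [pow_one]
  rw [integral_finsetSum _ fun j _ =>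
    ((AllMoments.const (r j)).mul ((AllMoments.coord j).pow 2)).integrable]
  simp only [integral_const_mul, h, mul_one]

theorem tMoment_two (r : Fin k → ℝ) : tMoment r 2 = (∑ j, r j) ^ 2 + 2 * powerSum r 2 := by
  change ∫ z, (∑ j, r j * z j ^ 2) ^ 2 ∂(gaussianPi (Fin k)) = _
  have e : ∀ z : Fin k → ℝ, (∑ j, r j * z j ^ 2) ^ 2 =
      ∑ i, ∑ j, r i * r j * (z i ^ 2 * z j ^ 2) := fun z => by
    rw [pow_two, Finset.sum_mul_sum]
    exact Finset.sum_congr rfl fun i _ => Finset.sum_congr rfl fun j _ => by ring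
  have hi : ∀ i j : Fin k, AllMoments fun z : Fin k → ℝ => r i * r j * (z i ^ 2 * z j ^ 2) :=
    fun i j => (AllMoments.const _).mul (((AllMoments.coord i).pow 2).mul
      ((AllMoments.coord j).pow 2))
  simp only [e]
  rw [integral_finsetSum _ fun i _ => (AllMoments.sum _ fun j _ => hi i j).integrable]
  have h : ∀ i, ∫ z, ∑ j, r i * r j * (z i ^ 2 * z j ^ 2) ∂(gaussianPi (Fin k)) =
      r i * (∑ j, r j) + 2 * r i ^ 2 := fun i => by
    rw [integral_finsetSum _ fun j _ => (hi i j).integrable]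
    simp only [integral_const_mul, integral_sq_mul_sq]
    have : ∀ j, r i * r j * (if i = j then (3 : ℝ) else 1) =
        r i * r j + if i = j then 2 * r i ^ 2 else 0 := fun j => by
      split_ifs with hij
      · subst hij; ring
      · ring
    simp only [this, Finset.sum_add_distrib, Finset.sum_ite_eq, Finset.mem_univ, if_true,
      Finset.mul_sum]
  simp only [h, Finset.sum_add_distrib, ← Finset.sum_mul, ← Finset.mul_sum, powerSum]
  ring

/-- Here the expansion is exact: `E(T T') = ρ² E(T²) + (1 - ρ²) (E T)²`, so the covariance is `ρ²`
times the variance `2 R₂` of `T`. -/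
theorem pairMoment_one (r : Fin k → ℝ) {ρ : ℝ} (hρ : |ρ| ≤ 1) :
    pairMoment r 1 ρ - tMoment r 1 ^ 2 = ρ ^ 2 * (2 * powerSum r 2) := by
  let X : (Fin k ⊕ Fin k → ℝ) → ℝ := fun z => ∑ j, r j * z (Sum.inl j) ^ 2
  let Y : (Fin k ⊕ Fin k → ℝ) → ℝ := fun z => ∑ j, r j * z (Sum.inr j) ^ 2
  let B : (Fin k ⊕ Fin k → ℝ) → ℝ := fun z => ∑ j, r j * (z (Sum.inl j) * z (Sum.inr j))
  have hX : AllMoments X := by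
    simpa only [← pow_two] using allMoments_quadratic r Sum.inl Sum.inl
  have hY : AllMoments Y := by
    simpa only [← pow_two] using allMoments_quadratic r Sum.inr Sum.inr
  have hB : AllMoments B := allMoments_quadratic r Sum.inl Sum.inr
  have hσ : √(1 - ρ ^ 2) ^ 2 = 1 - ρ ^ 2 :=
    Real.sq_sqrt (by nlinarith [sq_abs ρ, abs_nonneg ρ])
  have h0 : ∫ z, X z * B z ∂(gaussianPi (Fin k ⊕ Fin k)) = 0 := by
    refine integral_gaussianPi_eq_zero_of_odd (by fun_prop) fun z => ?_
    simp only [X, B, Sum.elim_inl, Sum.elim_inr, neg_sq, neg_mul, mul_neg,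
      Finset.sum_neg_distrib]
  have hXX : ∫ z, X z ^ 2 ∂(gaussianPi (Fin k ⊕ Fin k)) = tMoment r 2 := by
    have := integral_pow_mul_pow r 2 0
    have h1 : tMoment r 0 = 1 := by simp [tMoment]
    simpa only [pow_zero, mul_one, h1] using this
  have hXY : ∫ z, X z * Y z ∂(gaussianPi (Fin k ⊕ Fin k)) = tMoment r 1 ^ 2 := by
    have := integral_pow_mul_pow r 1 1
    simpa only [pow_one, ← pow_two] using this
  have h1 : pairMoment r 1 ρ = ∫ z, (ρ ^ 2 * X z ^ 2 +
      2 * ρ * √(1 - ρ ^ 2) * (X z * B z) + √(1 - ρ ^ 2) ^ 2 * (X z * Y z))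
      ∂(gaussianPi (Fin k ⊕ Fin k)) := by
    refine integral_congr_ae (Eventually.of_forall fun z => ?_)
    simp only [pow_one, quadratic_correlated, X, Y, B]
    ring
  have i1 := ((hX.pow 2).integrable.const_mul (ρ ^ 2))
  have i2 := ((hX.mul hB).integrable.const_mul (2 * ρ * √(1 - ρ ^ 2)))
  have i3 := ((hX.mul hY).integrable.const_mul (√(1 - ρ ^ 2) ^ 2))
  have i12 : Integrable (fun z => ρ ^ 2 * X z ^ 2 + 2 * ρ * √(1 - ρ ^ 2) * (X z * B z))
    (gaussianPi (Fin k ⊕ Fin k)) := i1.add i2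
  rw [h1, integral_add i12 i3, integral_add i1 i2, integral_const_mul, integral_const_mul,
    integral_const_mul, h0, hXX, hXY, hσ, tMoment_two, tMoment_one]
  ring

end PairMoment

end StackedMI

/-! ### Convergence of moments by truncation, and of the mean and variance of `tHat` -/

namespace StackedMI

section Truncation

/-- Truncation of a real number to `[-c, c]`. -/
noncomputable def clamp (c x : ℝ) : ℝ := max (-c) (min c x)

/-- The part of `x ^ (2 τ)` cut off by truncation at level `c`. -/
noncomputable def tailPow (τ : ℕ) (c x : ℝ) : ℝ := if c < |x| then x ^ (2 * τ) else 0

theorem continuous_clamp (c : ℝ) : Continuous (clamp c) := by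
  unfold clamp; fun_prop

theorem clamp_of_abs_le {c x : ℝ} (h : |x| ≤ c) : clamp c x = x := by
  obtain ⟨h1, h2⟩ := abs_le.1 h
  rw [clamp, min_eq_right h2, max_eq_right h1]

theorem abs_clamp_le {c : ℝ} (hc : 0 ≤ c) (x : ℝ) : |clamp c x| ≤ c :=
  abs_le.2 ⟨le_max_left _ _, max_le (by linarith) (min_le_left _ _)⟩

theorem abs_clamp_le_abs {c : ℝ} (hc : 0 ≤ c) (x : ℝ) : |clamp c x| ≤ |x| := by
  by_cases h : |x| ≤ c
  · rw [clamp_of_abs_le h]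
  · exact (abs_clamp_le hc x).trans (not_le.1 h).le

theorem tailPow_nonneg (τ : ℕ) (c x : ℝ) : 0 ≤ tailPow τ c x := by
  unfold tailPow
  split_ifs
  · exact (even_two_mul τ).pow_nonneg x
  · exact le_rfl

theorem tailPow_le (τ : ℕ) (c x : ℝ) : tailPow τ c x ≤ x ^ (2 * τ) := by
  unfold tailPow
  split_ifs
  · exact le_rfl
  · exact (even_two_mul τ).pow_nonneg x

theorem measurable_tailPow (τ : ℕ) (c : ℝ) : Measurable (tailPow τ c) :=
  Measurable.ite (measurableSet_lt measurable_const measurable_id.abs) (by fun_prop)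
    measurable_const

/-- The level `c ≥ 1` gives `|x| ^ τ ≤ |x| ^ (2 * τ)` beyond it. The variable `y` is present only to
fit the two-variable format of `tendsto_integral_of_truncation`. -/
theorem abs_pow_sub_clamp_le (τ : ℕ) {c : ℝ} (hc : 1 ≤ c) (x y : ℝ) :
    |x ^ τ - clamp c x ^ τ| ≤ 2 * (tailPow τ c x + tailPow τ c y) := by
  have h0 : 0 ≤ c := zero_le_one.trans hc
  have hy := tailPow_nonneg τ c y
  by_cases h : |x| ≤ c
  · rw [clamp_of_abs_le h, sub_self, abs_zero]
    have := tailPow_nonneg τ c x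
    positivity
  · have hx : tailPow τ c x = |x| ^ (2 * τ) := by
      rw [tailPow, if_pos (not_le.1 h), (even_two_mul τ).pow_abs]
    have h1 : |x| ^ τ ≤ |x| ^ (2 * τ) :=
      pow_le_pow_right₀ (hc.trans (not_le.1 h).le) (by omega)
    have h2 : |clamp c x| ^ τ ≤ |x| ^ τ := pow_le_pow_left₀ (abs_nonneg _) (abs_clamp_le_abs h0 x) τ
    calc |x ^ τ - clamp c x ^ τ| ≤ |x ^ τ| + |clamp c x ^ τ| := abs_sub _ _
      _ ≤ |x| ^ (2 * τ) + |x| ^ (2 * τ) := by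
        rw [abs_pow, abs_pow]
        exact add_le_add h1 (h2.trans h1)
      _ ≤ _ := by rw [hx]; linarith

/-- If `|y| ≤ |x|`, both products are at most `|x| ^ (2 * τ)`, and they coincide unless `|x|`
exceeds `c`. -/
theorem abs_pow_mul_pow_sub_clamp_le (τ : ℕ) {c : ℝ} (hc : 0 ≤ c) (x y : ℝ) :
    |x ^ τ * y ^ τ - clamp c x ^ τ * clamp c y ^ τ| ≤ 2 * (tailPow τ c x + tailPow τ c y) := by
  wlog hxy : |y| ≤ |x| generalizing x y
  · have := this y x (not_le.1 hxy).le
    rwa [mul_comm (y ^ τ), mul_comm (clamp c y ^ τ), add_comm (tailPow τ c y)] at this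
  have hy := tailPow_nonneg τ c y
  by_cases h : |x| ≤ c
  · rw [clamp_of_abs_le h, clamp_of_abs_le (hxy.trans h), sub_self, abs_zero]
    have := tailPow_nonneg τ c x
    positivity
  · have hx : tailPow τ c x = |x| ^ τ * |x| ^ τ := by
      rw [tailPow, if_pos (not_le.1 h), ← (even_two_mul τ).pow_abs, two_mul, pow_add]
    calc |x ^ τ * y ^ τ - clamp c x ^ τ * clamp c y ^ τ|
        ≤ |x ^ τ * y ^ τ| + |clamp c x ^ τ * clamp c y ^ τ| := abs_sub _ _
      _ = |x| ^ τ * |y| ^ τ + |clamp c x| ^ τ * |clamp c y| ^ τ := by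
        simp only [abs_mul, abs_pow]
      _ ≤ |x| ^ τ * |x| ^ τ + |x| ^ τ * |x| ^ τ := by
        have h1 := abs_clamp_le_abs hc x
        have h2 := (abs_clamp_le_abs hc y).trans hxy
        gcongr
      _ ≤ _ := by rw [hx]; linarith

theorem tendsto_clamp (x : ℝ) : Tendsto (fun c => clamp c x) atTop (𝓝 x) := by
  refine tendsto_const_nhds.congr' ?_
  filter_upwards [eventually_ge_atTop |x|] with c hc using (clamp_of_abs_le hc).symm

/-- Convergence of moments under uniform integrability: if `(T, T')` converges in distribution and
the truncation error of `φ (T, T')` is uniformly small, then `E φ (T, T')` converges. -/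
theorem tendsto_integral_of_truncation {Ω Ω' : Type*} [MeasurableSpace Ω] {P : Measure Ω}
    [IsProbabilityMeasure P] [MeasurableSpace Ω'] {μ : Measure Ω'} [IsProbabilityMeasure μ]
    {T T' : ℕ → Ω → ℝ} {Z Z' : Ω' → ℝ} {τ : ℕ}
    (h : TendstoInDistribution (fun n ω => (T n ω, T' n ω)) atTop (fun z => (Z z, Z' z))
      (fun _ => P) μ) (hT : ∀ n, Measurable (T n)) (hT' : ∀ n, Measurable (T' n))
    {φ : ℝ → ℝ → ℝ} (hφ : Continuous fun x : ℝ × ℝ => φ x.1 x.2)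
    (hcl : ∀ c, 1 ≤ c → ∀ x y, |φ x y - φ (clamp c x) (clamp c y)| ≤
      2 * (tailPow τ c x + tailPow τ c y))
    (hmono : ∀ c, 0 ≤ c → ∀ x y, |φ (clamp c x) (clamp c y)| ≤ |φ x y|)
    (hb : ∀ c, 0 ≤ c → ∃ K, ∀ x y, |φ (clamp c x) (clamp c y)| ≤ K)
    (hi : ∀ n, 1 ≤ n → Integrable (fun ω => φ (T n ω) (T' n ω)) P)
    (hZ : Integrable (fun z => φ (Z z) (Z' z)) μ)
    (i1 : ∀ n, 1 ≤ n → Integrable (fun ω => T n ω ^ (2 * τ)) P)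
    (i2 : ∀ n, 1 ≤ n → Integrable (fun ω => T' n ω ^ (2 * τ)) P)
    (u1 : ∀ ε : ℝ, 0 < ε → ∀ᶠ c in atTop, ∀ n, 1 ≤ n → ∫ ω, tailPow τ c (T n ω) ∂P ≤ ε)
    (u2 : ∀ ε : ℝ, 0 < ε → ∀ᶠ c in atTop, ∀ n, 1 ≤ n → ∫ ω, tailPow τ c (T' n ω) ∂P ≤ ε) :
    Tendsto (fun n => ∫ ω, φ (T n ω) (T' n ω) ∂P) atTop (𝓝 (∫ z, φ (Z z) (Z' z) ∂μ)) := by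
  have hcc : ∀ c, Continuous fun x : ℝ × ℝ => φ (clamp c x.1) (clamp c x.2) := fun c =>
    hφ.comp (((continuous_clamp c).comp continuous_fst).prodMk
      ((continuous_clamp c).comp continuous_snd))
  have hZm : AEMeasurable (fun z => (Z z, Z' z)) μ := h.aemeasurable_limit
  have hlimZ : Tendsto (fun c => ∫ z, φ (clamp c (Z z)) (clamp c (Z' z)) ∂μ) atTop
      (𝓝 (∫ z, φ (Z z) (Z' z) ∂μ)) := by
    refine tendsto_integral_filter_of_dominated_convergence (fun z => |φ (Z z) (Z' z)|) ?_ ?_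
      hZ.abs ?_
    · exact Eventually.of_forall fun c =>
        ((hcc c).measurable.comp_aemeasurable hZm).aestronglyMeasurable
    · filter_upwards [eventually_ge_atTop 0] with c hc
      exact Eventually.of_forall fun z => hmono c hc _ _
    · exact Eventually.of_forall fun z => (hφ.tendsto (Z z, Z' z)).comp
        ((tendsto_clamp (Z z)).prodMk_nhds (tendsto_clamp (Z' z)))
  rw [Metric.tendsto_nhds]
  intro ε hε
  -- Two tails of `ε / 16`, with the factor `2` of `hcl`, give a truncation error of `ε / 4`
  -- uniformly in `n ≥ 1`. The truncation error of the limit and the weak convergence error take `ε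
  -- / 4` each.
  obtain ⟨c, hc1, hc2, hc3, hc4⟩ := ((eventually_ge_atTop (1 : ℝ)).and
    ((u1 (ε / 16) (by positivity)).and ((u2 (ε / 16) (by positivity)).and
      (Metric.tendsto_nhds.1 hlimZ (ε / 4) (by positivity))))).exists
  obtain ⟨K, hK⟩ := hb c (zero_le_one.trans hc1)
  let g : BoundedContinuousFunction (ℝ × ℝ) ℝ :=
    BoundedContinuousFunction.ofNormedAddCommGroup _ (hcc c) K fun x => hK _ _
  have hg := (ProbabilityMeasure.tendsto_iff_forall_integral_tendsto.1 h.tendsto) g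
  have hg' : Tendsto (fun n => ∫ ω, φ (clamp c (T n ω)) (clamp c (T' n ω)) ∂P) atTop
      (𝓝 (∫ z, φ (clamp c (Z z)) (clamp c (Z' z)) ∂μ)) := by
    have e1 : ∫ x, g x ∂(μ.map fun z => (Z z, Z' z)) =
        ∫ z, φ (clamp c (Z z)) (clamp c (Z' z)) ∂μ :=
      integral_map hZm (hcc c).aestronglyMeasurable
    rw [← e1]
    refine hg.congr fun n => ?_
    exact integral_map ((hT n).prodMk (hT' n)).aemeasurable (hcc c).aestronglyMeasurable
  filter_upwards [eventually_ge_atTop 1, Metric.tendsto_nhds.1 hg' (ε / 4) (by positivity)]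
    with n hn hn2
  have it1 : Integrable (fun ω => tailPow τ c (T n ω)) P :=
    (i1 n hn).mono' ((measurable_tailPow τ c).comp (hT n)).aestronglyMeasurable
      (Eventually.of_forall fun ω => by
        rw [Real.norm_of_nonneg (tailPow_nonneg _ _ _)]; exact tailPow_le _ _ _)
  have it2 : Integrable (fun ω => tailPow τ c (T' n ω)) P :=
    (i2 n hn).mono' ((measurable_tailPow τ c).comp (hT' n)).aestronglyMeasurable
      (Eventually.of_forall fun ω => by
        rw [Real.norm_of_nonneg (tailPow_nonneg _ _ _)]; exact tailPow_le _ _ _)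
  have ig : Integrable (fun ω => φ (clamp c (T n ω)) (clamp c (T' n ω))) P :=
    Integrable.of_bound (((hcc c).measurable.comp
      ((hT n).prodMk (hT' n))).aestronglyMeasurable) K (Eventually.of_forall fun ω => hK _ _)
  have herr : |∫ ω, φ (T n ω) (T' n ω) ∂P -
      ∫ ω, φ (clamp c (T n ω)) (clamp c (T' n ω)) ∂P| ≤ ε / 4 := by
    rw [← integral_sub (hi n hn) ig]
    calc |∫ ω, (φ (T n ω) (T' n ω) - φ (clamp c (T n ω)) (clamp c (T' n ω))) ∂P|
        ≤ ∫ ω, |φ (T n ω) (T' n ω) - φ (clamp c (T n ω)) (clamp c (T' n ω))| ∂P :=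
          abs_integral_le_integral_abs
      _ ≤ ∫ ω, 2 * (tailPow τ c (T n ω) + tailPow τ c (T' n ω)) ∂P :=
          integral_mono ((hi n hn).sub ig).abs ((it1.add it2).const_mul 2)
            fun ω => hcl c hc1 _ _
      _ = 2 * (∫ ω, tailPow τ c (T n ω) ∂P + ∫ ω, tailPow τ c (T' n ω) ∂P) := by
          rw [integral_const_mul, integral_add it1 it2]
      _ ≤ ε / 4 := by linarith [hc2 n hn, hc3 n hn]
  rw [Real.dist_eq] at *
  calc |∫ ω, φ (T n ω) (T' n ω) ∂P - ∫ z, φ (Z z) (Z' z) ∂μ| ≤ _ + _ + _ :=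
        (abs_sub_le _ (∫ z, φ (clamp c (Z z)) (clamp c (Z' z)) ∂μ) _).trans
          (add_le_add (abs_sub_le _ (∫ ω, φ (clamp c (T n ω)) (clamp c (T' n ω)) ∂P) _) le_rfl)
    _ < ε := by linarith

end Truncation

variable {p k q m : ℕ} {M : Model p k q} {Ω : Type*} [MeasurableSpace Ω] {P : Measure Ω}
  {A : Analyst M} {E : Imputation M m Ω P} {ψlim : Param k q}
  {iFull : Matrix (Fin k ⊕ Fin q) (Fin k ⊕ Fin q) ℝ} {iMis : Matrix (Fin k) (Fin k) ℝ}
  {H : Fin A.dim → ℝ}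

theorem lintegral_tail {t : Test} (hM : MeasurableStatistics A E t) (τ n : ℕ) (c : ℝ)
    {Q : Finset (Fin m) × Finset (Fin m)} (hQ : Q ∈ pairs m) :
    ∫⁻ ω in {ω | c < |E.THat A t n Q ω|}, ENNReal.ofReal (E.THat A t n Q ω ^ (2 * τ)) ∂P =
      ∫⁻ ω, ENNReal.ofReal (tailPow τ c (E.THat A t n Q ω)) ∂P := by
  rw [← lintegral_indicator (measurableSet_lt measurable_const (measurable_THat hM n hQ).abs)]
  refine lintegral_congr fun ω => ?_
  by_cases h : c < |E.THat A t n Q ω|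
  · rw [Set.indicator_of_mem (show ω ∈ {ω | c < |E.THat A t n Q ω|} from h), tailPow, if_pos h]
  · rw [Set.indicator_of_notMem (show ω ∉ {ω | c < |E.THat A t n Q ω|} from h), tailPow, if_neg h,
      ENNReal.ofReal_zero]

theorem eventually_integral_tail_le {t : Test} {τ : ℕ} (hM : MeasurableStatistics A E t)
    (hU : UniformlyIntegrablePow A E t τ) {Q : Finset (Fin m) × Finset (Fin m)} (hQ : Q ∈ pairs m)
    {ε : ℝ} (hε : 0 < ε) :
    ∀ᶠ c in atTop, ∀ n, 1 ≤ n → ∫ ω, tailPow τ c (E.THat A t n Q ω) ∂P ≤ ε := by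
  filter_upwards [ENNReal.tendsto_nhds_zero.1 (hU Q hQ) (ENNReal.ofReal ε)
    (ENNReal.ofReal_pos.2 hε)] with c hc n hn
  rw [integral_eq_lintegral_of_nonneg_ae (Eventually.of_forall fun ω => tailPow_nonneg _ _ _)
    ((measurable_tailPow τ c).comp (measurable_THat hM n hQ)).aestronglyMeasurable]
  refine ENNReal.toReal_le_of_le_ofReal hε.le (le_trans ?_ hc)
  rw [← lintegral_tail hM τ n c hQ]
  exact le_iSup₂ (f := fun (n : ℕ) (_ : 1 ≤ n) => ∫⁻ ω in {ω | c < |E.THat A t n Q ω|},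
    ENNReal.ofReal (E.THat A t n Q ω ^ (2 * τ)) ∂P) n hn

theorem integrable_THat_pow [IsProbabilityMeasure P] {t : Test} {τ : ℕ}
    (hM : MeasurableStatistics A E t) (hU : UniformlyIntegrablePow A E t τ)
    {Q : Finset (Fin m) × Finset (Fin m)} (hQ : Q ∈ pairs m) {n : ℕ} (hn : 1 ≤ n) :
    Integrable (fun ω => E.THat A t n Q ω ^ (2 * τ)) P := by
  -- One level with a finite tail suffices. Its sign is unknown, whence `|c|` in the bound below.
  obtain ⟨c, hc⟩ := (ENNReal.tendsto_nhds_zero.1 (hU Q hQ) 1 one_pos).exists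
  have h1 : ∫⁻ ω, ENNReal.ofReal (tailPow τ c (E.THat A t n Q ω)) ∂P ≤ 1 := by
    rw [← lintegral_tail hM τ n c hQ]
    exact (le_iSup₂ (f := fun (n : ℕ) (_ : 1 ≤ n) => ∫⁻ ω in {ω | c < |E.THat A t n Q ω|},
      ENNReal.ofReal (E.THat A t n Q ω ^ (2 * τ)) ∂P) n hn).trans hc
  have hm := measurable_THat (P := P) hM n hQ
  have h2 : Integrable (fun ω => tailPow τ c (E.THat A t n Q ω)) P := by
    refine ⟨((measurable_tailPow τ c).comp hm).aestronglyMeasurable, ?_⟩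
    rw [hasFiniteIntegral_iff_ofReal (Eventually.of_forall fun ω => tailPow_nonneg _ _ _)]
    exact h1.trans_lt ENNReal.one_lt_top
  refine ((integrable_const (|c| ^ (2 * τ))).add h2).mono' (hm.pow_const _).aestronglyMeasurable
    (Eventually.of_forall fun ω => ?_)
  rw [Real.norm_of_nonneg ((even_two_mul τ).pow_nonneg _), Pi.add_apply, tailPow]
  split_ifs with h
  · exact le_add_of_nonneg_left (by positivity)
  · rw [add_zero, ← (even_two_mul τ).pow_abs]
    exact pow_le_pow_left₀ (abs_nonneg _) ((not_lt.1 h).trans (le_abs_self c)) _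

theorem memLp_THat_pow [IsProbabilityMeasure P] {t : Test} {τ : ℕ}
    (hM : MeasurableStatistics A E t) (hU : UniformlyIntegrablePow A E t τ)
    {Q : Finset (Fin m) × Finset (Fin m)} (hQ : Q ∈ pairs m) {n : ℕ} (hn : 1 ≤ n) :
    MemLp (fun ω => E.THat A t n Q ω ^ τ) 2 P := by
  rw [memLp_two_iff_integrable_sq ((measurable_THat hM n hQ).pow_const τ).aestronglyMeasurable]
  simpa only [← pow_mul, mul_comm τ 2] using integrable_THat_pow hM hU hQ hn

theorem integrable_limit_pow {k : ℕ} (r : Fin k → ℝ) (τ : ℕ) :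
    AllMoments fun z : Fin k ⊕ Fin k → ℝ => (∑ j, r j * z (Sum.inl j) ^ 2) ^ τ := by
  simpa only [← pow_two] using (allMoments_quadratic r Sum.inl Sum.inl).pow τ

theorem memLp_tHat [IsProbabilityMeasure P] {t : Test} {τ : ℕ}
    (hM : MeasurableStatistics A E t)
    (hU : UniformlyIntegrablePow A E t τ)
    {Λ : Finset (Finset (Fin m) × Finset (Fin m))} (hΛ : Λ ⊆ pairs m) {n : ℕ} (hn : 1 ≤ n) :
    MemLp (E.tHat A t τ Λ n) 2 P :=
  (memLp_finsetSum Λ fun _ hQ => memLp_THat_pow hM hU (hΛ hQ) hn).const_mul _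

variable [StandardBorelSpace Ω] [IsProbabilityMeasure P] {r : Fin k → ℝ} {t : Test} {τ : ℕ}

/-- The joint limit is applied to the pair `(Q, Q)` with a test function that ignores the second
component. -/
theorem tendsto_integral_THat_pow (hM : MeasurableStatistics A E t)
    (hR : Regular A E ψlim iFull iMis H) (hLA : LocalAlternative E) (hP : ProperImputation A E)
    (hU : UniformlyIntegrablePow A E t τ) (hr : IsOMI iFull.toBlocks₁₁ iMis r)
    {Q : Finset (Fin m) × Finset (Fin m)} (hQ : Q ∈ pairs m) :
    Tendsto (fun n => ∫ ω, E.THat A t n Q ω ^ τ ∂P) atTop (𝓝 (tMoment r τ)) := by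
  have h := tendstoInDistribution_THat hM hR hLA hP hr hQ hQ
  have key := tendsto_integral_of_truncation (τ := τ) (φ := fun x _ => x ^ τ) h
    (fun n => measurable_THat hM n hQ) (fun n => measurable_THat hM n hQ) (by fun_prop)
    (fun c hc x y => abs_pow_sub_clamp_le τ hc x y)
    (fun c hc x y => by
      rw [abs_pow, abs_pow]
      exact pow_le_pow_left₀ (abs_nonneg _) (abs_clamp_le_abs hc x) τ)
    (fun c hc => ⟨c ^ τ, fun x y => by
      rw [abs_pow]
      exact pow_le_pow_left₀ (abs_nonneg _) (abs_clamp_le hc x) τ⟩)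
    (fun n hn => (memLp_THat_pow hM hU hQ hn).integrable (by norm_num))
    (integrable_limit_pow r τ).integrable
    (fun n hn => integrable_THat_pow hM hU hQ hn) (fun n hn => integrable_THat_pow hM hU hQ hn)
    (fun ε hε => eventually_integral_tail_le hM hU hQ hε)
    (fun ε hε => eventually_integral_tail_le hM hU hQ hε)
  have e := integral_pow_mul_pow r τ 0
  have h1 : tMoment r 0 = 1 := by simp [tMoment]
  simp only [pow_zero, mul_one, h1] at e
  rwa [e] at key

theorem tendsto_integral_THat_pow_mul (hM : MeasurableStatistics A E t)
    (hR : Regular A E ψlim iFull iMis H) (hLA : LocalAlternative E) (hP : ProperImputation A E)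
    (hU : UniformlyIntegrablePow A E t τ) (hr : IsOMI iFull.toBlocks₁₁ iMis r)
    {Q Q' : Finset (Fin m) × Finset (Fin m)} (hQ : Q ∈ pairs m) (hQ' : Q' ∈ pairs m) :
    Tendsto (fun n => ∫ ω, E.THat A t n Q ω ^ τ * E.THat A t n Q' ω ^ τ ∂P) atTop
      (𝓝 (pairMoment r τ (rho Q Q'))) := by
  have h := tendstoInDistribution_THat hM hR hLA hP hr hQ hQ'
  refine tendsto_integral_of_truncation (τ := τ) (φ := fun x y => x ^ τ * y ^ τ) h
    (fun n => measurable_THat hM n hQ) (fun n => measurable_THat hM n hQ') (by fun_prop)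
    (fun c hc x y => abs_pow_mul_pow_sub_clamp_le τ (zero_le_one.trans hc) x y)
    (fun c hc x y => by
      simp only [abs_mul, abs_pow]
      have h1 := abs_clamp_le_abs hc x
      have h2 := abs_clamp_le_abs hc y
      gcongr)
    (fun c hc => ⟨c ^ τ * c ^ τ, fun x y => by
      simp only [abs_mul, abs_pow]
      have h1 := abs_clamp_le hc x
      have h2 := abs_clamp_le hc y
      gcongr⟩)
    (fun n hn => (memLp_THat_pow hM hU hQ hn).integrable_mul (memLp_THat_pow hM hU hQ' hn))
    ?_
    (fun n hn => integrable_THat_pow hM hU hQ hn) (fun n hn => integrable_THat_pow hM hU hQ' hn)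
    (fun ε hε => eventually_integral_tail_le hM hU hQ hε)
    (fun ε hε => eventually_integral_tail_le hM hU hQ' hε)
  refine AllMoments.integrable ((integrable_limit_pow r τ).mul (AllMoments.pow ?_ τ))
  refine AllMoments.sum _ fun j _ => (AllMoments.const _).mul (AllMoments.pow ?_ 2)
  exact ((AllMoments.const _).mul (AllMoments.coord _)).add
    ((AllMoments.const _).mul (AllMoments.coord _))

theorem tendsto_integral_tHat (hM : MeasurableStatistics A E t)
    (hR : Regular A E ψlim iFull iMis H) (hLA : LocalAlternative E) (hP : ProperImputation A E)
    (hU : UniformlyIntegrablePow A E t τ) (hr : IsOMI iFull.toBlocks₁₁ iMis r)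
    {Λ : Finset (Finset (Fin m) × Finset (Fin m))} (hne : Λ.Nonempty) (hΛ : Λ ⊆ pairs m) :
    Tendsto (fun n => ∫ ω, E.tHat A t τ Λ n ω ∂P) atTop (𝓝 (tMoment r τ)) := by
  have h1 := (tendsto_finsetSum Λ fun Q hQ =>
    tendsto_integral_THat_pow hM hR hLA hP hU hr (hΛ hQ)).const_mul (Λ.card : ℝ)⁻¹
  have hc : (Λ.card : ℝ) ≠ 0 := by exact_mod_cast hne.card_pos.ne'
  rw [Finset.sum_const, nsmul_eq_mul, inv_mul_cancel_left₀ hc] at h1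
  refine h1.congr' ?_
  filter_upwards [eventually_ge_atTop 1] with n hn
  simp only [Imputation.tHat]
  rw [integral_const_mul, integral_finsetSum _ fun Q hQ =>
    (memLp_THat_pow hM hU (hΛ hQ) hn).integrable (by norm_num)]

theorem tendsto_variance_tHat (hM : MeasurableStatistics A E t)
    (hR : Regular A E ψlim iFull iMis H) (hLA : LocalAlternative E) (hP : ProperImputation A E)
    (hU : UniformlyIntegrablePow A E t τ) (hr : IsOMI iFull.toBlocks₁₁ iMis r)
    {Λ : Finset (Finset (Fin m) × Finset (Fin m))} (hne : Λ.Nonempty) (hΛ : Λ ⊆ pairs m) :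
    Tendsto (fun n => variance (E.tHat A t τ Λ n) P) atTop
      (𝓝 (((Λ.card : ℝ) ^ 2)⁻¹ *
        ∑ Q ∈ Λ, ∑ Q' ∈ Λ, (pairMoment r τ (rho Q Q') - tMoment r τ ^ 2))) := by
  have h1 := (tendsto_finsetSum Λ fun Q hQ => tendsto_finsetSum Λ fun Q' hQ' =>
    tendsto_integral_THat_pow_mul hM hR hLA hP hU hr (hΛ hQ) (hΛ hQ')).const_mul
      ((Λ.card : ℝ) ^ 2)⁻¹
  have h2 := h1.sub ((tendsto_integral_tHat hM hR hLA hP hU hr hne hΛ).pow 2)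
  have hc : (Λ.card : ℝ) ≠ 0 := by exact_mod_cast hne.card_pos.ne'
  have e : ((Λ.card : ℝ) ^ 2)⁻¹ *
      ∑ Q ∈ Λ, ∑ Q' ∈ Λ, (pairMoment r τ (rho Q Q') - tMoment r τ ^ 2) =
      ((Λ.card : ℝ) ^ 2)⁻¹ * ∑ Q ∈ Λ, ∑ Q' ∈ Λ, pairMoment r τ (rho Q Q') - tMoment r τ ^ 2 := by
    simp only [Finset.sum_sub_distrib, Finset.sum_const, nsmul_eq_mul]
    field_simp
  rw [e]
  refine h2.congr' ?_
  filter_upwards [eventually_ge_atTop 1] with n hn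
  rw [variance_eq_sub (memLp_tHat hM hU hΛ hn)]
  congr 1
  have e2 : ∀ ω, (E.tHat A t τ Λ n ^ 2) ω = ((Λ.card : ℝ) ^ 2)⁻¹ *
      ∑ Q ∈ Λ, ∑ Q' ∈ Λ, E.THat A t n Q ω ^ τ * E.THat A t n Q' ω ^ τ := fun ω => by
    rw [Pi.pow_apply, Imputation.tHat, mul_pow, inv_pow, pow_two (∑ Q ∈ Λ, _), Finset.sum_mul_sum]
  have hint : ∀ Q ∈ Λ, ∀ Q' ∈ Λ,
      Integrable (fun ω => E.THat A t n Q ω ^ τ * E.THat A t n Q' ω ^ τ) P := fun Q hQ Q' hQ' =>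
    (memLp_THat_pow hM hU (hΛ hQ) hn).integrable_mul (memLp_THat_pow hM hU (hΛ hQ') hn)
  simp only [e2]
  rw [integral_const_mul, integral_finsetSum _ fun Q hQ => integrable_finsetSum _ fun Q' hQ' =>
    hint Q hQ Q' hQ']
  congr 1
  exact Finset.sum_congr rfl fun Q hQ =>
    (integral_finsetSum _ fun Q' hQ' => hint Q hQ Q' hQ').symm

end StackedMI

/-! ### The constants `C` -/

theorem theorem2 (k : ℕ) (r : Fin k → ℝ) (τ : ℕ) :
    ∃ (K : ℝ) (C : (m : ℕ) → Finset (Fin m) × Finset (Fin m) →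
        Finset (Fin m) × Finset (Fin m) → ℝ),
      (∀ m, ∀ Q ∈ StackedMI.pairs m, ∀ Q' ∈ StackedMI.pairs m,
        |C m Q Q'| ≤ K ∧ (τ = 1 → C m Q Q' = 2 * StackedMI.powerSum r 2)) ∧
      ∀ (p q m : ℕ) (_ : 1 < m) (M : StackedMI.Model p k q) (A : StackedMI.Analyst M)
        (t : StackedMI.Test)
        (Ω : Type*) [MeasurableSpace Ω] [StandardBorelSpace Ω]
        (P : Measure Ω) [IsProbabilityMeasure P] (E : StackedMI.Imputation M m Ω P)
        (ψlim : StackedMI.Param k q)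
        (iFull : Matrix (Fin k ⊕ Fin q) (Fin k ⊕ Fin q) ℝ)
        (iMis : Matrix (Fin k) (Fin k) ℝ) (H : Fin A.dim → ℝ),
        StackedMI.MeasurableStatistics A E t →
        StackedMI.Regular A E ψlim iFull iMis H →
        StackedMI.LocalAlternative E →
        StackedMI.NormalObsMLE E →
        StackedMI.ProperImputation A E →
        StackedMI.UniformlyIntegrablePow A E t τ →
        StackedMI.IsOMI iFull.toBlocks₁₁ iMis r →
        ∀ Λ : Finset (Finset (Fin m) × Finset (Fin m)), Λ.Nonempty → Λ ⊆ StackedMI.pairs m →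
          (∀ n, 1 ≤ n → MemLp (E.tHat A t τ Λ n) 2 P) ∧
          Tendsto (fun n => ∫ ω, E.tHat A t τ Λ n ω ∂P) atTop
            (𝓝 (StackedMI.tMoment r τ)) ∧
          Tendsto (fun n => variance (E.tHat A t τ Λ n) P) atTop
            (𝓝 (((Λ.card : ℝ) ^ 2)⁻¹ *
              ∑ Q ∈ Λ, ∑ Q' ∈ Λ, StackedMI.rho Q Q' ^ 2 * C m Q Q')) := by
  obtain ⟨K, hK⟩ := StackedMI.exists_abs_pairMoment_sub_le r τ
  -- `C` is the limiting covariance divided by `ρ ^ 2`, with the default value `0` when `ρ = 0`. For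
  -- `τ = 1` this default would be wrong, so the exact value is set separately, and the bound takes
  -- the maximum of both cases.
  refine ⟨max K |2 * StackedMI.powerSum r 2|, fun m Q Q' =>
    if τ = 1 then 2 * StackedMI.powerSum r 2
    else (StackedMI.pairMoment r τ (StackedMI.rho Q Q') - StackedMI.tMoment r τ ^ 2) /
      StackedMI.rho Q Q' ^ 2, fun m Q hQ Q' hQ' => ⟨?_, fun h => if_pos h⟩, ?_⟩
  · beta_reduce
    split_ifs with h
    · exact le_max_right _ _
    · by_cases h0 : StackedMI.rho Q Q' = 0
      · rw [h0]
        simp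
      · have h1 : 0 < StackedMI.rho Q Q' ^ 2 := by positivity
        rw [abs_div, abs_of_pos h1, div_le_iff₀ h1, mul_comm]
        refine (hK _ (StackedMI.abs_rho_le_one hQ hQ')).trans ?_
        exact mul_le_mul_of_nonneg_left (le_max_left _ _) h1.le
  · intro p q m _ M A t Ω _ _ P _ E ψlim iFull iMis H hM hR hLA _ hP hU hr Λ hne hΛ
    refine ⟨fun n hn => StackedMI.memLp_tHat hM hU hΛ hn,
      StackedMI.tendsto_integral_tHat hM hR hLA hP hU hr hne hΛ, ?_⟩
    have h1 := StackedMI.tendsto_variance_tHat hM hR hLA hP hU hr hne hΛ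
    refine cast (congrArg (fun x => Tendsto _ atTop (𝓝 (((Λ.card : ℝ) ^ 2)⁻¹ * x))) ?_) h1
    refine Finset.sum_congr rfl fun Q hQ => Finset.sum_congr rfl fun Q' hQ' => ?_
    have hρ := StackedMI.abs_rho_le_one (hΛ hQ) (hΛ hQ')
    split_ifs with h
    · subst h
      exact StackedMI.pairMoment_one r hρ
    -- When `ρ = 0` the bound `ρ ^ 2 * K` forces the covariance itself to vanish, so the default
    -- value of `C` does no harm.
    · by_cases h0 : StackedMI.rho Q Q' = 0
      · have h2 := hK _ hρ
        rw [h0, zero_pow two_ne_zero, zero_mul] at h2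
        rw [h0, zero_pow two_ne_zero, zero_mul]
        exact abs_nonpos_iff.1 h2
      · rw [mul_div_cancel₀]
        positivity
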